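/- **Setting.** Let $e_0,\dots,e_3$ be the canonical basis of $\mathbb{R}^4$ and let $\omega_i$ be the orthogonal projection of $\mathbb{R}^4$ onto the span of $\{e_j : j\neq i\}$. A *tiling by parallelograms* with pairwise non-collinear edge vectors $v_0,\dots,v_3\in\mathbb{R}^2$ is a covering of the plane by translates of the parallelograms $T_{jk}=\{\lambda v_j+\mu v_k: 0\le\lambda,\mu\le 1\}$ ($j<k$), with pairwise disjoint interiors, in which any two tiles meet in the empty set, a common vertex or a common entire edge. A *lift* of such a tiling sends each tile of type $T_{jk}$ to a unit face of the grid $\mathbb{Z}^4$ generated by $e_j,e_k$, so that tiles adjacent along an edge $v_j$ go to faces adjacent along the corresponding edge $e_j$; it is unique up to a translation. The *$i$-shadow* of the tiling is the image under $\omega_i$ of the union of these faces. A set $S$ is *$q$-periodic* if $S+q=S$. Let $V\subset\mathbb{R}^4$ be a $2$-dimensional linear subspace (a *slope*). A *cutting plane* of slope $V$ is an affine plane $E$ parallel to $V$ with $E\cap\mathbb{Z}^4=\emptyset$; it selects the two-dimensional unit faces of $\mathbb{Z}^4$ contained in the tube $E+[0,1]^4$. A vector $p\in V$ is an *$i$-subperiod*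 of $V$ if, for the cutting planes $E$ of slope $V$, $\omega_i(p)$ is a prime period (a nonzero integer period which is not a proper multiple of another integer period) of the image under $\omega_i$ of the union of the selected faces. The slope $V$ is *characterized by subperiods* $p_0,\dots,p_3$ if $p_i$ is an $i$-subperiod of $V$ for each $i$ and only finitely many slopes $V'$ have, for every $i$, an $i$-subperiod $p_i'$ with $\omega_i(p_i')=\omega_i(p_i)$. A linear map $\pi:\mathbb{R}^4\to\mathbb{R}^2$ is *valid* for a cutting plane $E$ if the images under $\pi$ of the selected faces form a tiling by parallelograms with edge vectors $\pi(e_j)$ (distinct faces giving distinct tiles); it is *fine* if moreover $\pi(p_i)$ and $\pi(e_i)$ are collinear for every $i\in\{0,1,2,3\}$. The *FP-tileset* $\mathcal{T}$ obtained from $E$, $\pi$ and $p_0,\dots,p_3$ is constructed as follows: through every vertex of the tiling obtained from $E$ by $\pi$, draw the four lines directed by $\pi(p_0),\dots,\pi(p_3)$; these decorate each tile with segments in (at most) four directions, and $\mathcal{T}$ is the set of all the decorated tiles so obtained, up to translation. A tiling by tiles of $\mathcal{T}$ *respects the Ammann-bar rules* if every segment of each direction is prolonged by segments of the same direction on adjacent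 tiles, so as to form a full straight line. **Lemma.** Let $V\subset\mathbb{R}^4$ be a $2$-dimensional slope which is totally irrational (it contains no nonzero rational vector) and characterized by subperiods $p_0,\dots,p_3$. Let $E$ be a cutting plane of slope $V$, let $\pi$ be a fine projection for $E$, and let $\mathcal{T}$ be the FP-tileset obtained from them. Then for every tiling of the plane by parallelograms composed of translates of tiles of $\mathcal{T}$ and respecting the Ammann-bar rules, the $i$-shadow of the tiling is $\omega_i(p_i)$-periodic for every $i\in\{0,1,2,3\}$. -/

import Mathlib

namespace FPTiling

/-! ### Tilings of the plane by parallelograms -/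

/-- A parallelogram tile: the prototile spanned by `v fst` and `v snd`, translated by `base`. -/
structure Tile where
  base : Fin 2 → ℝ
  fst : Fin 4
  snd : Fin 4

/-- The parallelogram spanned by two vectors, with a corner at the origin. -/
def parallelogram (a b : Fin 2 → ℝ) : Set (Fin 2 → ℝ) :=
  {z | ∃ s ∈ Set.Icc (0 : ℝ) 1, ∃ t ∈ Set.Icc (0 : ℝ) 1, z = s • a + t • b}

/-- The region of the plane covered by a tile. -/
def Tile.region (v : Fin 4 → Fin 2 → ℝ) (τ : Tile) : Set (Fin 2 → ℝ) :=
  (fun z => τ.base + z) '' parallelogram (v τ.fst) (v τ.snd)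

/-- The four corners of a tile. -/
def Tile.vertices (v : Fin 4 → Fin 2 → ℝ) (τ : Tile) : Set (Fin 2 → ℝ) :=
  {τ.base, τ.base + v τ.fst, τ.base + v τ.snd, τ.base + v τ.fst + v τ.snd}

/-- The four sides of a tile. -/
def Tile.edges (v : Fin 4 → Fin 2 → ℝ) (τ : Tile) : Set (Set (Fin 2 → ℝ)) :=
  {segment ℝ τ.base (τ.base + v τ.fst),
   segment ℝ τ.base (τ.base + v τ.snd),
   segment ℝ (τ.base + v τ.fst) (τ.base + v τ.fst + v τ.snd),
   segment ℝ (τ.base + v τ.snd) (τ.base + v τ.fst + v τ.snd)}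

/-- A family of tiles is an edge-to-edge tiling of the plane by parallelograms: the vectors `v j`
are pairwise non-collinear, the tiles cover the plane, they have pairwise disjoint interiors, and
two of them meet in the empty set, a common vertex or a common entire edge. -/
structure IsTiling (v : Fin 4 → Fin 2 → ℝ) {ι : Type} (tile : ι → Tile) : Prop where
  noncollinear : ∀ j k, j ≠ k → LinearIndependent ℝ ![v j, v k]
  ordered : ∀ a, (tile a).fst < (tile a).snd
  cover : (⋃ a, (tile a).region v) = Set.univ
  disjoint : ∀ a b, a ≠ b →
    Disjoint (interior ((tile a).region v)) (interior ((tile b).region v))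
  edge_to_edge : ∀ a b, a ≠ b →
    (tile a).region v ∩ (tile b).region v = ∅ ∨
    (∃ x ∈ (tile a).vertices v ∩ (tile b).vertices v,
      (tile a).region v ∩ (tile b).region v = {x}) ∨
    (tile a).region v ∩ (tile b).region v ∈ (tile a).edges v ∩ (tile b).edges v

/-! ### Faces, stepped surfaces and shadows in `ℝ⁴` -/

/-- An integer vector, seen in `ℝ⁴`. -/
def intVec (m : Fin 4 → ℤ) : Fin 4 → ℝ := fun j => (m j : ℝ)

/-- The canonical basis of `ℝ⁴`. -/
def e (j : Fin 4) : Fin 4 → ℝ := Pi.single j 1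

/-- A two-dimensional face of the cubical grid `ℤ⁴`: `base + [0,1] e_fst + [0,1] e_snd`. -/
structure Face where
  base : Fin 4 → ℤ
  fst : Fin 4
  snd : Fin 4

/-- The points of a face. -/
def Face.carrier (f : Face) : Set (Fin 4 → ℝ) :=
  {x | ∃ s ∈ Set.Icc (0 : ℝ) 1, ∃ t ∈ Set.Icc (0 : ℝ) 1,
    x = intVec f.base + s • e f.fst + t • e f.snd}

/-- The orthogonal projection `ω_i` of `ℝ⁴` onto the space generated by the `e_j`, `j ≠ i`. -/
def omega (i : Fin 4) (x : Fin 4 → ℝ) : Fin 4 → ℝ := fun j => if j = i then 0 else x j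

/-- The `i`-shadow of a stepped surface. -/
def shadow (i : Fin 4) (S : Set (Fin 4 → ℝ)) : Set (Fin 4 → ℝ) := omega i '' S

/-- `S` is `q`-periodic, i.e. `S + q = S`. -/
def IsPeriod (S : Set (Fin 4 → ℝ)) (q : Fin 4 → ℝ) : Prop := ∀ x, x + q ∈ S ↔ x ∈ S

/-- A prime period: a nonzero integer period that is not a proper multiple of an integer period. -/
def IsPrimePeriod (S : Set (Fin 4 → ℝ)) (q : Fin 4 → ℝ) : Prop :=
  q ∈ Set.range intVec ∧ q ≠ 0 ∧ IsPeriod S q ∧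
    ∀ r ∈ Set.range intVec, IsPeriod S r → ∀ k : ℕ, q = k • r → k = 1

/-! ### Canonical cut and project tilings, subperiods, valid and fine projections -/

/-- The tube `E + [0,1]⁴`. -/
def tube (E : AffineSubspace ℝ (Fin 4 → ℝ)) : Set (Fin 4 → ℝ) :=
  {x | ∃ y ∈ E, ∃ u ∈ Set.Icc (0 : Fin 4 → ℝ) 1, x = y + u}

/-- `E` is an affine plane with direction `V` without integer points: the cutting planes of the
canonical cut and project tilings of slope `V`. -/
structure IsCutPlane (V : Submodule ℝ (Fin 4 → ℝ)) (E : AffineSubspace ℝ (Fin 4 → ℝ)) : Prop where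
  nonempty : (E : Set (Fin 4 → ℝ)).Nonempty
  direction : E.direction = V
  avoids : ∀ m, intVec m ∉ E

/-- The faces of `ℤ⁴` selected by the cut: those lying in the tube. -/
def canonicalFaces (E : AffineSubspace ℝ (Fin 4 → ℝ)) : Set Face :=
  {f | f.fst < f.snd ∧ f.carrier ⊆ tube E}

/-- The lift of the canonical cut and project tiling: the union of the selected faces. -/
def canonicalLift (E : AffineSubspace ℝ (Fin 4 → ℝ)) : Set (Fin 4 → ℝ) :=
  ⋃ f ∈ canonicalFaces E, f.carrier

/-- `V` contains no rational line. -/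
def TotallyIrrational (V : Submodule ℝ (Fin 4 → ℝ)) : Prop :=
  ∀ r : Fin 4 → ℚ, (fun j => (r j : ℝ)) ∈ V → r = 0

/-- `p` is an `i`-subperiod of the slope `V`: a vector of `V` which projects to a prime period of
the `i`-shadow of the canonical tilings of slope `V`. -/
def IsSubperiod (V : Submodule ℝ (Fin 4 → ℝ)) (i : Fin 4) (p : Fin 4 → ℝ) : Prop :=
  p ∈ V ∧ ∀ E, IsCutPlane V E → IsPrimePeriod (shadow i (canonicalLift E)) (omega i p)

/-- The slope `V` is characterized by the subperiods `p 0, …, p 3`: these are subperiods of `V`,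
and only finitely many slopes have the same subperiods in the shadows. -/
def IsCharacterizedBySubperiods (V : Submodule ℝ (Fin 4 → ℝ)) (p : Fin 4 → Fin 4 → ℝ) : Prop :=
  (∀ i, IsSubperiod V i (p i)) ∧
  {V' : Submodule ℝ (Fin 4 → ℝ) | Module.finrank ℝ V' = 2 ∧
    ∀ i, ∃ p', IsSubperiod V' i p' ∧ omega i p' = omega i (p i)}.Finite

/-- The plane vectors `π(e_j)`. -/
def edgeVec (π : (Fin 4 → ℝ) →ₗ[ℝ] (Fin 2 → ℝ)) (j : Fin 4) : Fin 2 → ℝ := π (e j)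

/-- The tile onto which a face is projected. -/
def Face.project (π : (Fin 4 → ℝ) →ₗ[ℝ] (Fin 2 → ℝ)) (f : Face) : Tile :=
  ⟨π (intVec f.base), f.fst, f.snd⟩

/-- `π` is valid for `E`: the projections of the selected faces tile the plane. -/
def IsValidProjection (π : (Fin 4 → ℝ) →ₗ[ℝ] (Fin 2 → ℝ))
    (E : AffineSubspace ℝ (Fin 4 → ℝ)) : Prop :=
  IsTiling (edgeVec π) (fun f : canonicalFaces E => f.1.project π)

/-- `π` is a fine projection: it is valid and `π(p_i)`, `π(e_i)` are collinear vectors. -/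
def IsFineProjection (π : (Fin 4 → ℝ) →ₗ[ℝ] (Fin 2 → ℝ))
    (E : AffineSubspace ℝ (Fin 4 → ℝ)) (p : Fin 4 → Fin 4 → ℝ) : Prop :=
  IsValidProjection π E ∧ ∀ i, Collinear ℝ {0, π (p i), π (e i)}

/-! ### The FP-tileset -/

/-- A prototile (with a corner at the origin) decorated with segments; `deco i` is the union of the
segments of the `i`-th direction. -/
structure DecoratedPrototile where
  fst : Fin 4
  snd : Fin 4
  deco : Fin 4 → Set (Fin 2 → ℝ)

/-- The line through `x` directed by `d`. -/
def lineThrough (x d : Fin 2 → ℝ) : Set (Fin 2 → ℝ) := {z | ∃ t : ℝ, z = x + t • d}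

/-- The union of the lines directed by `π(p_i)` through all vertices of the canonical tiling. -/
def ammannLines (π : (Fin 4 → ℝ) →ₗ[ℝ] (Fin 2 → ℝ)) (E : AffineSubspace ℝ (Fin 4 → ℝ))
    (p : Fin 4 → Fin 4 → ℝ) (i : Fin 4) : Set (Fin 2 → ℝ) :=
  ⋃ f ∈ canonicalFaces E, ⋃ x ∈ (f.project π).vertices (edgeVec π), lineThrough x (π (p i))

/-- The decorated prototile cut out by the lines in the tile of the face `f`, translated to have
its corner at the origin. -/
def decorate (π : (Fin 4 → ℝ) →ₗ[ℝ] (Fin 2 → ℝ)) (E : AffineSubspace ℝ (Fin 4 → ℝ))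
    (p : Fin 4 → Fin 4 → ℝ) (f : Face) : DecoratedPrototile where
  fst := f.fst
  snd := f.snd
  deco i := {z | z ∈ parallelogram (edgeVec π f.fst) (edgeVec π f.snd) ∧
    π (intVec f.base) + z ∈ ammannLines π E p i}

/-- The FP-tileset: all decorated tiles of the canonical tiling, up to translation. -/
def fpTileset (π : (Fin 4 → ℝ) →ₗ[ℝ] (Fin 2 → ℝ)) (E : AffineSubspace ℝ (Fin 4 → ℝ))
    (p : Fin 4 → Fin 4 → ℝ) : Set DecoratedPrototile :=
  decorate π E p '' canonicalFaces E

/-! ### Tilings with decorated tiles -/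

/-- A translated decorated prototile. -/
structure PlacedTile where
  base : Fin 2 → ℝ
  proto : DecoratedPrototile

/-- The underlying undecorated tile. -/
def PlacedTile.tile (τ : PlacedTile) : Tile := ⟨τ.base, τ.proto.fst, τ.proto.snd⟩

/-- The union of all segments of the `i`-th direction drawn on the tiles of `T`. -/
def decoration (T : Set PlacedTile) (i : Fin 4) : Set (Fin 2 → ℝ) :=
  ⋃ τ ∈ T, (fun z => τ.base + z) '' τ.proto.deco i

/-- `T` is a tiling by tiles of the decorated tileset `𝒯`, respecting the Ammann bar rules: every
segment of the `i`-th direction (directed by `d i`) is prolonged on adjacent tiles to a full line. -/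
structure IsAmmannTiling (v d : Fin 4 → Fin 2 → ℝ) (𝒯 : Set DecoratedPrototile)
    (T : Set PlacedTile) : Prop where
  proto_mem : ∀ τ ∈ T, τ.proto ∈ 𝒯
  isTiling : IsTiling v (fun τ : T => τ.1.tile)
  lines : ∀ i, ∀ x ∈ decoration T i, lineThrough x (d i) ⊆ decoration T i

/-- `ℓ` lifts the vertices of the tiling `T` to `ℤ⁴`: a tile of type `(j, k)` goes to a face
generated by `e_j` and `e_k`. Since `ℓ` is a function on vertices, tiles which are adjacent along
an edge `v_j` go to faces adjacent along the corresponding edge `e_j`. Only the values of `ℓ` at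
vertices of `T` matter; they are unique up to a global translation. -/
def IsLift (v : Fin 4 → Fin 2 → ℝ) (T : Set PlacedTile) (ℓ : (Fin 2 → ℝ) → (Fin 4 → ℤ)) : Prop :=
  ∀ τ ∈ T,
    ℓ (τ.base + v τ.proto.fst) = ℓ τ.base + Pi.single τ.proto.fst 1 ∧
    ℓ (τ.base + v τ.proto.snd) = ℓ τ.base + Pi.single τ.proto.snd 1 ∧
    ℓ (τ.base + v τ.proto.fst + v τ.proto.snd) =
      ℓ τ.base + Pi.single τ.proto.fst 1 + Pi.single τ.proto.snd 1

/-- The stepped surface in `ℝ⁴` onto which `T` is lifted. -/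
def liftedSurface (T : Set PlacedTile) (ℓ : (Fin 2 → ℝ) → (Fin 4 → ℤ)) : Set (Fin 4 → ℝ) :=
  ⋃ τ ∈ T, (Face.mk (ℓ τ.base) τ.proto.fst τ.proto.snd).carrier

end FPTiling

open FPTiling

namespace FPTiling
open Set Filter Topology

/-! Let `F` be a linear map of ℝ⁴ onto a plane with kernel `V`, and call det(F x, F e_i) the level
of x; put f_l = det(F e_l, F e_i). Write π(p_k) = t_k π(e_k), so that c_k = p_k - t_k e_k (`conj`)
lies in ker π.

Two facts about the slope. Rigidity (`rigid`): if C is the matrix with rows c_k, a nonzero μ with C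
diag(μ) C = 0 would deform `V` into infinitely many slopes with the same subperiods, against the
finiteness hypothesis. Arithmetic (`F_det_eq_zero`): an integer vector sent by π to a multiple of
π(e_i) lies in V + ℝe_i, that is, has level 0; otherwise all the c_k, and then by rigidity all the
t_k, would be rational, against total irrationality.

Planarity. A bar through a vertex meets tiles that are copies of canonical ones, cut by canonical
bars. By the arithmetic fact, the levels of their corners relative to the vertex are differences of
levels of canonical vertices (`bar_compare`). Hence the lift L followed by `F` sends each line of
direction π(e_k) into a strip of direction F(e_k). With four directions such a map is close to a
linear map A with A π(e_k) = a_k F(e_k), and rigidity gives A = 0: the lifted surface stays near the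
slope (`exists_bound_F_lift`).

Shadows. There is n ∈ ker π with n_i = 0, and validity of π yields n_l f_l > 0 for all l ≠ i
(`exists_normal`). It also makes the level difference of two canonical vertices strictly less than
Σ|f_l| (`strict_width`). Planarity makes the i-shadow a graph in the direction n (`exists_above`,
`eq_zero_of_above`), and no two of its points are strictly ordered for the signs of n (`antichain`).

Periodicity. Translate the shadow of a vertex by a multiple of ω_i(p_i). The point of the shadow on
the same line of direction n comes from the bar through that vertex. Were it a different point, a
corner of its tile would differ from the translate by nonzero integers in all three coordinates,
with the signs of ±n, so its level would be off by at least Σ|f_l|, which is impossible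
(`exists_vertex_add`). Vertices thus translate into the shadow, and the absence of strictly ordered
points extends this to the whole shadow. -/

/-! ### Determinants in the plane -/

/-- The determinant of two plane vectors. -/
def det2 (a b : Fin 2 → ℝ) : ℝ := a 0 * b 1 - a 1 * b 0

lemma det2_self (a : Fin 2 → ℝ) : det2 a a = 0 := by simp only [det2]; ring

lemma det2_swap (a b : Fin 2 → ℝ) : det2 a b = -det2 b a := by simp only [det2]; ring

lemma det2_add_left (a b c : Fin 2 → ℝ) : det2 (a + b) c = det2 a c + det2 b c := by
  simp only [det2, Pi.add_apply]; ring

lemma det2_sub_left (a b c : Fin 2 → ℝ) : det2 (a - b) c = det2 a c - det2 b c := by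
  simp only [det2, Pi.sub_apply]; ring

lemma det2_smul_left (r : ℝ) (a c : Fin 2 → ℝ) : det2 (r • a) c = r * det2 a c := by
  simp only [det2, Pi.smul_apply, smul_eq_mul]; ring

lemma det2_neg_left (a c : Fin 2 → ℝ) : det2 (-a) c = -det2 a c := by
  simp only [det2, Pi.neg_apply]; ring

lemma det2_zero_left (c : Fin 2 → ℝ) : det2 0 c = 0 := by simp [det2]

lemma det2_zero_right (c : Fin 2 → ℝ) : det2 c 0 = 0 := by simp [det2]

lemma det2_add_right (a b c : Fin 2 → ℝ) : det2 c (a + b) = det2 c a + det2 c b := by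
  simp only [det2, Pi.add_apply]; ring

lemma det2_sub_right (a b c : Fin 2 → ℝ) : det2 c (a - b) = det2 c a - det2 c b := by
  simp only [det2, Pi.sub_apply]; ring

lemma det2_smul_right (r : ℝ) (a c : Fin 2 → ℝ) : det2 c (r • a) = r * det2 c a := by
  simp only [det2, Pi.smul_apply, smul_eq_mul]; ring

lemma det2_sum_left {ι : Type*} (s : Finset ι) (g : ι → Fin 2 → ℝ) (c : Fin 2 → ℝ) :
    det2 (∑ k ∈ s, g k) c = ∑ k ∈ s, det2 (g k) c := by
  classical
  induction s using Finset.induction_on with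
  | empty => simp [det2_zero_left]
  | insert a s ha ih => rw [Finset.sum_insert ha, Finset.sum_insert ha, det2_add_left, ih]

lemma det2_expand {a b : Fin 2 → ℝ} (h : det2 a b ≠ 0) (w : Fin 2 → ℝ) :
    w = (det2 w b / det2 a b) • a + (det2 a w / det2 a b) • b := by
  ext m
  have h2 : det2 a b * w m = det2 w b * a m + det2 a w * b m := by
    fin_cases m <;> simp [det2] <;> ring
  simp only [Pi.add_apply, Pi.smul_apply, smul_eq_mul]
  field_simp
  linarith

lemma exists_smul_of_det2_eq_zero {a w : Fin 2 → ℝ} (ha : a ≠ 0) (h : det2 w a = 0) :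
    ∃ r : ℝ, w = r • a := by
  simp only [det2] at h
  by_cases h0 : a 0 = 0
  · have h1 : a 1 ≠ 0 := fun h1 => ha (by ext m; fin_cases m <;> simp [h0, h1])
    have h2 : w 0 = 0 := by simpa [h0, h1] using h
    exact ⟨w 1 / a 1, by ext m; fin_cases m <;> simp [h0, h1, h2]⟩
  · refine ⟨w 0 / a 0, ?_⟩
    ext m
    fin_cases m <;> simp <;> field_simp
    linarith

lemma det2_ne_zero_of_linearIndependent {a b : Fin 2 → ℝ} (h : LinearIndependent ℝ ![a, b]) :
    det2 a b ≠ 0 := by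
  intro h0
  rw [LinearIndependent.pair_iff] at h
  have hb : b ≠ 0 := by
    rintro rfl
    simpa using (h 0 1 (by simp)).2
  obtain ⟨r, hr⟩ := exists_smul_of_det2_eq_zero hb h0
  simpa using (h 1 (-r) (by rw [hr]; simp)).1

lemma abs_det2_le (a b : Fin 2 → ℝ) : |det2 a b| ≤ 2 * ‖a‖ * ‖b‖ := by
  have h : ∀ x y : Fin 2, |a x * b y| ≤ ‖a‖ * ‖b‖ := fun x y => by
    rw [abs_mul]
    exact mul_le_mul (norm_le_pi_norm a x) (norm_le_pi_norm b y) (abs_nonneg _) (norm_nonneg _)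
  have := abs_sub (a 0 * b 1) (a 1 * b 0)
  simp only [det2]
  linarith [h 0 1, h 1 0]

/-! ### Linear maps on `ℝ⁴` -/

lemma sum_smul_e (x : Fin 4 → ℝ) : x = ∑ k, x k • e k := by
  ext m
  simp [e, Finset.sum_apply, Pi.single_apply]

lemma map_eq_sum {M : Type*} [AddCommGroup M] [Module ℝ M] (F : (Fin 4 → ℝ) →ₗ[ℝ] M)
    (x : Fin 4 → ℝ) : F x = ∑ k, x k • F (e k) := by
  conv_lhs => rw [sum_smul_e x]
  simp [map_sum]

lemma e_self (j : Fin 4) : e j j = 1 := by simp [e]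

lemma e_ne {j m : Fin 4} (h : m ≠ j) : e j m = 0 := by simp [e, h]

lemma intVec_add (a b : Fin 4 → ℤ) : intVec (a + b) = intVec a + intVec b := by
  ext; simp [intVec]

lemma intVec_sub (a b : Fin 4 → ℤ) : intVec (a - b) = intVec a - intVec b := by
  ext; simp [intVec]

lemma intVec_neg (a : Fin 4 → ℤ) : intVec (-a) = -intVec a := by
  ext; simp [intVec]

lemma intVec_single (j : Fin 4) (c : ℤ) : intVec (Pi.single j c) = (c : ℝ) • e j := by
  ext m
  by_cases h : m = j
  · subst h; simp [intVec, e]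
  · simp [intVec, e, h]

lemma intVec_single_one (j : Fin 4) : intVec (Pi.single j 1) = e j := by
  rw [intVec_single]; simp

lemma omega_add (i : Fin 4) (x y : Fin 4 → ℝ) : omega i (x + y) = omega i x + omega i y := by
  ext j; simp only [omega, Pi.add_apply]; split_ifs <;> simp

lemma omega_smul (i : Fin 4) (r : ℝ) (x : Fin 4 → ℝ) : omega i (r • x) = r • omega i x := by
  ext j; simp only [omega, Pi.smul_apply]; split_ifs <;> simp

lemma omega_eq (i : Fin 4) (x : Fin 4 → ℝ) : omega i x = x - x i • e i := by
  ext j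
  by_cases h : j = i
  · subst h; simp [omega, e]
  · simp [omega, e, h]

lemma omega_apply_self (i : Fin 4) (x : Fin 4 → ℝ) : omega i x i = 0 := by simp [omega]

lemma omega_apply_ne {i l : Fin 4} (h : l ≠ i) (x : Fin 4 → ℝ) : omega i x l = x l := by
  simp [omega, h]

/-- The map serves as the projection to the internal plane of the cut and project scheme. -/
lemma exists_linearMap_ker {V : Submodule ℝ (Fin 4 → ℝ)} (h : Module.finrank ℝ V = 2) :
    ∃ F : (Fin 4 → ℝ) →ₗ[ℝ] (Fin 2 → ℝ), ∀ x, F x = 0 ↔ x ∈ V := by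
  have h1 := V.finrank_quotient_add_finrank
  have h2 : Module.finrank ℝ ((Fin 4 → ℝ) ⧸ V) = Module.finrank ℝ (Fin 2 → ℝ) := by
    simp only [Module.finrank_fin_fun] at h1 ⊢
    omega
  let g := LinearEquiv.ofFinrankEq _ _ h2
  exact ⟨g.toLinearMap ∘ₗ V.mkQ, fun x => by simp⟩

/-- In a plane of `ℝ⁴`, some nonzero vector has a vanishing `j`-th coordinate. -/
lemma exists_ne_zero_coord_eq_zero {V : Submodule ℝ (Fin 4 → ℝ)} (h : Module.finrank ℝ V = 2)
    (j : Fin 4) : ∃ x ∈ V, x ≠ 0 ∧ x j = 0 := by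
  let g : V →ₗ[ℝ] ℝ := (LinearMap.proj j) ∘ₗ V.subtype
  have h1 := g.finrank_range_add_finrank_ker
  have h2 : Module.finrank ℝ (LinearMap.range g) ≤ 1 := by
    simpa using (LinearMap.range g).finrank_le
  have h3 : 0 < Module.finrank ℝ (LinearMap.ker g) := by omega
  obtain ⟨x, hx⟩ := (Module.finrank_pos_iff_exists_ne_zero (R := ℝ) (M := LinearMap.ker g)).1 h3
  exact ⟨x.1.1, x.1.2, fun h => hx (Subtype.ext (Subtype.ext h)), x.2⟩

lemma exists_combination {V : Submodule ℝ (Fin 4 → ℝ)} (h : Module.finrank ℝ V = 2)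
    {x y z : Fin 4 → ℝ} (hx : x ∈ V) (hy : y ∈ V) (hz : z ∈ V)
    (hxy : LinearIndependent ℝ ![x, y]) : ∃ a b : ℝ, z = a • x + b • y := by
  have h1 : Submodule.span ℝ {x, y} = V := by
    apply Submodule.eq_of_le_of_finrank_eq
    · rw [Submodule.span_le]
      rintro w (rfl | rfl) <;> assumption
    · have := finrank_span_eq_card hxy
      rw [h]
      have hr : Set.range ![x, y] = {x, y} := by
        ext w
        simp [eq_comm, or_comm]
      rw [hr] at this
      simpa using this
  rw [← h1, Submodule.mem_span_pair] at hz
  obtain ⟨a, b, hab⟩ := hz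
  exact ⟨a, b, hab.symm⟩

/-! ### Selected faces -/

/-- The unit cube. -/
abbrev cube : Set (Fin 4 → ℝ) := Set.Icc 0 1

lemma mem_cube {u : Fin 4 → ℝ} : u ∈ cube ↔ ∀ k, 0 ≤ u k ∧ u k ≤ 1 := by
  simp only [cube, Set.mem_Icc, Pi.le_def, Pi.zero_apply, Pi.one_apply]
  exact ⟨fun h k => ⟨h.1 k, h.2 k⟩, fun h => ⟨fun k => (h k).1, fun k => (h k).2⟩⟩

/-- Modulo the slope, the tube is the translate by F y₀ of the window `F '' cube`. -/
lemma mem_tube_iff {V : Submodule ℝ (Fin 4 → ℝ)} {E : AffineSubspace ℝ (Fin 4 → ℝ)}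
    {F : (Fin 4 → ℝ) →ₗ[ℝ] (Fin 2 → ℝ)} (hF : ∀ x, F x = 0 ↔ x ∈ V) (hE : E.direction = V)
    {y₀ : Fin 4 → ℝ} (hy : y₀ ∈ E) (x : Fin 4 → ℝ) :
    x ∈ tube E ↔ ∃ u ∈ cube, F x - F y₀ = F u := by
  constructor
  · rintro ⟨y, hyE, u, hu, rfl⟩
    refine ⟨u, hu, ?_⟩
    have : y - y₀ ∈ V := by
      rw [← hE]; exact AffineSubspace.vsub_mem_direction hyE hy
    rw [← hF, map_sub] at this
    rw [map_add, add_sub_right_comm, this, zero_add]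
  · rintro ⟨u, hu, h⟩
    refine ⟨x - u, ?_, u, hu, by simp⟩
    have : x - u - y₀ ∈ E.direction := by
      rw [hE, ← hF, map_sub, map_sub, sub_right_comm, h, sub_self]
    have := AffineSubspace.vadd_mem_of_mem_direction this hy
    simpa using this

lemma mem_carrier {b : Fin 4 → ℤ} {j k : Fin 4} {x : Fin 4 → ℝ} :
    x ∈ (Face.mk b j k).carrier ↔
      ∃ s ∈ Set.Icc (0 : ℝ) 1, ∃ t ∈ Set.Icc (0 : ℝ) 1, x = intVec b + s • e j + t • e k := Iff.rfl

/-- A face of type `(j, k)` lies in the tube iff its base point lies in the tube with the directions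
`j` and `k` removed. -/
lemma carrier_subset_tube_iff {V : Submodule ℝ (Fin 4 → ℝ)} {E : AffineSubspace ℝ (Fin 4 → ℝ)}
    {F : (Fin 4 → ℝ) →ₗ[ℝ] (Fin 2 → ℝ)} (hF : ∀ x, F x = 0 ↔ x ∈ V) (hE : E.direction = V)
    {y₀ : Fin 4 → ℝ} (hy : y₀ ∈ E) (b : Fin 4 → ℤ) {j k : Fin 4} (hjk : j ≠ k) :
    (Face.mk b j k).carrier ⊆ tube E ↔
      ∃ u ∈ cube, u j = 0 ∧ u k = 0 ∧ F (intVec b) - F y₀ = F u := by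
  constructor
  · intro h
    let S : Set (Fin 4 → ℝ) := {u | u ∈ cube ∧ u j = 0 ∧ u k = 0}
    have hSc : IsCompact S := by
      refine isCompact_Icc.of_isClosed_subset ?_ (fun u hu => hu.1)
      refine isClosed_Icc.inter (IsClosed.inter ?_ ?_)
      · exact isClosed_eq (continuous_apply j) continuous_const
      · exact isClosed_eq (continuous_apply k) continuous_const
    have hSv : Convex ℝ S := by
      intro u hu v hv a b ha hb hab
      refine ⟨convex_Icc _ _ hu.1 hv.1 ha hb hab, ?_, ?_⟩
      · simp [hu.2.1, hv.2.1]
      · simp [hu.2.2, hv.2.2]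
    by_contra hne
    have hnot : F (intVec b) - F y₀ ∉ F '' S := by
      rintro ⟨u, hu, hu'⟩
      exact hne ⟨u, hu.1, hu.2.1, hu.2.2, hu'.symm⟩
    obtain ⟨g, c, hg1, hg2⟩ := geometric_hahn_banach_point_closed (hSv.linear_image F)
      (hSc.image F.continuous_of_finiteDimensional).isClosed hnot
    -- Corner of the face where the separating functional is smallest. If it lies in the tube,
    -- deleting the `j` and `k` components of its cube vector gives a point of `S` that contradicts
    -- the separation.
    let σ : Fin 4 → ℝ := fun m => if g (F (e m)) < 0 then 1 else 0
    have hσ : ∀ m, σ m ∈ Set.Icc (0 : ℝ) 1 := fun m => by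
      simp only [σ]; split_ifs <;> simp
    have hσm : ∀ m, ∀ r ∈ Set.Icc (0 : ℝ) 1, σ m * g (F (e m)) ≤ r * g (F (e m)) := by
      intro m r hr
      simp only [σ]
      split_ifs with hm
      · nlinarith [hr.2]
      · nlinarith [hr.1]
    have hmem := h (mem_carrier.2 ⟨σ j, hσ j, σ k, hσ k, rfl⟩)
    rw [mem_tube_iff hF hE hy] at hmem
    obtain ⟨u, hu, hu'⟩ := hmem
    let u' : Fin 4 → ℝ := u - u j • e j - u k • e k
    have hu'S : u' ∈ S := by
      refine ⟨mem_cube.2 fun m => ?_, ?_, ?_⟩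
      · have := mem_cube.1 hu m
        by_cases h1 : m = j
        · subst h1; simp [u', e, hjk]
        · by_cases h2 : m = k
          · subst h2; simp [u', e, h1]
          · simpa [u', e, h1, h2] using this
      · simp [u', e, hjk]
      · simp [u', e, hjk.symm]
    have h3 := hg2 _ (Set.mem_image_of_mem F hu'S)
    have h4 : g (F (intVec b) - F y₀) + σ j * g (F (e j)) + σ k * g (F (e k)) =
        g (F u') + u j * g (F (e j)) + u k * g (F (e k)) := by
      have := congrArg g hu'
      simp only [u', map_add, map_sub, map_smul, smul_eq_mul] at this ⊢
      linarith
    have h5 := hσm j (u j) (mem_cube.1 hu j)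
    have h6 := hσm k (u k) (mem_cube.1 hu k)
    linarith
  · rintro ⟨u, hu, huj, huk, h⟩ x hx
    obtain ⟨s, hs, t, ht, rfl⟩ := hx
    rw [mem_tube_iff hF hE hy]
    refine ⟨u + s • e j + t • e k, mem_cube.2 fun m => ?_, ?_⟩
    · have := mem_cube.1 hu m
      by_cases h1 : m = j
      · subst h1; simpa [e, hjk, huj] using hs
      · by_cases h2 : m = k
        · subst h2; simpa [e, h1, huk] using ht
        · simpa [e, h1, h2] using this
    · rw [map_add, map_add, map_add, map_add, ← h]; abel

/-- `Borders F a j m ε b`: the face between the `j`-edges based at `b` and `b + ε e_m` is selected,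
where `a` is the image of the cutting plane under `F`. -/
def Borders (F : (Fin 4 → ℝ) →ₗ[ℝ] (Fin 2 → ℝ)) (a : Fin 2 → ℝ) (j m : Fin 4) (up : Bool)
    (b : Fin 4 → ℤ) : Prop :=
  ∃ u ∈ cube, u j = 0 ∧ u m = (if up then 0 else 1) ∧ F (intVec b) - a = F u

/-- The face with base `b` and directions `j`, `k`, with directions in increasing order. -/
def orderedFace (b : Fin 4 → ℤ) (j k : Fin 4) : Face := if j < k then ⟨b, j, k⟩ else ⟨b, k, j⟩

lemma carrier_orderedFace (b : Fin 4 → ℤ) (j k : Fin 4) :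
    (orderedFace b j k).carrier = (Face.mk b j k).carrier := by
  unfold orderedFace
  split_ifs
  · rfl
  · ext x
    simp only [mem_carrier]
    constructor
    · rintro ⟨s, hs, t, ht, h⟩
      exact ⟨t, ht, s, hs, by rw [h]; abel⟩
    · rintro ⟨s, hs, t, ht, h⟩
      exact ⟨t, ht, s, hs, by rw [h]; abel⟩

lemma orderedFace_mem {V : Submodule ℝ (Fin 4 → ℝ)} {E : AffineSubspace ℝ (Fin 4 → ℝ)}
    {F : (Fin 4 → ℝ) →ₗ[ℝ] (Fin 2 → ℝ)} (hF : ∀ x, F x = 0 ↔ x ∈ V) (hE : E.direction = V)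
    {y₀ : Fin 4 → ℝ} (hy : y₀ ∈ E) {b : Fin 4 → ℤ} {j k : Fin 4} (hjk : j ≠ k)
    (h : ∃ u ∈ cube, u j = 0 ∧ u k = 0 ∧ F (intVec b) - F y₀ = F u) :
    orderedFace b j k ∈ canonicalFaces E := by
  refine ⟨?_, ?_⟩
  · unfold orderedFace
    split_ifs with h1
    · exact h1
    · exact lt_of_le_of_ne (not_lt.1 h1) hjk.symm
  · rw [carrier_orderedFace]
    exact (carrier_subset_tube_iff hF hE hy b hjk).2 h

/-- The base of the face between the `j`-edges at `b` and at its neighbour in direction `± e_m`. -/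
def faceBase (m : Fin 4) (up : Bool) (b : Fin 4 → ℤ) : Fin 4 → ℤ :=
  if up then b else b - Pi.single m 1

lemma Borders.mem {V : Submodule ℝ (Fin 4 → ℝ)} {E : AffineSubspace ℝ (Fin 4 → ℝ)}
    {F : (Fin 4 → ℝ) →ₗ[ℝ] (Fin 2 → ℝ)} (hF : ∀ x, F x = 0 ↔ x ∈ V) (hE : E.direction = V)
    {y₀ : Fin 4 → ℝ} (hy : y₀ ∈ E) {j m : Fin 4} (hjm : j ≠ m) {up : Bool} {b : Fin 4 → ℤ}
    (h : Borders F (F y₀) j m up b) : orderedFace (faceBase m up b) j m ∈ canonicalFaces E := by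
  obtain ⟨u, hu, huj, hum, h⟩ := h
  apply orderedFace_mem hF hE hy hjm
  cases up
  · refine ⟨u - e m, mem_cube.2 fun l => ?_, by simp [e, hjm, huj], ?_, ?_⟩
    · have := mem_cube.1 hu l
      by_cases h1 : l = m
      · subst h1; simp [e] at hum ⊢; simp [hum]
      · simpa [e, h1] using this
    · simp [e] at hum ⊢; simp [hum]
    · simp only [faceBase, Bool.false_eq_true, if_false, intVec_sub, intVec_single_one, map_sub]
      rw [← h]; abel
  · exact ⟨u, hu, huj, by simpa using hum, by simpa [faceBase] using h⟩

/-- Moving through the cube along a relation between the vectors `F e_m`, `m ≠ j`. -/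
lemma exists_exit {F : (Fin 4 → ℝ) →ₗ[ℝ] (Fin 2 → ℝ)} {a : Fin 2 → ℝ} {j : Fin 4}
    {b : Fin 4 → ℤ} {x : Fin 4 → ℝ} (hx0 : x ≠ 0) (hxj : x j = 0) (hx : F x = 0)
    (hb : ∃ u ∈ cube, u j = 0 ∧ F (intVec b) - a = F u) :
    ∃ m, m ≠ j ∧ ((0 < x m ∧ Borders F a j m true b) ∨ (x m < 0 ∧ Borders F a j m false b)) := by
  obtain ⟨u, hu, huj, hFu⟩ := hb
  -- Time at which a point starting at `u` with velocity `-x` has its m-th coordinate at the wall of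
  -- the cube it is heading for: 0 if `x m` is positive, 1 if it is negative. The smallest of these
  -- times is the exit time.
  let ρ : Fin 4 → ℝ := fun m => if 0 < x m then u m / x m else (u m - 1) / x m
  obtain ⟨m0, hm0⟩ : ∃ m, x m ≠ 0 := Function.ne_iff.1 hx0
  obtain ⟨m, hm, hmin⟩ := Finset.exists_min_image (Finset.univ.filter fun m => x m ≠ 0) ρ
    ⟨m0, by simpa using hm0⟩
  have hm : x m ≠ 0 := by simpa using hm
  have hmj : m ≠ j := by rintro rfl; exact hm hxj
  have hρ : ∀ l, x l ≠ 0 → 0 ≤ ρ l := fun l hl => by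
    simp only [ρ]
    have := mem_cube.1 hu l
    split_ifs with h
    · exact div_nonneg this.1 h.le
    · exact div_nonneg_of_nonpos (by linarith) (not_lt.1 h)
  have hcube : u - ρ m • x ∈ cube := mem_cube.2 fun l => by
    have h1 := mem_cube.1 hu l
    by_cases hl : x l = 0
    · simpa [hl] using h1
    have h2 : ρ m ≤ ρ l := hmin l (by simpa using hl)
    have h3 := hρ m hm
    simp only [Pi.sub_apply, Pi.smul_apply, smul_eq_mul]
    rcases lt_or_gt_of_ne hl with h | h
    · have h4 : ρ l = (u l - 1) / x l := by simp [ρ, not_lt.2 h.le]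
      have h5 : ρ l * x l = u l - 1 := by rw [h4]; field_simp
      constructor <;> nlinarith
    · have h4 : ρ l = u l / x l := by simp [ρ, h]
      have h5 : ρ l * x l = u l := by rw [h4]; field_simp
      constructor <;> nlinarith
  have hF : F (intVec b) - a = F (u - ρ m • x) := by rw [hFu]; simp [hx]
  refine ⟨m, hmj, ?_⟩
  rcases lt_or_gt_of_ne hm with h | h
  · refine Or.inr ⟨h, _, hcube, by simp [huj, hxj], ?_, hF⟩
    have h4 : ρ m = (u m - 1) / x m := by simp [ρ, not_lt.2 h.le]
    simp [h4, hm]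
  · refine Or.inl ⟨h, _, hcube, by simp [huj, hxj], ?_, hF⟩
    have h4 : ρ m = u m / x m := by simp [ρ, h]
    simp [h4, hm]

/-- An integer vector of `ω_i(V)` translates the shadow of the canonical lift into itself. -/
lemma shadow_add_mem {V : Submodule ℝ (Fin 4 → ℝ)} (hdim : Module.finrank ℝ V = 2)
    {E : AffineSubspace ℝ (Fin 4 → ℝ)} (hE : IsCutPlane V E) {i : Fin 4} {p : Fin 4 → ℝ}
    (hp : p ∈ V) {r : Fin 4 → ℤ} (hr : omega i p = intVec r) {x : Fin 4 → ℝ}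
    (hx : x ∈ shadow i (canonicalLift E)) : x + omega i p ∈ shadow i (canonicalLift E) := by
  obtain ⟨F, hF⟩ := exists_linearMap_ker hdim
  obtain ⟨y₀, hy⟩ := hE.nonempty
  have hFp := (hF p).2 hp
  obtain ⟨z, hz, rfl⟩ := hx
  simp only [canonicalLift, Set.mem_iUnion] at hz
  obtain ⟨⟨b, j, k⟩, ⟨hlt, hsub⟩, hzf⟩ := hz
  have hjk : j ≠ k := ne_of_lt hlt
  obtain ⟨u, hu, huj, huk, h⟩ := (carrier_subset_tube_iff hF hE.direction hy b hjk).1 hsub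
  have hFr : F (intVec r) = -(p i • F (e i)) := by
    rw [← hr, omega_eq, map_sub, hFp, map_smul, zero_sub]
  -- Since `F p = 0`, translating by `r` amounts to sliding by `-p i` along `e i`; the integer `m`
  -- is free, because `omega i` does not see it, and serves to return to the cube.
  have key : ∀ m : ℤ, F (intVec (b + r + Pi.single i m)) - F y₀ = F (u + ((m : ℝ) - p i) • e i) := by
    intro m
    simp only [intVec_add, intVec_single, map_add, map_smul, hFr, sub_smul]
    rw [← h]; simp only [map_sub, map_smul]; abel
  have fin : ∀ (m : ℤ) (f : Face), f ∈ canonicalFaces E → ∀ y ∈ f.carrier, ∀ w : Fin 4 → ℝ,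
      y = w + intVec r + (m : ℝ) • e i → omega i z = omega i w →
      omega i z + omega i p ∈ shadow i (canonicalLift E) := by
    intro m f hf y hyf w hyw hzw
    refine ⟨y, Set.mem_biUnion hf hyf, ?_⟩
    rw [hyw, hzw, omega_add, omega_add, omega_smul, ← hr]
    have h1 : omega i (e i) = 0 := by ext l; by_cases h : l = i <;> simp [omega, e, h]
    have h2 : omega i (omega i p) = omega i p := by ext l; by_cases h : l = i <;> simp [omega, h]
    rw [h1, h2]; simp
  -- A face having `e i` among its directions only casts an edge as shadow. Any selected face
  -- carrying the translated edge will do, and `exists_exit` supplies one.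
  have edge : ∀ l : Fin 4, l ≠ i → u l = 0 → u i = 0 → ∀ τ ∈ Set.Icc (0:ℝ) 1,
      omega i z = omega i (intVec b + τ • e l) →
      omega i z + omega i p ∈ shadow i (canonicalLift E) := by
    intro l hli hul hui τ hτ hz
    obtain ⟨x, hxV, hx0, hxl⟩ := exists_ne_zero_coord_eq_zero hdim l
    set m : ℤ := ⌈p i⌉
    have hb : ∃ u ∈ cube, u l = 0 ∧ F (intVec (b + r + Pi.single i m)) - F y₀ = F u := by
      refine ⟨_, mem_cube.2 fun l' => ?_, ?_, key m⟩
      · by_cases h1 : l' = i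
        · subst h1
          have := Int.le_ceil (p l')
          have := Int.ceil_lt_add_one (p l')
          simp only [Pi.add_apply, Pi.smul_apply, hui, e_self, smul_eq_mul, mul_one, zero_add, m]
          constructor <;> linarith
        · simpa [e, h1] using mem_cube.1 hu l'
      · simp [hul, e, hli]
    obtain ⟨m', hm', hcase⟩ := exists_exit hx0 hxl ((hF x).2 hxV) hb
    have hy' : intVec b + τ • e l + intVec r + (m : ℝ) • e i =
        intVec (b + r + Pi.single i m) + τ • e l := by
      simp only [intVec_add, intVec_single]; abel
    rcases hcase with ⟨-, hB⟩ | ⟨-, hB⟩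
    · refine fin m _ (hB.mem hF hE.direction hy hm'.symm) _ ?_ _ rfl hz
      rw [carrier_orderedFace, mem_carrier]
      exact ⟨τ, hτ, 0, by simp, by rw [hy']; simp [faceBase]⟩
    · refine fin m _ (hB.mem hF hE.direction hy hm'.symm) _ ?_ _ rfl hz
      rw [carrier_orderedFace, mem_carrier]
      refine ⟨τ, hτ, 1, by simp, ?_⟩
      rw [hy']
      simp only [faceBase, Bool.false_eq_true, if_false, intVec_sub, intVec_single_one, one_smul]
      abel
  obtain ⟨s, hs, t, ht, rfl⟩ := hzf
  have hω : omega i (e i) = 0 := by ext l; by_cases h : l = i <;> simp [omega, e, h]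
  by_cases hij : j = i
  · subst hij
    refine edge k hjk.symm huk huj t ht ?_
    simp [omega_add, omega_smul, hω]
  by_cases hik : k = i
  · subst hik
    refine edge j hjk huj huk s hs ?_
    simp [omega_add, omega_smul, hω]
  set m : ℤ := ⌈p i - u i⌉
  refine fin m (orderedFace (b + r + Pi.single i m) j k) ?_ _ ?_ _ rfl rfl
  · refine orderedFace_mem hF hE.direction hy hjk ⟨_, mem_cube.2 fun l' => ?_, ?_, ?_, key m⟩
    · by_cases h1 : l' = i
      · subst h1
        have := Int.le_ceil (p l' - u l')
        have := Int.ceil_lt_add_one (p l' - u l')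
        simp only [Pi.add_apply, Pi.smul_apply, e_self, smul_eq_mul, mul_one, m]
        constructor <;> linarith
      · simpa [e, h1] using mem_cube.1 hu l'
    · simp [huj, e, hij]
    · simp [huk, e, hik]
  · rw [carrier_orderedFace, mem_carrier]
    exact ⟨s, hs, t, ht, by simp only [intVec_add, intVec_single]; abel⟩

lemma omega_neg (i : Fin 4) (x : Fin 4 → ℝ) : omega i (-x) = -omega i x := by
  ext j; simp only [omega, Pi.neg_apply]; split_ifs <;> simp

/-- The one-sided inclusion is applied to `p` and to `-p`. -/
lemma isPeriod_shadow {V : Submodule ℝ (Fin 4 → ℝ)} (hdim : Module.finrank ℝ V = 2)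
    {E : AffineSubspace ℝ (Fin 4 → ℝ)} (hE : IsCutPlane V E) {i : Fin 4} {p : Fin 4 → ℝ}
    (hp : p ∈ V) (hr : omega i p ∈ Set.range intVec) :
    IsPeriod (shadow i (canonicalLift E)) (omega i p) := by
  obtain ⟨r, hr⟩ := hr
  intro x
  refine ⟨fun h => ?_, fun h => shadow_add_mem hdim hE hp hr.symm h⟩
  have := shadow_add_mem hdim hE (V.neg_mem hp) (r := -r) (i := i)
    (by rw [omega_neg, intVec_neg, hr]) h
  simpa [omega_neg] using this


/-! ### Four indices -/

lemma univ_eq_of_distinct : ∀ i j k l : Fin 4, i ≠ j → i ≠ k → i ≠ l → j ≠ k → j ≠ l → k ≠ l →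
    (Finset.univ : Finset (Fin 4)) = {i, j, k, l} := by decide

lemma eq_of_distinct : ∀ i j k l : Fin 4, i ≠ j → i ≠ k → i ≠ l → j ≠ k → j ≠ l → k ≠ l →
    ∀ m, m = i ∨ m = j ∨ m = k ∨ m = l := by decide

lemma exists_others : ∀ i j : Fin 4, i ≠ j → ∃ k l : Fin 4,
    i ≠ k ∧ i ≠ l ∧ j ≠ k ∧ j ≠ l ∧ k ≠ l := by decide

lemma exists_other_three (i : Fin 4) : ∃ j k l : Fin 4,
    i ≠ j ∧ i ≠ k ∧ i ≠ l ∧ j ≠ k ∧ j ≠ l ∧ k ≠ l := by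
  revert i; decide

lemma sum_four {M : Type*} [AddCommMonoid M] (g : Fin 4 → M) {i j k l : Fin 4} (hij : i ≠ j)
    (hik : i ≠ k) (hil : i ≠ l) (hjk : j ≠ k) (hjl : j ≠ l) (hkl : k ≠ l) :
    ∑ m, g m = g i + g j + g k + g l := by
  rw [univ_eq_of_distinct i j k l hij hik hil hjk hjl hkl, Finset.sum_insert (by simp [*]),
    Finset.sum_insert (by simp [*]), Finset.sum_insert (by simp [*]), Finset.sum_singleton]
  simp only [add_assoc]

/-- A vector with two vanishing coordinates is determined by its image. -/
lemma eq_zero_of_coords {F : (Fin 4 → ℝ) →ₗ[ℝ] (Fin 2 → ℝ)}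
    (hF : ∀ j k, j ≠ k → det2 (F (e j)) (F (e k)) ≠ 0) {x : Fin 4 → ℝ} (hx : F x = 0) {i l : Fin 4}
    (hil : i ≠ l) (hi : x i = 0) (hl : x l = 0) : x = 0 := by
  obtain ⟨j, k, hij, hik, hlj, hlk, hjk⟩ := exists_others i l hil
  rw [map_eq_sum, sum_four _ hil hij hik hlj hlk hjk, hi, hl] at hx
  simp only [zero_smul, zero_add] at hx
  have h1 : x j = 0 := by
    have := congrArg (fun w => det2 w (F (e k))) hx
    simpa [det2_add_left, det2_smul_left, det2_self, det2_zero_left, hF j k hjk] using this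
  have h2 : x k = 0 := by
    have := congrArg (fun w => det2 w (F (e j))) hx
    simpa [det2_add_left, det2_smul_left, det2_self, det2_zero_left, hF k j hjk.symm] using this
  ext m
  rcases eq_of_distinct i l j k hil hij hik hlj hlk hjk m with rfl | rfl | rfl | rfl <;> simpa

/-! ### Valid projections -/

lemma exists_dual_of_not_injective {V : Submodule ℝ (Fin 4 → ℝ)} (hdim : Module.finrank ℝ V = 2)
    {π : (Fin 4 → ℝ) →ₗ[ℝ] (Fin 2 → ℝ)} {x : Fin 4 → ℝ} (hx : x ∈ V) (hx0 : x ≠ 0)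
    (hπ : π x = 0) : ∃ g : (Fin 2 → ℝ) →ₗ[ℝ] ℝ, g ≠ 0 ∧ ∀ y ∈ V, g (π y) = 0 := by
  have hlt : V.map π < ⊤ := by
    rw [lt_top_iff_ne_top]
    intro htop
    let ρ : V →ₗ[ℝ] (Fin 2 → ℝ) := π ∘ₗ V.subtype
    have hsurj : Function.Surjective ρ := fun z => by
      have : z ∈ V.map π := by rw [htop]; trivial
      obtain ⟨y, hy, hyz⟩ := this
      exact ⟨⟨y, hy⟩, hyz⟩
    have hinj : Function.Injective ρ :=
      (LinearMap.injective_iff_surjective_of_finrank_eq_finrank (by simp [hdim])).2 hsurj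
    have h0 : ρ ⟨x, hx⟩ = ρ 0 := by simp [ρ, hπ]
    exact hx0 (congrArg Subtype.val (hinj h0))
  obtain ⟨g, hg, hle⟩ := Submodule.exists_le_ker_of_lt_top _ hlt
  exact ⟨g, hg, fun y hy => hle (Submodule.mem_map_of_mem hy)⟩

/-- A valid projection is injective on the slope. -/
lemma IsValidProjection.eq_zero {V : Submodule ℝ (Fin 4 → ℝ)} (hdim : Module.finrank ℝ V = 2)
    {E : AffineSubspace ℝ (Fin 4 → ℝ)} (hE : IsCutPlane V E)
    {π : (Fin 4 → ℝ) →ₗ[ℝ] (Fin 2 → ℝ)} (hπ : IsValidProjection π E) {x : Fin 4 → ℝ}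
    (hx : x ∈ V) (hπx : π x = 0) : x = 0 := by
  by_contra hx0
  obtain ⟨g, hg, hgV⟩ := exists_dual_of_not_injective hdim hx hx0 hπx
  obtain ⟨y₀, hy⟩ := hE.nonempty
  obtain ⟨z, hz⟩ : ∃ z, g z ≠ 0 := by
    by_contra h
    push Not at h
    exact hg (LinearMap.ext h)
  let B : ℝ := ∑ k, |g (π (e k))|
  have hB : ∀ u ∈ cube, |g (π u)| ≤ B := by
    intro u hu
    rw [← LinearMap.comp_apply, map_eq_sum]
    refine (Finset.abs_sum_le_sum_abs _ _).trans (Finset.sum_le_sum fun k _ => ?_)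
    rw [smul_eq_mul, abs_mul, abs_of_nonneg (mem_cube.1 hu k).1]
    exact mul_le_of_le_one_left (abs_nonneg _) (mem_cube.1 hu k).2
  -- `g ∘ π` vanishes on `V`, so it is bounded on the tube: the tiles would fill only a strip and
  -- could not cover the plane.
  have hbound : ∀ P, |g P - g (π y₀)| ≤ B := by
    intro P
    have hP : P ∈ ⋃ a : canonicalFaces E, (a.1.project π).region (edgeVec π) := by
      rw [hπ.cover]; trivial
    obtain ⟨f, hf⟩ := Set.mem_iUnion.1 hP
    obtain ⟨_, ⟨s, hs, t, ht, rfl⟩, rfl⟩ := hf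
    have hmem : intVec f.1.base + s • e f.1.fst + t • e f.1.snd ∈ tube E :=
      f.2.2 ⟨s, hs, t, ht, rfl⟩
    obtain ⟨y, hyE, u, hu, h⟩ := hmem
    have hyV : y - y₀ ∈ V := by
      rw [← hE.direction]; exact AffineSubspace.vsub_mem_direction hyE hy
    have h1 : (f.1.project π).base + (s • edgeVec π (f.1.project π).fst +
        t • edgeVec π (f.1.project π).snd) = π (y - y₀) + π y₀ + π u := by
      rw [← map_add, ← map_add]
      have : y - y₀ + y₀ + u = intVec f.1.base + s • e f.1.fst + t • e f.1.snd := by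
        rw [h]; abel
      rw [this]
      simp only [Face.project, edgeVec, map_add, map_smul, add_assoc]
    simp only [h1, map_add, hgV _ hyV, zero_add, add_sub_cancel_left]
    exact hB u hu
  have h1 := hbound (((B + 1 + |g (π y₀)|) / g z) • z)
  rw [map_smul, smul_eq_mul, div_mul_cancel₀ _ hz] at h1
  have h2 := (abs_le.1 h1).2
  linarith [le_abs_self (g (π y₀))]

/-! ### The linear setting -/

/-- The linear data attached to a slope `V` with subperiods `p` and a fine projection `π`; `F` is
a linear map with kernel `V`. -/
structure LinearSetting (V : Submodule ℝ (Fin 4 → ℝ)) (p : Fin 4 → Fin 4 → ℝ)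
    (π F : (Fin 4 → ℝ) →ₗ[ℝ] (Fin 2 → ℝ)) (t : Fin 4 → ℝ) : Prop where
  dim : Module.finrank ℝ V = 2
  irr : TotallyIrrational V
  mem_iff : ∀ x, F x = 0 ↔ x ∈ V
  p_mem : ∀ k, p k ∈ V
  omega_mem : ∀ k, omega k (p k) ∈ Set.range intVec
  omega_ne : ∀ k, omega k (p k) ≠ 0
  pi_det : ∀ j k, j ≠ k → det2 (π (e j)) (π (e k)) ≠ 0
  pi_inj : ∀ x ∈ V, π x = 0 → x = 0
  pi_p : ∀ k, π (p k) = t k • π (e k)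

/-! ### Irrationality and general position of the slope. -/

namespace LinearSetting

variable {V : Submodule ℝ (Fin 4 → ℝ)} {p : Fin 4 → Fin 4 → ℝ}
  {π F : (Fin 4 → ℝ) →ₗ[ℝ] (Fin 2 → ℝ)} {t : Fin 4 → ℝ} (S : LinearSetting V p π F t)

include S

lemma pi_e_ne (k : Fin 4) : π (e k) ≠ 0 := by
  intro h
  obtain ⟨j, -, -, hkj, -⟩ := exists_other_three k
  exact S.pi_det k j hkj (by rw [h, det2_zero_left])

lemma p_ne (k : Fin 4) : p k ≠ 0 := by
  intro h
  apply S.omega_ne k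
  rw [h]; ext; simp [omega]

lemma t_ne (k : Fin 4) : t k ≠ 0 := by
  intro h
  apply S.p_ne k
  apply S.pi_inj _ (S.p_mem k)
  rw [S.pi_p, h, zero_smul]

lemma F_p (k : Fin 4) : F (p k) = 0 := (S.mem_iff _).2 (S.p_mem k)

lemma eq_zero_of_F_of_pi {x : Fin 4 → ℝ} (h1 : F x = 0) (h2 : π x = 0) : x = 0 :=
  S.pi_inj x ((S.mem_iff x).1 h1) h2

lemma coord_int {k l : Fin 4} (h : l ≠ k) : ∃ c : ℤ, p k l = c := by
  obtain ⟨q, hq⟩ := S.omega_mem k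
  refine ⟨q l, ?_⟩
  have := congrFun hq l
  rw [omega_apply_ne h] at this
  exact this.symm

lemma exists_coord_ne (k : Fin 4) : ∃ l, l ≠ k ∧ p k l ≠ 0 := by
  obtain ⟨l, hl⟩ := Function.ne_iff.1 (S.omega_ne k)
  have hlk : l ≠ k := by rintro rfl; simp [omega] at hl
  exact ⟨l, hlk, by simpa [omega, hlk] using hl⟩

/-- The other coordinates of `p k` are integers, so a rational k-th coordinate would make `p k` a
rational vector of `V`. -/
lemma not_rat (k : Fin 4) : ¬ ∃ c : ℚ, p k k = c := by
  rintro ⟨c, hc⟩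
  have : ∀ l, ∃ r : ℚ, p k l = r := fun l => by
    by_cases h : l = k
    · exact ⟨c, h ▸ hc⟩
    · obtain ⟨z, hz⟩ := S.coord_int h
      exact ⟨z, by simpa using hz⟩
  choose r hr using this
  have h0 := S.irr r (by rw [← funext hr]; exact S.p_mem k)
  apply S.p_ne k
  ext l
  rw [hr, h0]; simp

/-- Otherwise `V` contains a nonzero combination `x` of `e i` and `e j`. As `π (p i)` is parallel to
`π (e i)`, the vector `p i` has a nonzero coordinate outside i and j, hence is independent of `x`.
Writing `p k` in the basis `x`, `p i`, with the k-th and l-th coordinates of `x` zero, makes `p k k`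
rational unless `p i l = 0`; exchanging k and l gives `p i k = 0` as well. -/
lemma F_det {i j : Fin 4} (hij : i ≠ j) : det2 (F (e i)) (F (e j)) ≠ 0 := by
  intro hdet
  obtain ⟨k, l, hik, hil, hjk, hjl, hkl⟩ := exists_others i j hij
  obtain ⟨a, b, hab, hx⟩ : ∃ a b : ℝ, (a ≠ 0 ∨ b ≠ 0) ∧ a • e i + b • e j ∈ V := by
    by_cases h0 : F (e j) = 0
    · exact ⟨0, 1, by simp, by simpa [← S.mem_iff] using h0⟩
    · obtain ⟨r, hr⟩ := exists_smul_of_det2_eq_zero h0 hdet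
      exact ⟨1, -r, by simp, by rw [← S.mem_iff]; simp [hr]⟩
  set x : Fin 4 → ℝ := a • e i + b • e j with hxdef
  have hxi : x i = a := by simp [x, e, hij]
  have hxj : x j = b := by simp [x, e, hij.symm]
  have hxk : x k = 0 := by simp [x, e, hik.symm, hjk.symm]
  have hxl : x l = 0 := by simp [x, e, hil.symm, hjl.symm]
  have hx0 : x ≠ 0 := by
    intro h
    rcases hab with h' | h'
    · exact h' (by rw [← hxi, h]; rfl)
    · exact h' (by rw [← hxj, h]; rfl)
  have hqij : ∀ c : ℝ, (p i k = 0 → p i l = 0 → p i j = c → c = 0) := by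
    intro c h1 h2 h3
    have h4 := S.pi_p i
    rw [map_eq_sum, sum_four _ hij hik hil hjk hjl hkl, h1, h2, h3] at h4
    have := congrArg (fun w => det2 w (π (e i))) h4
    simpa [det2_add_left, det2_smul_left, det2_self, det2_zero_left, S.pi_det j i hij.symm]
      using this
  have hnot : ¬ (p i k = 0 ∧ p i l = 0) := by
    rintro ⟨h1, h2⟩
    obtain ⟨m, hm, hm0⟩ := S.exists_coord_ne i
    rcases eq_of_distinct i j k l hij hik hil hjk hjl hkl m with rfl | rfl | rfl | rfl
    · exact hm rfl
    · exact hm0 (hqij _ h1 h2 rfl)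
    · exact hm0 h1
    · exact hm0 h2
  have hind : LinearIndependent ℝ ![x, p i] := by
    rw [LinearIndependent.pair_iff]
    intro c d hcd
    have h1 := congrFun hcd k
    have h2 := congrFun hcd l
    simp only [Pi.add_apply, Pi.smul_apply, hxk, hxl, smul_eq_mul, mul_zero, zero_add,
      Pi.zero_apply] at h1 h2
    have hd : d = 0 := by
      by_contra hd
      exact hnot ⟨by simpa [hd] using h1, by simpa [hd] using h2⟩
    refine ⟨?_, hd⟩
    rw [hd, zero_smul, add_zero] at hcd
    exact (smul_eq_zero.1 hcd).resolve_right hx0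
  have main : ∀ k l : Fin 4, i ≠ k → k ≠ l → i ≠ l → x k = 0 → x l = 0 → p i l = 0 := by
    intro k l hik hkl hil hxk hxl
    by_contra hl0
    obtain ⟨c, d, hcd⟩ := exists_combination S.dim hx (S.p_mem i) (S.p_mem k) hind
    have h1 := congrFun hcd l
    have h2 := congrFun hcd k
    simp only [Pi.add_apply, Pi.smul_apply, hxk, hxl, smul_eq_mul, mul_zero, zero_add] at h1 h2
    obtain ⟨z1, hz1⟩ := S.coord_int (k := k) (l := l) hkl.symm
    obtain ⟨z2, hz2⟩ := S.coord_int (k := i) (l := l) hil.symm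
    obtain ⟨z3, hz3⟩ := S.coord_int (k := i) (l := k) hik.symm
    apply S.not_rat k
    refine ⟨z1 / z2 * z3, ?_⟩
    rw [h2, hz3]
    have : d = z1 / z2 := by
      rw [← hz1, ← hz2, h1]; field_simp
    rw [this]; push_cast; ring
  exact hnot ⟨main l k hil hkl.symm hik hxl hxk, main k l hik hkl hil hxk hxl⟩

lemma F_det' : ∀ j k, j ≠ k → det2 (F (e j)) (F (e k)) ≠ 0 := fun _ _ h => S.F_det h

lemma F_e_ne (k : Fin 4) : F (e k) ≠ 0 := by
  intro h
  obtain ⟨j, -, -, hkj, -⟩ := exists_other_three k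
  exact S.F_det hkj (by rw [h, det2_zero_left])

lemma finrank_ker_pi : Module.finrank ℝ (LinearMap.ker π) = 2 := by
  let ρ : V →ₗ[ℝ] (Fin 2 → ℝ) := π ∘ₗ V.subtype
  have hinj : Function.Injective ρ := by
    rw [← LinearMap.ker_eq_bot, LinearMap.ker_eq_bot']
    intro x hx
    exact Subtype.ext (S.pi_inj x.1 x.2 hx)
  have hsurj : Function.Surjective ρ :=
    (LinearMap.injective_iff_surjective_of_finrank_eq_finrank (by simp [S.dim])).1 hinj
  have hs : LinearMap.range π = ⊤ := by
    rw [LinearMap.range_eq_top]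
    intro z
    obtain ⟨x, hx⟩ := hsurj z
    exact ⟨x.1, hx⟩
  have := π.finrank_range_add_finrank_ker
  rw [hs, finrank_top] at this
  simp only [Module.finrank_fin_fun] at this
  omega

end LinearSetting


/-- A real number on which every `ℚ`-linear form vanishing at `1` vanishes is rational. -/
lemma exists_rat_of_forall_linear {x : ℝ} (h : ∀ θ : ℝ →ₗ[ℚ] ℚ, θ 1 = 0 → θ x = 0) :
    ∃ c : ℚ, x = c := by
  by_contra hne
  have hx : x ∉ Submodule.span ℚ {(1 : ℝ)} := by
    rw [Submodule.mem_span_singleton]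
    rintro ⟨c, hc⟩
    exact hne ⟨c, by rw [← hc, Rat.smul_def, mul_one]⟩
  obtain ⟨θ, hθ, hle⟩ := Submodule.exists_le_ker_of_notMem hx
  exact hθ (h θ (hle (Submodule.mem_span_singleton_self 1)))

lemma rat_linear_int_mul (θ : ℝ →ₗ[ℚ] ℚ) (x : ℝ) (z : ℤ) : θ (x * z) = θ x * z := by
  have : x * z = (z : ℚ) • x := by rw [Rat.smul_def]; push_cast; ring
  rw [this, map_smul, smul_eq_mul, mul_comm]

lemma rat_linear_rat_mul (θ : ℝ →ₗ[ℚ] ℚ) (x : ℝ) (c : ℚ) : θ (x * c) = θ x * c := by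
  have : x * c = c • x := by rw [Rat.smul_def]; ring
  rw [this, map_smul, smul_eq_mul, mul_comm]

lemma rat_linear_rat (θ : ℝ →ₗ[ℚ] ℚ) (h : θ 1 = 0) (c : ℚ) : θ (c : ℝ) = 0 := by
  have := rat_linear_rat_mul θ 1 c
  rwa [one_mul, h, zero_mul] at this

lemma rat_linear_int (θ : ℝ →ₗ[ℚ] ℚ) (h : θ 1 = 0) (c : ℤ) : θ (c : ℝ) = 0 := by
  simpa using rat_linear_rat θ h c

/-! ### Rigidity of the slope and its arithmetic consequence. -/

namespace LinearSetting

variable {V : Submodule ℝ (Fin 4 → ℝ)} {p : Fin 4 → Fin 4 → ℝ}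
  {π F : (Fin 4 → ℝ) →ₗ[ℝ] (Fin 2 → ℝ)} {t : Fin 4 → ℝ}

/-- The subperiod moved along `e k` into the kernel of the projection. -/
def conj (p : Fin 4 → Fin 4 → ℝ) (t : Fin 4 → ℝ) (k : Fin 4) : Fin 4 → ℝ := p k - t k • e k

lemma conj_apply_ne {k l : Fin 4} (h : l ≠ k) : conj p t k l = p k l := by
  simp [conj, e, h]

lemma conj_apply_self (k : Fin 4) : conj p t k k = p k k - t k := by
  simp [conj, e]

variable (S : LinearSetting V p π F t)
include S

lemma pi_conj (k : Fin 4) : π (conj p t k) = 0 := by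
  simp [conj, S.pi_p]

lemma F_conj (k : Fin 4) : F (conj p t k) = -(t k • F (e k)) := by
  simp [conj, S.F_p]

lemma conj_ne (k : Fin 4) : conj p t k ≠ 0 := by
  obtain ⟨l, hl, h⟩ := S.exists_coord_ne k
  intro h0
  exact h (by rw [← conj_apply_ne (p := p) (t := t) hl, h0]; rfl)

/-- The deformation does not change the image under `π`, which is injective on `V`. -/
lemma finrank_map_add {A : (Fin 4 → ℝ) →ₗ[ℝ] (Fin 4 → ℝ)} (hA : ∀ x, π (A x) = 0) :
    Module.finrank ℝ (V.map (LinearMap.id + A)) = 2 := by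
  have hinj : Function.Injective ((LinearMap.id + A) ∘ₗ V.subtype) := by
    rw [← LinearMap.ker_eq_bot, LinearMap.ker_eq_bot']
    intro x hx
    have h1 : π (x.1 + A x.1) = 0 := by
      have := congrArg π hx
      simpa using this
    rw [map_add, hA, add_zero] at h1
    exact Subtype.ext (S.pi_inj x.1 x.2 h1)
  have h := LinearMap.finrank_range_of_inj hinj
  rw [LinearMap.range_comp, Submodule.range_subtype] at h
  rw [h, S.dim]

/-- When only finitely many slopes have the given subperiods, the slope has no infinitesimal
deformation with the same subperiods. -/
lemma rigid (hprim : ∀ k (r : Fin 4 → ℤ) (n : ℕ), omega k (p k) = n • intVec r → n = 1)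
    (hfin : {V' : Submodule ℝ (Fin 4 → ℝ) | Module.finrank ℝ V' = 2 ∧
      ∀ i, ∃ p', IsSubperiod V' i p' ∧ omega i p' = omega i (p i)}.Finite)
    {μ : Fin 4 → ℝ} (hμ : ∀ j, ∑ k, conj p t j k • (μ k • conj p t k) = 0) : μ = 0 := by
  by_contra hμ0
  obtain ⟨k₀, hk₀⟩ := Function.ne_iff.1 hμ0
  -- By `hμ`, `A` kills every `conj p t k`, so `A (p k)` is a multiple of `conj p t k`, which agrees
  -- with `p k` outside coordinate k. Moving `V` by `id + s • A` therefore only rescales the shadows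
  -- of the subperiods, while its values in ker π make the moved slopes pairwise distinct.
  let A : (Fin 4 → ℝ) →ₗ[ℝ] (Fin 4 → ℝ) :=
    ∑ k, (LinearMap.proj k : (Fin 4 → ℝ) →ₗ[ℝ] ℝ).smulRight (μ k • conj p t k)
  have hA : ∀ x, A x = ∑ k, x k • (μ k • conj p t k) := fun x => by
    simp [A]
  have hπA : ∀ x, π (A x) = 0 := fun x => by
    rw [hA, map_sum]
    exact Finset.sum_eq_zero fun k _ => by rw [map_smul, map_smul, S.pi_conj]; simp
  have hAe : ∀ k, A (e k) = μ k • conj p t k := fun k => by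
    rw [hA, Finset.sum_eq_single k]
    · simp [e]
    · intro m _ hm; simp [e, hm]
    · simp
  have hAp : ∀ k, A (p k) = (t k * μ k) • conj p t k := fun k => by
    have h1 : p k = conj p t k + t k • e k := by simp [conj]
    conv_lhs => rw [h1]
    rw [map_add, hA (conj p t k), hμ, map_smul, hAe, smul_smul, zero_add]
  let Vs : ℝ → Submodule ℝ (Fin 4 → ℝ) := fun s => V.map (LinearMap.id + s • A)
  have hπsA : ∀ (s : ℝ) x, π ((s • A) x) = 0 := fun s x => by
    rw [LinearMap.smul_apply, map_smul, hπA, smul_zero]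
  have hVs_inj : Function.Injective Vs := by
    intro s s' hss
    have h1 : p k₀ + s • A (p k₀) ∈ Vs s := ⟨p k₀, S.p_mem k₀, by simp⟩
    rw [hss] at h1
    obtain ⟨x, hx, h⟩ := h1
    simp only [LinearMap.add_apply, LinearMap.id_apply, LinearMap.smul_apply] at h
    have hx' : x = p k₀ := by
      have h2 := congrArg π h
      simp only [map_add, map_smul, hπA, smul_zero, add_zero] at h2
      exact sub_eq_zero.1 (S.pi_inj _ (V.sub_mem hx (S.p_mem _)) (by rw [map_sub, h2, sub_self]))
    rw [hx', add_right_inj, hAp, smul_smul, smul_smul] at h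
    have h3 := smul_left_injective ℝ (S.conj_ne k₀) h
    have h4 : t k₀ * μ k₀ ≠ 0 := mul_ne_zero (S.t_ne k₀) hk₀
    exact (mul_right_cancel₀ h4 h3).symm
  -- For 0 < s < 1/(1+M) no rescaling factor `1 + s * (t k * μ k)` vanishes.
  let M : ℝ := ∑ k, |t k * μ k|
  have hM : 0 ≤ M := Finset.sum_nonneg fun k _ => abs_nonneg _
  have hpos : ∀ s ∈ Set.Ioo 0 (1 / (1 + M)), ∀ k, 1 + s * (t k * μ k) ≠ 0 := by
    intro s hs k h
    have h1 : |t k * μ k| ≤ M :=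
      Finset.single_le_sum (f := fun k => |t k * μ k|) (fun k _ => abs_nonneg _)
        (Finset.mem_univ k)
    have h2 : s * (1 + M) < 1 := by
      have := hs.2
      rwa [lt_div_iff₀ (by linarith)] at this
    have h3 := neg_abs_le (t k * μ k)
    nlinarith [hs.1]
  have hsub : Vs '' Set.Ioo 0 (1 / (1 + M)) ⊆ {V' : Submodule ℝ (Fin 4 → ℝ) |
      Module.finrank ℝ V' = 2 ∧ ∀ i, ∃ p', IsSubperiod V' i p' ∧ omega i p' = omega i (p i)} := by
    rintro _ ⟨s, hs, rfl⟩
    have hd := S.finrank_map_add (hπsA s)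
    refine ⟨hd, fun i => ?_⟩
    have hc := hpos s hs i
    let c := 1 + s * (t i * μ i)
    have hmem : c⁻¹ • (p i + s • A (p i)) ∈ Vs s :=
      (Vs s).smul_mem _ ⟨p i, S.p_mem i, by simp⟩
    have heq : omega i (c⁻¹ • (p i + s • A (p i))) = omega i (p i) := by
      ext l
      by_cases hl : l = i
      · subst hl; simp [omega]
      · rw [omega_apply_ne hl, omega_apply_ne hl, hAp]
        simp only [Pi.smul_apply, Pi.add_apply, smul_eq_mul, conj_apply_ne hl]
        have : p i l + s * (t i * μ i * p i l) = c * p i l := by simp only [c]; ring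
        rw [this, inv_mul_cancel_left₀ hc]
    refine ⟨_, ⟨hmem, fun E hE => ?_⟩, heq⟩
    have hint := S.omega_mem i
    rw [heq]
    refine ⟨hint, S.omega_ne i, ?_, ?_⟩
    · have := isPeriod_shadow hd hE hmem (by rw [heq]; exact hint)
      rwa [heq] at this
    · rintro _ ⟨r, rfl⟩ - n hn
      exact hprim i r n hn
  refine (Set.Infinite.image hVs_inj.injOn (Set.Ioo_infinite ?_)) (hfin.subset hsub)
  positivity

/-- If an integer vector not in `Re_i + V` were projected onto the `i`-th direction, the
slope would contain a rational vector. -/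
lemma F_det_eq_zero (hrig : ∀ μ : Fin 4 → ℝ,
      (∀ j, ∑ k, conj p t j k • (μ k • conj p t k) = 0) → μ = 0)
    {i : Fin 4} {z : Fin 4 → ℤ} (hz : det2 (π (intVec z)) (π (e i)) = 0) :
    det2 (F (intVec z)) (F (e i)) = 0 := by
  by_contra hne
  have hW := S.finrank_ker_pi
  have hmem : ∀ k, conj p t k ∈ LinearMap.ker π := fun k => S.pi_conj k
  -- Coordinates of the vectors `conj p t k`, `k ≠ i`, are rational.
  obtain ⟨r, hr⟩ := exists_smul_of_det2_eq_zero (S.pi_e_ne i) hz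
  have hzr : intVec z - r • e i ∈ LinearMap.ker π := by
    rw [LinearMap.mem_ker, map_sub, map_smul, hr, sub_self]
  -- If the conclusion fails, these two vectors form a basis of ker π whose coordinates other than
  -- the i-th are integers.
  have hind : LinearIndependent ℝ ![intVec z - r • e i, conj p t i] := by
    rw [LinearIndependent.pair_iff]
    intro a b hab
    have h1 := congrArg (fun x => det2 (F x) (F (e i))) hab
    simp only [map_add, map_smul, map_sub, S.F_conj, det2_add_left, det2_smul_left,
      det2_sub_left, det2_neg_left, det2_self, map_zero, det2_zero_left] at h1
    have ha : a = 0 := by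
      rcases mul_eq_zero.1 (show a * det2 (F (intVec z)) (F (e i)) = 0 by linarith) with h | h
      · exact h
      · exact absurd h hne
    refine ⟨ha, ?_⟩
    rw [ha, zero_smul, zero_add] at hab
    exact (smul_eq_zero.1 hab).resolve_right (S.conj_ne i)
  -- Take `θ` ℚ-linear with `θ 1 = 0` and apply it to the coordinates of `conj p t k` in the basis
  -- above. The vector `y = θ(a) z + θ(b) q` then vanishes outside coordinates i and k, while `π y`
  -- is parallel to `π (e i)`; so its k-th coordinate, which is `θ (conj p t k k)`, is zero.
  have hrat : ∀ k, k ≠ i → ∃ c : ℚ, conj p t k k = c := by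
    intro k hk
    apply exists_rat_of_forall_linear
    intro θ hθ
    obtain ⟨a, b, hab⟩ := exists_combination hW hzr (hmem i) (hmem k) hind
    obtain ⟨q, hq⟩ := S.omega_mem i
    have hcoord : ∀ l, l ≠ i → θ (conj p t k l) = θ a * z l + θ b * q l := by
      intro l hl
      have h1 := congrFun hab l
      have h2 : p i l = q l := by
        have := congrFun hq l
        rw [omega_apply_ne hl] at this
        exact this.symm
      simp only [Pi.add_apply, Pi.smul_apply, Pi.sub_apply, e_ne hl, smul_eq_mul, mul_zero,
        sub_zero, conj_apply_ne hl, h2, intVec] at h1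
      rw [h1, map_add, rat_linear_int_mul, rat_linear_int_mul]
    have hzero : ∀ l, l ≠ i → l ≠ k → (θ a : ℝ) * z l + θ b * q l = 0 := by
      intro l hl hlk
      have h1 := hcoord l hl
      rw [conj_apply_ne hlk] at h1
      obtain ⟨c, hc⟩ := S.coord_int hlk
      rw [hc, rat_linear_int θ hθ] at h1
      exact_mod_cast h1.symm
    have hq' : det2 (π (intVec q)) (π (e i)) = 0 := by
      rw [hq, omega_eq, map_sub, S.pi_p, map_smul, det2_sub_left, det2_smul_left,
        det2_smul_left, det2_self]
      ring
    let y : Fin 4 → ℝ := (θ a : ℝ) • intVec z + (θ b : ℝ) • intVec q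
    have h3 : det2 (π y) (π (e i)) = 0 := by
      simp only [y, map_add, map_smul, det2_add_left, det2_smul_left, hz, hq']
      ring
    rw [map_eq_sum, det2_sum_left, Finset.sum_eq_single k] at h3
    · rw [det2_smul_left] at h3
      have h4 : y k = 0 := (mul_eq_zero.1 h3).resolve_right (S.pi_det k i hk)
      rw [hcoord k hk]
      have : (θ a : ℝ) * z k + θ b * q k = 0 := h4
      exact_mod_cast this
    · intro l _ hlk
      rw [det2_smul_left]
      by_cases hl : l = i
      · subst hl; rw [det2_self, mul_zero]
      · have : y l = 0 := hzero l hl hlk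
        rw [this, zero_mul]
    · simp
  have hrat' : ∀ k, k ≠ i → ∀ l, ∃ c : ℚ, conj p t k l = c := by
    intro k hk l
    by_cases hl : l = k
    · subst hl; exact hrat l hk
    · obtain ⟨c, hc⟩ := S.coord_int hl
      exact ⟨c, by rw [conj_apply_ne hl, hc]; simp⟩
  -- So are those of `conj p t i`.
  obtain ⟨k, k', _, hik, hik', _, hkk', _, _⟩ := exists_other_three i
  have hind' : LinearIndependent ℝ ![conj p t k, conj p t k'] := by
    rw [LinearIndependent.pair_iff]
    intro a b hab
    have h1 := congrArg (fun x => det2 (F x) (F (e k))) hab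
    have h2 := congrArg (fun x => det2 (F x) (F (e k'))) hab
    simp only [map_add, map_smul, S.F_conj, det2_add_left, det2_smul_left,
      det2_neg_left, det2_self, map_zero, det2_zero_left] at h1 h2
    have n1 := S.F_det hkk'
    have n2 := S.F_det hkk'.symm
    have t1 := S.t_ne k
    have t2 := S.t_ne k'
    constructor
    · simpa [n1, t1] using h2
    · simpa [n2, t2] using h1
  -- The same device in the rational basis `conj p t k`, `conj p t k'` gives a multiple of `e i`
  -- lying in ker π, hence zero.
  have hrati : ∀ l, ∃ c : ℚ, conj p t i l = c := by
    obtain ⟨a, b, hab⟩ := exists_combination hW (hmem k) (hmem k') (hmem i) hind'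
    choose c hc using hrat' k hik.symm
    choose c' hc' using hrat' k' hik'.symm
    intro l
    by_cases hl : l = i
    swap
    · obtain ⟨z, hz⟩ := S.coord_int hl
      exact ⟨z, by rw [conj_apply_ne hl, hz]; simp⟩
    subst hl
    apply exists_rat_of_forall_linear
    intro θ hθ
    have hcoord : ∀ m, θ (conj p t l m) = θ a * c m + θ b * c' m := by
      intro m
      have h1 := congrFun hab m
      simp only [Pi.add_apply, Pi.smul_apply, smul_eq_mul, hc, hc'] at h1
      rw [h1, map_add, rat_linear_rat_mul, rat_linear_rat_mul]
    have hval : (θ a : ℝ) • conj p t k + (θ b : ℝ) • conj p t k' =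
        (θ (conj p t l l) : ℝ) • e l := by
      ext m
      have h1 := hcoord m
      simp only [Pi.add_apply, Pi.smul_apply, smul_eq_mul, hc, hc']
      by_cases hm : m = l
      · subst hm
        rw [h1, e_self]; push_cast; ring
      · obtain ⟨z, hz⟩ := S.coord_int hm
        rw [conj_apply_ne hm, hz, rat_linear_int θ hθ] at h1
        rw [e_ne hm, mul_zero]
        exact_mod_cast h1.symm
    have h2 := congrArg π hval
    rw [map_add, map_smul, map_smul, map_smul, S.pi_conj, S.pi_conj] at h2
    have h3 := (smul_eq_zero.1 (by simpa only [smul_zero, add_zero] using h2.symm)).resolve_right (S.pi_e_ne l)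
    exact_mod_cast h3
  have hratall : ∀ k l, ∃ c : ℚ, conj p t k l = c := fun k l => by
    by_cases hk : k = i
    · subst hk; exact hrati l
    · exact hrat' k hk l
  choose c hc using hratall
  have ht : ∀ k, ∃ a : ℚ, (t k)⁻¹ = a := by
    intro k₀
    apply exists_rat_of_forall_linear
    intro θ hθ
    -- Adding `conj p t j` to the left side gives a combination of the `p k`, which lies in V ∩ ker
    -- π = 0. Since the entries of `conj` are rational, applying `θ` turns this identity into the
    -- rigidity system for μ_k = θ(1/t_k).
    have hsum : ∀ j, ∑ k, conj p t j k • ((t k)⁻¹ • conj p t k) = -conj p t j := by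
      intro j
      have h1 : ∑ k, conj p t j k • ((t k)⁻¹ • conj p t k) + conj p t j =
          ∑ k, conj p t j k • ((t k)⁻¹ • p k) := by
        conv_lhs => rw [sum_smul_e (conj p t j)]
        rw [← Finset.sum_add_distrib]
        refine Finset.sum_congr rfl fun k _ => ?_
        rw [← sum_smul_e, ← smul_add]
        congr 1
        simp only [conj, smul_sub, smul_smul, inv_mul_cancel₀ (S.t_ne k)]
        simp
      have h2 : ∑ k, conj p t j k • ((t k)⁻¹ • p k) ∈ V :=
        V.sum_mem fun k _ => V.smul_mem _ (V.smul_mem _ (S.p_mem k))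
      have h3 : π (∑ k, conj p t j k • ((t k)⁻¹ • p k)) = 0 := by
        rw [← h1, map_add, S.pi_conj, map_sum, add_zero]
        exact Finset.sum_eq_zero fun k _ => by rw [map_smul, map_smul, S.pi_conj]; simp
      rw [S.pi_inj _ h2 h3] at h1
      exact eq_neg_of_add_eq_zero_left h1
    have hμ : (fun k => (θ ((t k)⁻¹) : ℝ)) = 0 := by
      apply hrig
      intro j
      ext l
      have h1 := congrArg θ (congrFun (hsum j) l)
      simp only [Finset.sum_apply, Pi.smul_apply, smul_eq_mul, Pi.neg_apply, map_sum, map_neg,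
        hc, rat_linear_rat θ hθ, neg_zero] at h1
      have h2 : ∀ k, θ ((c j k : ℝ) * ((t k)⁻¹ * (c k l : ℝ))) = c j k * (θ ((t k)⁻¹) * c k l) := by
        intro k
        rw [mul_comm, rat_linear_rat_mul, rat_linear_rat_mul, mul_comm]
      simp only [h2] at h1
      simp only [Finset.sum_apply, Pi.smul_apply, smul_eq_mul, hc, Pi.zero_apply]
      exact_mod_cast h1
    simpa using congrFun hμ k₀
  obtain ⟨a, ha⟩ := ht i
  apply S.not_rat i
  refine ⟨c i i + a⁻¹, ?_⟩
  have h1 := hc i i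
  rw [conj_apply_self] at h1
  push_cast
  rw [← h1, ← ha, inv_inv]; ring

end LinearSetting


/-! ### Coordinates in a tile -/

/-- The first coordinate of a point relative to a tile. -/
noncomputable def Tile.coordFst (v : Fin 4 → Fin 2 → ℝ) (τ : Tile) (P : Fin 2 → ℝ) : ℝ :=
  det2 (P - τ.base) (v τ.snd) / det2 (v τ.fst) (v τ.snd)

/-- The second coordinate of a point relative to a tile. -/
noncomputable def Tile.coordSnd (v : Fin 4 → Fin 2 → ℝ) (τ : Tile) (P : Fin 2 → ℝ) : ℝ :=
  det2 (v τ.fst) (P - τ.base) / det2 (v τ.fst) (v τ.snd)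

lemma continuous_det2_left (c : Fin 2 → ℝ) : Continuous fun P : Fin 2 → ℝ => det2 P c := by
  unfold det2; fun_prop

lemma continuous_det2_right (c : Fin 2 → ℝ) : Continuous fun P : Fin 2 → ℝ => det2 c P := by
  unfold det2; fun_prop

lemma Tile.continuous_coordFst (v : Fin 4 → Fin 2 → ℝ) (τ : Tile) : Continuous (τ.coordFst v) :=
  ((continuous_det2_left _).comp (continuous_id.sub continuous_const)).div_const _

lemma Tile.continuous_coordSnd (v : Fin 4 → Fin 2 → ℝ) (τ : Tile) : Continuous (τ.coordSnd v) :=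
  ((continuous_det2_right _).comp (continuous_id.sub continuous_const)).div_const _

lemma Tile.eq_coord {v : Fin 4 → Fin 2 → ℝ} {τ : Tile} (h : det2 (v τ.fst) (v τ.snd) ≠ 0)
    (P : Fin 2 → ℝ) :
    P = τ.base + (τ.coordFst v P • v τ.fst + τ.coordSnd v P • v τ.snd) := by
  have := det2_expand h (P - τ.base)
  unfold Tile.coordFst Tile.coordSnd
  rw [← this]; abel

lemma Tile.coordFst_apply {v : Fin 4 → Fin 2 → ℝ} {τ : Tile} (h : det2 (v τ.fst) (v τ.snd) ≠ 0)
    (s r : ℝ) : τ.coordFst v (τ.base + (s • v τ.fst + r • v τ.snd)) = s := by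
  unfold Tile.coordFst
  rw [add_sub_cancel_left, det2_add_left, det2_smul_left, det2_smul_left, det2_self]
  field_simp; simp

lemma Tile.coordSnd_apply {v : Fin 4 → Fin 2 → ℝ} {τ : Tile} (h : det2 (v τ.fst) (v τ.snd) ≠ 0)
    (s r : ℝ) : τ.coordSnd v (τ.base + (s • v τ.fst + r • v τ.snd)) = r := by
  unfold Tile.coordSnd
  rw [add_sub_cancel_left, det2_add_right, det2_smul_right, det2_smul_right, det2_self]
  field_simp; simp

lemma Tile.mem_region_iff {v : Fin 4 → Fin 2 → ℝ} {τ : Tile} (h : det2 (v τ.fst) (v τ.snd) ≠ 0)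
    (P : Fin 2 → ℝ) : P ∈ τ.region v ↔
      τ.coordFst v P ∈ Set.Icc (0 : ℝ) 1 ∧ τ.coordSnd v P ∈ Set.Icc (0 : ℝ) 1 := by
  constructor
  · rintro ⟨_, ⟨s, hs, r, hr, rfl⟩, rfl⟩
    simp only [Tile.coordFst_apply h, Tile.coordSnd_apply h]
    exact ⟨hs, hr⟩
  · rintro ⟨h1, h2⟩
    exact ⟨_, ⟨_, h1, _, h2, rfl⟩, (Tile.eq_coord h P).symm⟩

/-- Turns disjointness of interiors into a contradiction once a point with coordinates strictly
between 0 and 1 in two tiles is exhibited. -/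
lemma Tile.mem_interior_region {v : Fin 4 → Fin 2 → ℝ} {τ : Tile}
    (h : det2 (v τ.fst) (v τ.snd) ≠ 0) {s r : ℝ} (hs : s ∈ Set.Ioo (0 : ℝ) 1)
    (hr : r ∈ Set.Ioo (0 : ℝ) 1) :
    τ.base + (s • v τ.fst + r • v τ.snd) ∈ interior (τ.region v) := by
  rw [mem_interior]
  refine ⟨τ.coordFst v ⁻¹' Set.Ioo 0 1 ∩ τ.coordSnd v ⁻¹' Set.Ioo 0 1, ?_, ?_, ?_⟩
  · rintro P ⟨h1, h2⟩
    rw [Tile.mem_region_iff h]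
    exact ⟨Ioo_subset_Icc_self h1, Ioo_subset_Icc_self h2⟩
  · exact (isOpen_Ioo.preimage (τ.continuous_coordFst v)).inter
      (isOpen_Ioo.preimage (τ.continuous_coordSnd v))
  · exact ⟨by simpa only [Set.mem_preimage, Tile.coordFst_apply h] using hs,
      by simpa only [Set.mem_preimage, Tile.coordSnd_apply h] using hr⟩

/-- The sign attached to a direction. -/
noncomputable def sgn (up : Bool) : ℝ := if up then 1 else -1

lemma mem_interior_orderedFace {π : (Fin 4 → ℝ) →ₗ[ℝ] (Fin 2 → ℝ)} {j m : Fin 4}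
    (hdet : det2 (π (e j)) (π (e m)) ≠ 0) (up : Bool) (b : Fin 4 → ℤ) {s r : ℝ}
    (hs : s ∈ Set.Ioo (0 : ℝ) 1) (hr : r ∈ Set.Ioo (0 : ℝ) 1) :
    π (intVec b) + s • π (e j) + (r * sgn up) • π (e m) ∈
      interior (((orderedFace (faceBase m up b) j m).project π).region (edgeVec π)) := by
  obtain ⟨r', hr', hrr⟩ : ∃ r' ∈ Set.Ioo (0 : ℝ) 1, π (intVec b) + s • π (e j) +
      (r * sgn up) • π (e m) = π (intVec (faceBase m up b)) + (s • π (e j) + r' • π (e m)) := by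
    cases up
    · refine ⟨1 - r, ⟨by linarith [hr.2], by linarith [hr.1]⟩, ?_⟩
      simp only [sgn, faceBase, Bool.false_eq_true, if_false, intVec_sub, intVec_single_one, map_sub,
        sub_smul, one_smul, mul_neg, mul_one, neg_smul]
      abel
    · refine ⟨r, hr, ?_⟩
      simp only [sgn, faceBase, if_true, mul_one]
      abel
  rw [hrr]
  unfold orderedFace
  split_ifs
  · exact Tile.mem_interior_region (v := edgeVec π)
      (τ := (Face.mk (faceBase m up b) j m).project π) hdet hs hr'
  · rw [add_comm (s • π (e j))]
    refine Tile.mem_interior_region (v := edgeVec π)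
      (τ := (Face.mk (faceBase m up b) m j).project π) ?_ hr' hs
    change det2 (π (e m)) (π (e j)) ≠ 0
    rw [det2_swap]; exact neg_ne_zero.2 hdet

lemma orderedFace_ne {b b' : Fin 4 → ℤ} {j m m' : Fin 4} (h : m ≠ m') :
    orderedFace b j m ≠ orderedFace b' j m' := by
  unfold orderedFace
  intro h0
  split_ifs at h0 <;> simp only [Face.mk.injEq] at h0 <;> grind

/-! ### Position of two projected faces along a shared edge. -/

namespace LinearSetting

variable {V : Submodule ℝ (Fin 4 → ℝ)} {p : Fin 4 → Fin 4 → ℝ}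
  {π F : (Fin 4 → ℝ) →ₗ[ℝ] (Fin 2 → ℝ)} {t : Fin 4 → ℝ}
  {E : AffineSubspace ℝ (Fin 4 → ℝ)} {y₀ : Fin 4 → ℝ}

/-- Two distinct selected faces sharing an edge are projected on opposite sides of this edge. -/
lemma not_same_side (S : LinearSetting V p π F t) (hE : IsCutPlane V E)
    (hπ : IsValidProjection π E) (hy : y₀ ∈ E) {j m m' : Fin 4} (hjm : j ≠ m) (hjm' : j ≠ m')
    (hmm : m ≠ m') {up up' : Bool} {b : Fin 4 → ℤ} (h1 : Borders F (F y₀) j m up b)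
    (h2 : Borders F (F y₀) j m' up' b) :
    ¬ 0 < (sgn up * det2 (π (e j)) (π (e m))) * (sgn up' * det2 (π (e j)) (π (e m'))) := by
  intro hpos
  have hD := S.pi_det j m hjm
  have hD' := S.pi_det j m' hjm'
  have hs2 : ∀ up, sgn up * sgn up = 1 := fun up => by cases up <;> simp [sgn]
  have hdis := hπ.disjoint ⟨_, h1.mem S.mem_iff hE.direction hy hjm⟩
    ⟨_, h2.mem S.mem_iff hE.direction hy hjm'⟩
    (fun h => orderedFace_ne hmm (congrArg Subtype.val h))
  -- `sgn up' • v m' = a • v j + (c * sgn up) • v m` with `c > 0`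
  set D := det2 (π (e j)) (π (e m))
  set D' := det2 (π (e j)) (π (e m'))
  set a : ℝ := sgn up' * (det2 (π (e m')) (π (e m)) / D)
  set c : ℝ := sgn up' * sgn up * (D' / D)
  have hc : 0 < c := by
    have : c = (sgn up * D * (sgn up' * D')) / (D * D) := by
      simp only [c]; field_simp
    rw [this]
    exact div_pos hpos (mul_self_pos.2 hD)
  have hexp : sgn up' • π (e m') = a • π (e j) + (c * sgn up) • π (e m) := by
    conv_lhs => rw [det2_expand hD (π (e m'))]
    rw [smul_add, smul_smul, smul_smul]
    congr 2
    simp only [c]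
    calc sgn up' * (D' / D) = sgn up' * (sgn up * sgn up) * (D' / D) := by rw [hs2, mul_one]
      _ = _ := by ring
  -- Small enough that the point at height η above the middle of the edge, in the second face, is
  -- also interior to the first: it needs η|a| < 1/2, ηc < 1 and η < 1.
  set η : ℝ := 1 / (2 + 2 * |a| + c)
  have hden : 0 < 2 + 2 * |a| + c := by positivity
  have hη : 0 < η := by positivity
  have hη1 : η * (2 + 2 * |a| + c) = 1 := by simp only [η]; field_simp
  have hηa : |η * a| < 1 / 2 := by
    rw [abs_mul, abs_of_pos hη]; nlinarith [abs_nonneg a]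
  have hP1 := mem_interior_orderedFace hD up b (s := 1 / 2 + η * a) (r := η * c)
    ⟨by linarith [(abs_lt.1 hηa).1], by linarith [(abs_lt.1 hηa).2]⟩
    ⟨by positivity, by nlinarith [abs_nonneg a]⟩
  have hP2 := mem_interior_orderedFace hD' up' b (s := 1 / 2) (r := η)
    ⟨by norm_num, by norm_num⟩ ⟨hη, by nlinarith [abs_nonneg a]⟩
  have heq : π (intVec b) + (1 / 2 + η * a) • π (e j) + (η * c * sgn up) • π (e m) =
      π (intVec b) + (1 / 2 : ℝ) • π (e j) + (η * sgn up') • π (e m') := by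
    rw [mul_smul η (sgn up'), hexp, add_smul, smul_add, smul_smul, smul_smul, mul_assoc η c]
    abel
  rw [heq] at hP1
  exact Set.disjoint_left.1 hdis hP1 hP2

end LinearSetting


lemma exists_fourth : ∀ i k l : Fin 4, ∃ j, i ≠ j ∧ k ≠ j ∧ l ≠ j := by decide

lemma exists_bound_cube (F : (Fin 4 → ℝ) →ₗ[ℝ] (Fin 2 → ℝ)) : ∃ B, ∀ u ∈ cube, ‖F u‖ ≤ B :=
  isCompact_Icc.exists_bound_of_continuousOn F.continuous_of_finiteDimensional.continuousOn

lemma sgn_mul_self (up : Bool) : sgn up * sgn up = 1 := by cases up <;> simp [sgn]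

lemma sgn_not (up : Bool) : sgn (!up) = -sgn up := by cases up <;> simp [sgn]

/-- The neighbour of `b` in direction `± e_m`. -/
def neighbour (m : Fin 4) (up : Bool) (b : Fin 4 → ℤ) : Fin 4 → ℤ :=
  b + Pi.single m (if up then 1 else -1)

lemma intVec_neighbour (m : Fin 4) (up : Bool) (b : Fin 4 → ℤ) :
    intVec (neighbour m up b) = intVec b + sgn up • e m := by
  unfold neighbour
  rw [intVec_add, intVec_single]
  cases up <;> simp [sgn]

lemma Borders.neighbour {F : (Fin 4 → ℝ) →ₗ[ℝ] (Fin 2 → ℝ)} {a : Fin 2 → ℝ} {j m : Fin 4}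
    (hjm : j ≠ m) {up : Bool} {b : Fin 4 → ℤ} (h : Borders F a j m up b) :
    Borders F a j m (!up) (neighbour m up b) := by
  obtain ⟨u, hu, huj, hum, h⟩ := h
  refine ⟨u + sgn up • e m, mem_cube.2 fun l => ?_, by simp [huj, e, hjm], ?_, ?_⟩
  · have := mem_cube.1 hu l
    by_cases hl : l = m
    · subst hl
      cases up <;> simp [sgn, e] at hum ⊢ <;> simp [hum]
    · simpa [e, hl] using this
  · cases up <;> simp [sgn, e] at hum ⊢ <;> simp [hum]
  · rw [intVec_neighbour, map_add, map_add, ← h]; abel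

/-! ### Ribbons of the canonical tiling and the width of its levels. -/

namespace LinearSetting

variable {V : Submodule ℝ (Fin 4 → ℝ)} {p : Fin 4 → Fin 4 → ℝ}
  {π F : (Fin 4 → ℝ) →ₗ[ℝ] (Fin 2 → ℝ)} {t : Fin 4 → ℝ}
  {E : AffineSubspace ℝ (Fin 4 → ℝ)} {y₀ : Fin 4 → ℝ}

/-- Slide `y₀` inside the cutting plane along `p j` until its j-th coordinate is 0, then round the
coordinates up. -/
lemma exists_edge (S : LinearSetting V p π F t) (y₀ : Fin 4 → ℝ) (j : Fin 4) :
    ∃ b : Fin 4 → ℤ, ∃ u ∈ cube, u j = 0 ∧ F (intVec b) - F y₀ = F u := by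
  have hp : p j j ≠ 0 := fun h => S.not_rat j ⟨0, by simpa using h⟩
  let y := y₀ - (y₀ j / p j j) • p j
  have hyj : y j = 0 := by simp [y, hp]
  have hFy : F y = F y₀ := by simp [y, S.F_p]
  refine ⟨fun k => ⌈y k⌉, intVec (fun k => ⌈y k⌉) - y, mem_cube.2 fun k => ?_, ?_, ?_⟩
  · have h1 := Int.le_ceil (y k)
    have h2 := Int.ceil_lt_add_one (y k)
    simp only [Pi.sub_apply, intVec]
    constructor <;> linarith
  · simp [intVec, hyj]
  · rw [map_sub, hFy]

/-- Along a relation between three of the vectors `F e_m`, the orientations of the projected faces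
agree. -/
lemma ribbon_sign (S : LinearSetting V p π F t) (hE : IsCutPlane V E)
    (hπ : IsValidProjection π E) {x : Fin 4 → ℝ} (hxV : x ∈ V) (hx0 : x ≠ 0)
    {j : Fin 4} (hxj : x j = 0) {m m' : Fin 4} (hm : m ≠ j) (hm' : m' ≠ j) :
    0 < (x m * det2 (π (e j)) (π (e m))) * (x m' * det2 (π (e j)) (π (e m'))) := by
  obtain ⟨y₀, hy⟩ := hE.nonempty
  have hFx : F x = 0 := (S.mem_iff x).2 hxV
  have hxm : ∀ m, m ≠ j → x m ≠ 0 := fun m hm h =>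
    hx0 (eq_zero_of_coords S.F_det' hFx hm.symm hxj h)
  set G : Fin 4 → ℝ := fun m => x m * det2 (π (e j)) (π (e m))
  have hG : ∀ m, m ≠ j → G m ≠ 0 := fun m hm => mul_ne_zero (hxm m hm) (S.pi_det j m hm.symm)
  let Edge := {b : Fin 4 → ℤ // ∃ u ∈ cube, u j = 0 ∧ F (intVec b) - F y₀ = F u}
  -- Each selected j-edge is left through a face whose second direction is traversed with the sign
  -- of the matching coordinate of `x`; iterating produces a ribbon of faces glued along j-edges.
  have hstep : ∀ b : Edge, ∃ mu : Fin 4 × Bool, mu.1 ≠ j ∧ 0 < x mu.1 * sgn mu.2 ∧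
      Borders F (F y₀) j mu.1 mu.2 b.1 := by
    intro b
    obtain ⟨m, hm, h | h⟩ := exists_exit hx0 hxj hFx b.2
    · exact ⟨(m, true), hm, by simpa [sgn] using h.1, h.2⟩
    · exact ⟨(m, false), hm, by simpa [sgn] using h.1, h.2⟩
  choose mu hmuj hmupos hmuB using hstep
  let next : Edge → Edge := fun b => ⟨neighbour (mu b).1 (mu b).2 b.1, by
    obtain ⟨u, hu, huj, -, h⟩ := (hmuB b).neighbour (hmuj b).symm
    exact ⟨u, hu, huj, h⟩⟩
  -- Successive faces of the ribbon lie on opposite sides of the edge they share. Since steps follow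
  -- the signs of `x`, this says that `G` has the same sign for both.
  have hcons : ∀ b : Edge, 0 < G (mu b).1 * G (mu (next b)).1 := by
    intro b
    have h1 : Borders F (F y₀) j (mu b).1 (!(mu b).2) (next b).1 :=
      (hmuB b).neighbour (hmuj b).symm
    have h2 := hmuB (next b)
    by_cases hmm : (mu b).1 = (mu (next b)).1
    · rw [← hmm]; exact mul_self_pos.2 (hG _ (hmuj b))
    have h3 := S.not_same_side hE hπ hy (hmuj b).symm (hmuj _).symm hmm h1 h2
    rw [sgn_not] at h3
    have h4 := mul_pos (hmupos b) (hmupos (next b))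
    have h5 := S.pi_det j _ (hmuj b).symm
    have h6 := S.pi_det j _ (hmuj (next b)).symm
    set D := det2 (π (e j)) (π (e (mu b).1))
    set D' := det2 (π (e j)) (π (e (mu (next b)).1))
    have hs1 : sgn (mu b).2 ≠ 0 := by intro h; have := sgn_mul_self (mu b).2; simp [h] at this
    have hs2 : sgn (mu (next b)).2 ≠ 0 := by
      intro h; have := sgn_mul_self (mu (next b)).2; simp [h] at this
    have h7 : 0 < (sgn (mu b).2 * D) * (sgn (mu (next b)).2 * D') := by
      refine lt_of_le_of_ne ?_ (mul_ne_zero (mul_ne_zero hs1 h5) (mul_ne_zero hs2 h6)).symm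
      nlinarith
    have h8 := mul_pos h4 h7
    have h9 : G (mu b).1 * G (mu (next b)).1 = (x (mu b).1 * sgn (mu b).2 *
        (x (mu (next b)).1 * sgn (mu (next b)).2)) * (sgn (mu b).2 * D *
        (sgn (mu (next b)).2 * D')) := by
      calc _ = x (mu b).1 * D * (x (mu (next b)).1 * D') * (sgn (mu b).2 * sgn (mu b).2) *
            (sgn (mu (next b)).2 * sgn (mu (next b)).2) := by
              rw [sgn_mul_self, sgn_mul_self, mul_one, mul_one]
        _ = _ := by ring
    rw [h9]; exact h8
  obtain ⟨b₀, hb₀⟩ := S.exists_edge y₀ j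
  let seq : ℕ → Edge := fun r => next^[r] ⟨b₀, hb₀⟩
  have hseq : ∀ r, seq (r + 1) = next (seq r) := fun r => Function.iterate_succ_apply' _ _ _
  have hall : ∀ r, 0 < G (mu (seq 0)).1 * G (mu (seq r)).1 := by
    intro r
    induction r with
    | zero => exact mul_self_pos.2 (hG _ (hmuj _))
    | succ r ih =>
      have h1 := hcons (seq r)
      rw [← hseq] at h1
      have h2 := mul_pos ih h1
      have h3 : 0 < G (mu (seq r)).1 * G (mu (seq r)).1 := mul_self_pos.2 (hG _ (hmuj _))
      have h4 : G (mu (seq 0)).1 * G (mu (seq r)).1 * (G (mu (seq r)).1 * G (mu (seq (r + 1))).1) =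
        (G (mu (seq 0)).1 * G (mu (seq (r + 1))).1) * (G (mu (seq r)).1 * G (mu (seq r)).1) := by
        ring
      rw [h4] at h2
      exact pos_of_mul_pos_left h2 h3.le
  -- The ribbon uses all three directions: with only k and l, the displacement after r steps would
  -- have total length r, although `F` stays bounded along the ribbon and F(e_k), F(e_l) are
  -- independent.
  have hused : ∀ m₀, m₀ ≠ j → ∃ r, (mu (seq r)).1 = m₀ := by
    intro m₀ hm₀
    by_contra hne
    push Not at hne
    obtain ⟨k, l, hjk, hjl, hmk, hml, hkl⟩ := exists_others j m₀ hm₀.symm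
    let ε : Fin 4 → ℝ := fun m => if 0 < x m then 1 else -1
    have hε : ∀ m, |ε m| = 1 := fun m => by simp only [ε]; split_ifs <;> simp
    have hεs : ∀ b, sgn (mu b).2 = ε (mu b).1 := by
      intro b
      have := hmupos b
      simp only [ε]
      cases hb : (mu b).2
      · simp only [hb, sgn, Bool.false_eq_true, if_false] at this ⊢
        rw [if_neg (by linarith)]
      · simp only [hb, sgn, if_true] at this ⊢
        rw [if_pos (by linarith)]
    let z : ℕ → Fin 4 → ℝ := fun r => intVec (seq r).1 - intVec (seq 0).1
    have hz : ∀ r, z (r + 1) = z r + ε (mu (seq r)).1 • e (mu (seq r)).1 := by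
      intro r
      have : intVec (seq (r + 1)).1 = intVec (seq r).1 + sgn (mu (seq r)).2 • e (mu (seq r)).1 := by
        rw [hseq]; exact intVec_neighbour _ _ _
      simp only [z]
      rw [this, hεs]; abel
    have hinv : ∀ r, z r j = 0 ∧ z r m₀ = 0 ∧ ε k * z r k + ε l * z r l = r := by
      intro r
      induction r with
      | zero => simp [z]
      | succ r ih =>
        obtain ⟨i1, i2, i3⟩ := ih
        have hεε : ∀ m, ε m * ε m = 1 := fun m => by
          rw [← abs_mul_abs_self, hε, mul_one]
        have hcase : (mu (seq r)).1 = k ∨ (mu (seq r)).1 = l := by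
          rcases eq_of_distinct j m₀ k l hm₀.symm hjk hjl hmk hml hkl (mu (seq r)).1 with
            h | h | h | h
          · exact absurd h (hmuj _)
          · exact absurd h (hne r)
          · exact Or.inl h
          · exact Or.inr h
        rw [hz]
        rcases hcase with h | h <;> rw [h] <;>
          simp only [Pi.add_apply, Pi.smul_apply, smul_eq_mul, e_self, e_ne hjk, e_ne hjl,
            e_ne hmk, e_ne hml, e_ne hkl, e_ne hkl.symm, mul_zero, mul_one, add_zero, i1, i2,
            true_and] <;> push_cast <;> rw [← i3, mul_add, hεε] <;> ring
    obtain ⟨B, hB⟩ := exists_bound_cube F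
    have hFz : ∀ r, ‖F (z r)‖ ≤ 2 * B := by
      intro r
      obtain ⟨u, hu, -, h1⟩ := (seq r).2
      obtain ⟨u', hu', -, h2⟩ := (seq 0).2
      have : F (z r) = F u - F u' := by rw [← h1, ← h2]; simp [z]
      rw [this]
      linarith [norm_sub_le (F u) (F u'), hB u hu, hB u' hu']
    have hdet : ∀ r (k l : Fin 4), j ≠ k → j ≠ l → m₀ ≠ k → m₀ ≠ l → k ≠ l →
        |z r k| ≤ 2 * (2 * B) * ‖F (e l)‖ / |det2 (F (e k)) (F (e l))| := by
      intro r k l hjk hjl hmk hml hkl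
      have h1 : det2 (F (z r)) (F (e l)) = z r k * det2 (F (e k)) (F (e l)) := by
        rw [map_eq_sum, sum_four _ hm₀.symm hjk hjl hmk hml hkl, (hinv r).1, (hinv r).2.1]
        simp [det2_add_left, det2_smul_left, det2_self]
      have h2 := abs_det2_le (F (z r)) (F (e l))
      rw [h1, abs_mul] at h2
      rw [le_div_iff₀ (abs_pos.2 (S.F_det hkl))]
      refine h2.trans ?_
      gcongr
      exact hFz r
    obtain ⟨r, hr⟩ := exists_nat_gt (2 * (2 * B) * ‖F (e l)‖ / |det2 (F (e k)) (F (e l))| +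
      2 * (2 * B) * ‖F (e k)‖ / |det2 (F (e l)) (F (e k))|)
    have h1 := hdet r k l hjk hjl hmk hml hkl
    have h2 := hdet r l k hjl hjk hml hmk hkl.symm
    have h3 := (hinv r).2.2
    have h4 : ε k * z r k ≤ |z r k| := by
      have := le_abs_self (ε k * z r k); rwa [abs_mul, hε, one_mul] at this
    have h5 : ε l * z r l ≤ |z r l| := by
      have := le_abs_self (ε l * z r l); rwa [abs_mul, hε, one_mul] at this
    linarith
  obtain ⟨r, rfl⟩ := hused m hm
  obtain ⟨r', rfl⟩ := hused m' hm'
  have h1 := hall r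
  have h2 := hall r'
  have h3 : 0 < G (mu (seq 0)).1 * G (mu (seq 0)).1 := mul_self_pos.2 (hG _ (hmuj _))
  have h4 := mul_pos h1 h2
  have h5 : G (mu (seq 0)).1 * G (mu (seq r)).1 * (G (mu (seq 0)).1 * G (mu (seq r')).1) =
    (G (mu (seq r)).1 * G (mu (seq r')).1) * (G (mu (seq 0)).1 * G (mu (seq 0)).1) := by ring
  rw [h5] at h4
  exact pos_of_mul_pos_left h4 h3.le

/-- The direction collapsed by `π` in the space of the `i`-shadows is positively oriented with
respect to the image of the slope. -/
lemma exists_normal (S : LinearSetting V p π F t) (hE : IsCutPlane V E)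
    (hπ : IsValidProjection π E) (i : Fin 4) : ∃ n : Fin 4 → ℝ, π n = 0 ∧ n i = 0 ∧
      ∀ l, l ≠ i → 0 < n l * det2 (F (e l)) (F (e i)) := by
  obtain ⟨n, hn, hn0, hni⟩ := exists_ne_zero_coord_eq_zero S.finrank_ker_pi i
  rw [LinearMap.mem_ker] at hn
  have hnl : ∀ l, l ≠ i → n l ≠ 0 := fun l hl h =>
    hn0 (eq_zero_of_coords S.pi_det hn hl.symm hni h)
  set f : Fin 4 → ℝ := fun l => det2 (F (e l)) (F (e i))
  have hf : ∀ l, l ≠ i → f l ≠ 0 := fun l hl => S.F_det hl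
  have hpair : ∀ k l, k ≠ i → l ≠ i → 0 < (n k * f k) * (n l * f l) := by
    intro k l hk hl
    by_cases hkl : k = l
    · subst hkl; exact mul_self_pos.2 (mul_ne_zero (hnl k hk) (hf k hk))
    obtain ⟨j, hij, hkj, hlj⟩ : ∃ j, i ≠ j ∧ k ≠ j ∧ l ≠ j :=
      exists_fourth i k l
    obtain ⟨x, hxV, hx0, hxj⟩ := exists_ne_zero_coord_eq_zero S.dim j
    have h1 := S.ribbon_sign hE hπ hxV hx0 hxj hkj hlj
    -- Both relations have two terms: one from `F x = 0`, seen against `F (e i)`, the other from `π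
    -- n = 0`, seen against `π (e j)`. `ribbon_sign` compares the coefficients of `x` with the
    -- determinants, and eliminating `x` gives the sign of the product.
    have h2 : x k * f k + x l * f l = 0 := by
      have h : det2 (F x) (F (e i)) = 0 := by rw [(S.mem_iff x).2 hxV, det2_zero_left]
      rw [map_eq_sum, sum_four _ hij hk.symm hl.symm hkj.symm hlj.symm hkl, hxj] at h
      simpa [det2_add_left, det2_smul_left, det2_self] using h
    have h3 : n k * det2 (π (e j)) (π (e k)) + n l * det2 (π (e j)) (π (e l)) = 0 := by
      have h : det2 (π (e j)) (π n) = 0 := by rw [hn, det2_zero_right]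
      rw [map_eq_sum π n, sum_four _ hij hk.symm hl.symm hkj.symm hlj.symm hkl, hni] at h
      simpa [det2_add_right, det2_smul_right, det2_self] using h
    have hxl : x l ≠ 0 := fun h =>
      hx0 (eq_zero_of_coords S.F_det' ((S.mem_iff x).2 hxV) hlj h hxj)
    set D := det2 (π (e j)) (π (e k))
    set D' := det2 (π (e j)) (π (e l))
    have hD' : D' ≠ 0 := S.pi_det j l hlj.symm
    have h4 : (n k * f k) * (n l * f l) * ((x k * D) * (x l * D')) =
        (n l * D') * (n l * D') * ((x l * f l) * (x l * f l)) := by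
      have e1 : x k * f k = -(x l * f l) := by linarith
      have e2 : n k * D = -(n l * D') := by linarith
      calc _ = (x k * f k) * (n k * D) * ((x l * f l) * (n l * D')) := by ring
        _ = _ := by rw [e1, e2]; ring
    have h5 : 0 < (n k * f k) * (n l * f l) * ((x k * D) * (x l * D')) := by
      rw [h4]
      exact mul_pos (mul_self_pos.2 (mul_ne_zero (hnl l hl) hD'))
        (mul_self_pos.2 (mul_ne_zero hxl (hf l hl)))
    exact pos_of_mul_pos_left h5 h1.le
  obtain ⟨k, -, -, hik, -⟩ := exists_other_three i
  rcases lt_or_gt_of_ne (mul_ne_zero (hnl k hik.symm) (hf k hik.symm)) with h | h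
  · refine ⟨-n, by simp [hn], by simp [hni], fun l hl => ?_⟩
    have := hpair k l hik.symm hl
    have h' : n l * f l < 0 := by
      by_contra hc
      nlinarith
    simp only [Pi.neg_apply]
    change 0 < -n l * f l
    linarith
  · refine ⟨n, hn, hni, fun l hl => ?_⟩
    exact pos_of_mul_pos_right (hpair k l hik.symm hl) h.le

/-- The vertices of the canonical tiling are in a strip of half-open type. -/
lemma strict_width (S : LinearSetting V p π F t) (hE : IsCutPlane V E)
    (hπ : IsValidProjection π E) (i : Fin 4) {b c : Fin 4 → ℤ} (hb : intVec b ∈ tube E)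
    (hc : intVec c ∈ tube E) :
    det2 (F (intVec b - intVec c)) (F (e i)) < ∑ l, |det2 (F (e l)) (F (e i))| := by
  obtain ⟨n, hn, hni, hnf⟩ := S.exists_normal hE hπ i
  obtain ⟨y₀, hy⟩ := hE.nonempty
  obtain ⟨u, hu, hbu⟩ := (mem_tube_iff S.mem_iff hE.direction hy _).1 hb
  obtain ⟨w, hw, hcw⟩ := (mem_tube_iff S.mem_iff hE.direction hy _).1 hc
  by_contra hlt
  rw [not_lt] at hlt
  set f : Fin 4 → ℝ := fun l => det2 (F (e l)) (F (e i))
  have hf : ∀ l, l ≠ i → f l ≠ 0 := fun l hl => S.F_det hl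
  have hdiff : F (intVec b - intVec c) = F (u - w) := by
    rw [map_sub, map_sub, ← hbu, ← hcw]; abel
  have hsum : det2 (F (intVec b - intVec c)) (F (e i)) = ∑ l, (u l - w l) * f l := by
    rw [hdiff, map_eq_sum, det2_sum_left]
    exact Finset.sum_congr rfl fun l _ => by rw [det2_smul_left]; rfl
  rw [hsum] at hlt
  have hle : ∀ l ∈ Finset.univ, (u l - w l) * f l ≤ |f l| := by
    intro l _
    have h1 := mem_cube.1 hu l
    have h2 := mem_cube.1 hw l
    refine (le_abs_self _).trans ?_
    rw [abs_mul]
    exact mul_le_of_le_one_left (abs_nonneg _) (abs_le.2 ⟨by linarith, by linarith⟩)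
  -- Equality of the sums forces termwise equality, so outside coordinate i the cube vectors `u` and
  -- `w` sit at opposite corners.
  have heq : ∀ l, (u l - w l) * f l = |f l| := by
    have := (Finset.sum_eq_sum_iff_of_le hle).1 (le_antisymm (Finset.sum_le_sum hle) hlt)
    exact fun l => this l (Finset.mem_univ l)
  -- a whole cube of the shadow is selected
  obtain ⟨j, k, l, hij, hik, hil, hjk, hjl, hkl⟩ := exists_other_three i
  have hwl : ∀ l, l ≠ i → (0 < f l ∧ w l = 0) ∨ (f l < 0 ∧ w l = 1) := by
    intro l hl
    have h1 := mem_cube.1 hu l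
    have h2 := mem_cube.1 hw l
    have h3 := heq l
    rcases lt_or_gt_of_ne (hf l hl) with h | h
    · rw [abs_of_neg h] at h3
      have : u l - w l = -1 := by
        have : (u l - w l + 1) * f l = 0 := by linarith
        have := (mul_eq_zero.1 this).resolve_right h.ne
        linarith
      exact Or.inr ⟨h, by linarith⟩
    · rw [abs_of_pos h] at h3
      have : u l - w l = 1 := by
        have : (u l - w l - 1) * f l = 0 := by linarith
        have := (mul_eq_zero.1 this).resolve_right h.ne'
        linarith
      exact Or.inl ⟨h, by linarith⟩
  let up : Fin 4 → Bool := fun l => decide (0 < f l)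
  have hup : ∀ l, l ≠ i → w l = if up l then 0 else 1 := by
    intro l hl
    rcases hwl l hl with ⟨h1, h2⟩ | ⟨h1, h2⟩
    · simp [up, h1, h2]
    · simp [up, not_lt.2 h1.le, h2]
  have hsgn : ∀ l, l ≠ i → 0 < n l * sgn (up l) := by
    intro l hl
    have h0 := hnf l hl
    rcases hwl l hl with ⟨h1, h2⟩ | ⟨h1, h2⟩
    · simp only [sgn, up, h1, decide_true, if_true, mul_one]
      exact pos_of_mul_pos_left h0 h1.le
    · simp only [sgn, up, not_lt.2 h1.le, decide_false, Bool.false_eq_true, if_false]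
      change 0 < n l * f l at h0
      nlinarith
  -- Base of the j-edge that leaves `c` towards `b`.
  let c' : Fin 4 → ℤ := c - Pi.single j (if up j then 0 else 1)
  have hc' : intVec c' = intVec c - w j • e j := by
    simp only [c', intVec_sub, intVec_single, hup j hij.symm]
    push_cast; rfl
  have hB0 : Borders F (F y₀) j k (up k) c' := by
    refine ⟨w - w j • e j, mem_cube.2 fun m => ?_, by simp [e], ?_, ?_⟩
    · by_cases h : m = j
      · subst h; simp [e]
      · simpa [e, h] using mem_cube.1 hw m
    · simp [e, hjk.symm, hup k hik.symm]
    · rw [hc', map_sub, map_sub, ← hcw]; abel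
  have hB1 := hB0.neighbour hjk
  -- After crossing the face in direction k, two faces border the new edge: the one just crossed,
  -- going back, and one going on in direction l. The relation `π n = 0` puts both on the same side
  -- of that edge.
  have hB2 : Borders F (F y₀) j l (up l) (neighbour k (up k) c') := by
    refine ⟨w - w j • e j + sgn (up k) • e k, mem_cube.2 fun m => ?_, ?_, ?_, ?_⟩
    · by_cases h : m = j
      · subst h; simp [e, hjk]
      · by_cases h' : m = k
        · subst h'
          simp only [Pi.add_apply, Pi.sub_apply, Pi.smul_apply, e_ne h, e_self, smul_eq_mul, mul_zero,
            mul_one, hup m hik.symm, sgn]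
          split_ifs <;> norm_num
        · simpa [e, h, h'] using mem_cube.1 hw m
    · simp [e, hjk]
    · simp [e, hjl.symm, hkl.symm, hup l hil.symm]
    · rw [intVec_neighbour, hc', map_add, map_sub, map_add, map_sub, ← hcw]; abel
  apply S.not_same_side hE hπ hy hjk hjl hkl hB1 hB2
  have h3 : n k * det2 (π (e j)) (π (e k)) + n l * det2 (π (e j)) (π (e l)) = 0 := by
    have h : det2 (π (e j)) (π n) = 0 := by rw [hn, det2_zero_right]
    rw [map_eq_sum π n, sum_four _ hij hik hil hjk hjl hkl, hni] at h
    simpa [det2_add_right, det2_smul_right, det2_self] using h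
  have hk := hsgn k hik.symm
  have hl := hsgn l hil.symm
  have hD := S.pi_det j l hjl
  set D := det2 (π (e j)) (π (e k))
  set D' := det2 (π (e j)) (π (e l))
  have hnl : n l ≠ 0 := by rintro h; simp [h] at hl
  rw [sgn_not]
  have h4 : (-sgn (up k) * D) * (sgn (up l) * D') * ((n k * sgn (up k)) * (n l * sgn (up l))) =
      (n l * D') * (n l * D') := by
    have e1 : n k * D = -(n l * D') := by linarith
    calc _ = -(n k * D) * (n l * D') * (sgn (up k) * sgn (up k)) * (sgn (up l) * sgn (up l)) := by
          ring
      _ = _ := by rw [e1, sgn_mul_self, sgn_mul_self]; ring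
  refine pos_of_mul_pos_left ?_ (mul_pos hk hl).le
  rw [h4]
  exact mul_self_pos.2 (mul_ne_zero hnl hD)

end LinearSetting


/-! ### Real functions which do not decrease locally -/

/-- Propagates an estimate valid inside a single tile along a whole line, without subdividing the
line. -/
lemma le_of_eventually_le {h : ℝ → ℝ} (hc : Continuous h)
    (hloc : ∀ t, ∀ᶠ t' in 𝓝[>] t, h t ≤ h t') {a b : ℝ} (hab : a ≤ b) : h a ≤ h b := by
  have hcl : IsClosed ({t | h a ≤ h t} ∩ Set.Icc a b) :=
    (isClosed_le continuous_const hc).inter isClosed_Icc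
  have := hcl.Icc_subset_of_forall_exists_gt (show a ∈ {t | h a ≤ h t} from le_refl (h a)) ?_
  · exact this (Set.right_mem_Icc.2 hab)
  · rintro x ⟨hx, -⟩ y hy
    obtain ⟨z, hz1, hz2⟩ := ((hloc x).and (Ioc_mem_nhdsGT hy)).exists
    exact ⟨z, le_trans hx hz1, hz2⟩

/-! ### Segments -/

/-- The endpoints are determined by the segment as a set; this identifies the vertices of two tiles
that share an edge. -/
lemma left_eq_of_segment_eq {x y x' y' : Fin 2 → ℝ} (h : segment ℝ x y = segment ℝ x' y') :
    x = x' ∨ x = y' := by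
  have hx : x ∈ segment ℝ x' y' := h ▸ left_mem_segment ℝ x y
  have hx' : x' ∈ segment ℝ x y := h ▸ left_mem_segment ℝ x' y'
  have hy' : y' ∈ segment ℝ x y := h ▸ right_mem_segment ℝ x' y'
  obtain ⟨a, b, ha, hb, hab, hx⟩ := hx
  obtain ⟨a1, b1, ha1, hb1, hab1, rfl⟩ := hx'
  obtain ⟨a2, b2, ha2, hb2, hab2, rfl⟩ := hy'
  have e1 : a1 = 1 - b1 := by linarith
  have e2 : a2 = 1 - b2 := by linarith
  have e3 : a = 1 - b := by linarith
  subst e1 e2 e3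
  have h0 : ((1 - b) * b1 + b * b2) • (y - x) = 0 := by
    have : (1 - b) • ((1 - b1) • x + b1 • y) + b • ((1 - b2) • x + b2 • y) =
      x + ((1 - b) * b1 + b * b2) • (y - x) := by module
    rw [this] at hx
    simpa using hx
  rcases smul_eq_zero.1 h0 with h1 | h1
  · by_cases hb0 : b = 0
    · subst hb0
      have : b1 = 0 := by linarith
      left; simp [this]
    · have h2 : 0 ≤ (1 - b) * b1 := mul_nonneg ha hb1
      have h3 : 0 ≤ b * b2 := mul_nonneg hb hb2
      have : b2 = 0 := by
        have : b * b2 = 0 := by linarith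
        exact (mul_eq_zero.1 this).resolve_left hb0
      right; simp [this]
  · have : y = x := sub_eq_zero.1 h1
    subst this
    left; rw [← add_smul]; simp

/-! ### The lift of a tiling -/

/-- The affine lift of a tile. -/
noncomputable def liftAt (v : Fin 4 → Fin 2 → ℝ) (ℓ : (Fin 2 → ℝ) → (Fin 4 → ℤ)) (τ : PlacedTile)
    (P : Fin 2 → ℝ) : Fin 4 → ℝ :=
  intVec (ℓ τ.base) + τ.tile.coordFst v P • e τ.proto.fst + τ.tile.coordSnd v P • e τ.proto.snd

section

variable {v : Fin 4 → Fin 2 → ℝ} {T : Set PlacedTile} {ℓ : (Fin 2 → ℝ) → (Fin 4 → ℤ)}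

lemma IsTiling.det_ne {v : Fin 4 → Fin 2 → ℝ} {ι : Type} {tile : ι → Tile} (h : IsTiling v tile)
    {j k : Fin 4} (hjk : j ≠ k) : det2 (v j) (v k) ≠ 0 :=
  det2_ne_zero_of_linearIndependent (h.noncollinear j k hjk)

lemma IsTiling.tile_det_ne (hT : IsTiling v (fun τ : T => τ.1.tile)) {τ : PlacedTile} (hτ : τ ∈ T) :
    det2 (v τ.tile.fst) (v τ.tile.snd) ≠ 0 :=
  hT.det_ne (ne_of_lt (hT.ordered ⟨τ, hτ⟩))

lemma IsTiling.exists_mem (hT : IsTiling v (fun τ : T => τ.1.tile)) (P : Fin 2 → ℝ) :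
    ∃ τ ∈ T, P ∈ τ.tile.region v := by
  have : P ∈ ⋃ a : T, a.1.tile.region v := by rw [hT.cover]; trivial
  obtain ⟨τ, hτ⟩ := Set.mem_iUnion.1 this
  exact ⟨τ.1, τ.2, hτ⟩

lemma liftAt_apply {τ : PlacedTile} (h : det2 (v τ.tile.fst) (v τ.tile.snd) ≠ 0) (s r : ℝ) :
    liftAt v ℓ τ (τ.base + (s • v τ.proto.fst + r • v τ.proto.snd)) =
      intVec (ℓ τ.base) + s • e τ.proto.fst + r • e τ.proto.snd := by
  unfold liftAt
  have h1 := Tile.coordFst_apply h s r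
  have h2 := Tile.coordSnd_apply h s r
  change τ.tile.coordFst v (τ.base + (s • v τ.proto.fst + r • v τ.proto.snd)) = s at h1
  change τ.tile.coordSnd v (τ.base + (s • v τ.proto.fst + r • v τ.proto.snd)) = r at h2
  rw [h1, h2]

lemma liftAt_vertex (hT : IsTiling v (fun τ : T => τ.1.tile)) (hℓ : IsLift v T ℓ)
    {τ : PlacedTile} (hτ : τ ∈ T) {x : Fin 2 → ℝ} (hx : x ∈ τ.tile.vertices v) :
    liftAt v ℓ τ x = intVec (ℓ x) := by
  have hD := hT.tile_det_ne hτ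
  obtain ⟨h1, h2, h3⟩ := hℓ τ hτ
  rcases hx with rfl | rfl | rfl | rfl
  · have := liftAt_apply (ℓ := ℓ) hD 0 0
    change liftAt v ℓ τ τ.base = intVec (ℓ τ.base)
    simpa using this
  · have := liftAt_apply (ℓ := ℓ) hD 1 0
    simp only [one_smul, zero_smul, add_zero] at this
    change liftAt v ℓ τ (τ.base + v τ.proto.fst) = intVec (ℓ (τ.base + v τ.proto.fst))
    rw [this, h1, intVec_add, intVec_single_one]
  · have := liftAt_apply (ℓ := ℓ) hD 0 1
    simp only [one_smul, zero_smul, add_zero, zero_add] at this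
    change liftAt v ℓ τ (τ.base + v τ.proto.snd) = intVec (ℓ (τ.base + v τ.proto.snd))
    rw [this, h2, intVec_add, intVec_single_one]
  · have := liftAt_apply (ℓ := ℓ) hD 1 1
    simp only [one_smul, ← add_assoc] at this
    change liftAt v ℓ τ (τ.base + v τ.proto.fst + v τ.proto.snd) =
      intVec (ℓ (τ.base + v τ.proto.fst + v τ.proto.snd))
    rw [this, h3, intVec_add, intVec_add, intVec_single_one, intVec_single_one]

lemma Tile.coordFst_sub (v : Fin 4 → Fin 2 → ℝ) (τ : Tile) (P P' : Fin 2 → ℝ) :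
    τ.coordFst v P' - τ.coordFst v P = det2 (P' - P) (v τ.snd) / det2 (v τ.fst) (v τ.snd) := by
  unfold Tile.coordFst
  rw [← sub_div, ← det2_sub_left]
  congr 2; abel

lemma Tile.coordSnd_sub (v : Fin 4 → Fin 2 → ℝ) (τ : Tile) (P P' : Fin 2 → ℝ) :
    τ.coordSnd v P' - τ.coordSnd v P = det2 (v τ.fst) (P' - P) / det2 (v τ.fst) (v τ.snd) := by
  unfold Tile.coordSnd
  rw [← sub_div, ← det2_sub_right]
  congr 2; abel

lemma liftAt_sub (τ : PlacedTile) (P P' : Fin 2 → ℝ) :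
    liftAt v ℓ τ P' - liftAt v ℓ τ P =
      (det2 (P' - P) (v τ.proto.snd) / det2 (v τ.proto.fst) (v τ.proto.snd)) • e τ.proto.fst +
      (det2 (v τ.proto.fst) (P' - P) / det2 (v τ.proto.fst) (v τ.proto.snd)) • e τ.proto.snd := by
  have h1 := Tile.coordFst_sub v τ.tile P P'
  have h2 := Tile.coordSnd_sub v τ.tile P P'
  change _ = det2 (P' - P) (v τ.proto.snd) / det2 (v τ.proto.fst) (v τ.proto.snd) at h1
  change _ = det2 (v τ.proto.fst) (P' - P) / det2 (v τ.proto.fst) (v τ.proto.snd) at h2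
  rw [← h1, ← h2]
  unfold liftAt
  rw [sub_smul, sub_smul]; abel

lemma liftAt_convex (τ : PlacedTile) (x y : Fin 2 → ℝ) {a b : ℝ} (hab : a + b = 1) :
    liftAt v ℓ τ (a • x + b • y) = a • liftAt v ℓ τ x + b • liftAt v ℓ τ y := by
  have h1 := liftAt_sub (v := v) (ℓ := ℓ) τ x (a • x + b • y)
  have h2 := liftAt_sub (v := v) (ℓ := ℓ) τ x y
  have e1 : a = 1 - b := by linarith
  subst e1
  have h3 : (1 - b) • x + b • y - x = b • (y - x) := by module
  rw [h3, det2_smul_left, det2_smul_right, mul_div_assoc, mul_div_assoc, mul_smul, mul_smul,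
    ← smul_add, ← h2] at h1
  rw [← sub_add_cancel (liftAt v ℓ τ ((1 - b) • x + b • y)) (liftAt v ℓ τ x), h1]
  module

lemma exists_vertices_of_mem_edges {τ : Tile} {A : Set (Fin 2 → ℝ)} (h : A ∈ τ.edges v) :
    ∃ x ∈ τ.vertices v, ∃ y ∈ τ.vertices v, A = segment ℝ x y := by
  simp only [Tile.vertices]
  rcases h with rfl | rfl | rfl | rfl
  · exact ⟨_, by simp, _, by simp, rfl⟩
  · exact ⟨_, by simp, _, by simp, rfl⟩
  · exact ⟨_, by simp, _, by simp, rfl⟩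
  · exact ⟨_, by simp, _, by simp, rfl⟩

/-- The lifts of two tiles agree on their intersection. -/
lemma liftAt_eq (hT : IsTiling v (fun τ : T => τ.1.tile)) (hℓ : IsLift v T ℓ)
    {τ τ' : PlacedTile} (hτ : τ ∈ T) (hτ' : τ' ∈ T) {P : Fin 2 → ℝ} (hP : P ∈ τ.tile.region v)
    (hP' : P ∈ τ'.tile.region v) : liftAt v ℓ τ P = liftAt v ℓ τ' P := by
  by_cases hne : τ = τ'
  · rw [hne]
  rcases hT.edge_to_edge ⟨τ, hτ⟩ ⟨τ', hτ'⟩ (fun h => hne (congrArg Subtype.val h)) with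
    h | ⟨x, ⟨hx, hx'⟩, h⟩ | ⟨h, h'⟩
  · have : P ∈ (∅ : Set (Fin 2 → ℝ)) := h ▸ ⟨hP, hP'⟩
    exact absurd this (Set.notMem_empty _)
  · have : P ∈ ({x} : Set (Fin 2 → ℝ)) := h ▸ ⟨hP, hP'⟩
    rw [Set.mem_singleton_iff] at this
    rw [this, liftAt_vertex hT hℓ hτ hx, liftAt_vertex hT hℓ hτ' hx']
  · obtain ⟨x, hx, y, hy, hA⟩ := exists_vertices_of_mem_edges h
    obtain ⟨x', hx', y', hy', hA'⟩ := exists_vertices_of_mem_edges h'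
    have hPs : P ∈ segment ℝ x y := hA ▸ ⟨hP, hP'⟩
    rw [hA] at hA'
    have hxx : x ∈ τ'.tile.vertices v := by
      rcases left_eq_of_segment_eq hA' with rfl | rfl <;> assumption
    have hyy : y ∈ τ'.tile.vertices v := by
      rw [segment_symm] at hA'
      rcases left_eq_of_segment_eq hA' with rfl | rfl <;> assumption
    obtain ⟨a, b, -, -, hab, rfl⟩ := hPs
    rw [liftAt_convex _ _ _ hab, liftAt_convex _ _ _ hab, liftAt_vertex hT hℓ hτ hx,
      liftAt_vertex hT hℓ hτ hy, liftAt_vertex hT hℓ hτ' hxx, liftAt_vertex hT hℓ hτ' hyy]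

/-- `L` is the piecewise affine map of the plane lifting the tiling `T`. -/
def IsSurfaceLift (v : Fin 4 → Fin 2 → ℝ) (T : Set PlacedTile) (ℓ : (Fin 2 → ℝ) → (Fin 4 → ℤ))
    (L : (Fin 2 → ℝ) → Fin 4 → ℝ) : Prop :=
  ∀ τ ∈ T, ∀ P ∈ τ.tile.region v, L P = liftAt v ℓ τ P

lemma exists_isSurfaceLift (hT : IsTiling v (fun τ : T => τ.1.tile)) (hℓ : IsLift v T ℓ) :
    ∃ L, IsSurfaceLift v T ℓ L := by
  choose τ hτ hP using hT.exists_mem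
  exact ⟨fun P => liftAt v ℓ (τ P) P, fun τ' hτ' P hP' => liftAt_eq hT hℓ (hτ P) hτ' (hP P) hP'⟩

/-! ### Local finiteness -/

/-- A Lipschitz constant for the coordinates in the tiles. -/
noncomputable def tileConst (v : Fin 4 → Fin 2 → ℝ) : ℝ :=
  ∑ j, ∑ k, 2 * (‖v j‖ + ‖v k‖) / |det2 (v j) (v k)|

lemma le_tileConst (v : Fin 4 → Fin 2 → ℝ) (j k : Fin 4) :
    2 * (‖v j‖ + ‖v k‖) / |det2 (v j) (v k)| ≤ tileConst v := by
  unfold tileConst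
  have h1 : ∀ j k, 0 ≤ 2 * (‖v j‖ + ‖v k‖) / |det2 (v j) (v k)| := fun j k => by positivity
  refine le_trans ?_ (Finset.single_le_sum (f := fun j => ∑ k, 2 * (‖v j‖ + ‖v k‖) /
    |det2 (v j) (v k)|) (fun j _ => Finset.sum_nonneg fun k _ => h1 j k) (Finset.mem_univ j))
  exact Finset.single_le_sum (f := fun k => 2 * (‖v j‖ + ‖v k‖) / |det2 (v j) (v k)|)
    (fun k _ => h1 j k) (Finset.mem_univ k)

lemma tileConst_nonneg (v : Fin 4 → Fin 2 → ℝ) : 0 ≤ tileConst v :=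
  le_trans (by positivity) (le_tileConst v 0 0)

lemma abs_coordFst_le (v : Fin 4 → Fin 2 → ℝ) (j k : Fin 4) (w : Fin 2 → ℝ) :
    |det2 w (v k) / det2 (v j) (v k)| ≤ tileConst v * ‖w‖ := by
  rw [abs_div]
  calc |det2 w (v k)| / |det2 (v j) (v k)| ≤ (2 * (‖v j‖ + ‖v k‖) * ‖w‖) / |det2 (v j) (v k)| := by
        gcongr
        nlinarith [abs_det2_le w (v k), norm_nonneg w, norm_nonneg (v j),
          mul_nonneg (norm_nonneg w) (norm_nonneg (v j))]
    _ = 2 * (‖v j‖ + ‖v k‖) / |det2 (v j) (v k)| * ‖w‖ := by ring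
    _ ≤ _ := by gcongr; exact le_tileConst v j k

lemma abs_coordSnd_le (v : Fin 4 → Fin 2 → ℝ) (j k : Fin 4) (w : Fin 2 → ℝ) :
    |det2 (v j) w / det2 (v j) (v k)| ≤ tileConst v * ‖w‖ := by
  rw [abs_div]
  calc |det2 (v j) w| / |det2 (v j) (v k)| ≤ (2 * (‖v j‖ + ‖v k‖) * ‖w‖) / |det2 (v j) (v k)| := by
        gcongr
        nlinarith [abs_det2_le (v j) w, norm_nonneg w, norm_nonneg (v k),
          mul_nonneg (norm_nonneg w) (norm_nonneg (v k))]
    _ = 2 * (‖v j‖ + ‖v k‖) / |det2 (v j) (v k)| * ‖w‖ := by ring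
    _ ≤ _ := by gcongr; exact le_tileConst v j k

/-- The type of a tile and the integer part of its position. -/
noncomputable def tileCode (v : Fin 4 → Fin 2 → ℝ) (τ : PlacedTile) : (Fin 4 × Fin 4) × (ℤ × ℤ) :=
  ((τ.proto.fst, τ.proto.snd),
    (⌊det2 τ.base (v τ.proto.snd) / det2 (v τ.proto.fst) (v τ.proto.snd)⌋,
      ⌊det2 (v τ.proto.fst) τ.base / det2 (v τ.proto.fst) (v τ.proto.snd)⌋))

/-- Two tiles of one type whose positions differ by less than 1 in both coordinates would overlap:
the midpoint of their centres, written in each tile as `m1` and `m2`, is interior to both. -/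
lemma tileCode_injOn (hT : IsTiling v (fun τ : T => τ.1.tile)) : Set.InjOn (tileCode v) T := by
  intro τ hτ τ' hτ' h
  by_contra hne
  have hdis := hT.disjoint ⟨τ, hτ⟩ ⟨τ', hτ'⟩ (fun h => hne (congrArg Subtype.val h))
  simp only [tileCode, Prod.mk.injEq] at h
  obtain ⟨⟨hf, hs⟩, h1, h2⟩ := h
  have hD : det2 (v τ.proto.fst) (v τ.proto.snd) ≠ 0 := hT.tile_det_ne hτ
  rw [← hf, ← hs] at h1 h2
  set D := det2 (v τ.proto.fst) (v τ.proto.snd)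
  set α := det2 (τ'.base - τ.base) (v τ.proto.snd) / D
  set β := det2 (v τ.proto.fst) (τ'.base - τ.base) / D
  have hα : |α| < 1 := by
    have := Int.abs_sub_lt_one_of_floor_eq_floor h1
    rwa [abs_sub_comm, ← sub_div, ← det2_sub_left] at this
  have hβ : |β| < 1 := by
    have := Int.abs_sub_lt_one_of_floor_eq_floor h2
    rwa [abs_sub_comm, ← sub_div, ← det2_sub_right] at this
  have hb : τ'.base - τ.base = α • v τ.proto.fst + β • v τ.proto.snd := det2_expand hD _
  rw [abs_lt] at hα hβ
  have m1 := Tile.mem_interior_region (v := v) (τ := τ.tile) (s := (1 + α) / 2) (r := (1 + β) / 2)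
    hD ⟨by linarith, by linarith⟩ ⟨by linarith, by linarith⟩
  have m2 := Tile.mem_interior_region (v := v) (τ := τ'.tile) (s := (1 - α) / 2) (r := (1 - β) / 2)
    (hT.tile_det_ne hτ') ⟨by linarith, by linarith⟩ ⟨by linarith, by linarith⟩
  refine Set.disjoint_left.1 hdis m1 ?_
  convert m2 using 1
  simp only [PlacedTile.tile, ← hf, ← hs]
  have : τ'.base = τ.base + (α • v τ.proto.fst + β • v τ.proto.snd) := by rw [← hb]; abel
  rw [this]; module

lemma finite_meeting_ball (hT : IsTiling v (fun τ : T => τ.1.tile)) (P : Fin 2 → ℝ) :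
    {τ ∈ T | (τ.tile.region v ∩ Metric.ball P 1).Nonempty}.Finite := by
  set K := tileConst v
  -- A point of the ball has tile coordinates at most K(‖P‖+1) before subtracting those of the base;
  -- one unit more is lost inside the tile and one in taking the floor.
  set N : ℤ := ⌈K * (‖P‖ + 1) + 2⌉
  have hfin : (Set.univ ×ˢ (Set.Icc (-N) N ×ˢ Set.Icc (-N) N) :
      Set ((Fin 4 × Fin 4) × (ℤ × ℤ))).Finite :=
    Set.finite_univ.prod ((Set.finite_Icc _ _).prod (Set.finite_Icc _ _))
  refine Set.Finite.of_injOn ?_ ((tileCode_injOn hT).mono fun τ h => h.1) hfin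
  rintro τ ⟨hτ, R, hR, hRP⟩
  rw [Tile.mem_region_iff (hT.tile_det_ne hτ)] at hR
  have hnorm : ‖R‖ ≤ ‖P‖ + 1 := by
    have h1 : ‖R - P‖ < 1 := by rwa [← mem_ball_iff_norm]
    have h2 : ‖R‖ ≤ ‖P‖ + ‖R - P‖ := norm_le_insert' R P
    linarith
  have hK := tileConst_nonneg v
  have hKR : K * ‖R‖ ≤ K * (‖P‖ + 1) := by gcongr
  have hN : K * (‖P‖ + 1) + 2 ≤ N := Int.le_ceil _
  have hbound : ∀ (c : ℝ) (d : ℝ), |c| ≤ K * ‖R‖ → c - d ∈ Set.Icc (0 : ℝ) 1 →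
      ⌊d⌋ ∈ Set.Icc (-N) N := by
    intro c d hc hd
    rw [abs_le] at hc
    have h1 := Int.floor_le d
    have h2 := Int.lt_floor_add_one d
    have h3 : -(N : ℝ) ≤ ⌊d⌋ := by linarith [hd.2]
    have h4 : (⌊d⌋ : ℝ) ≤ N := by linarith [hd.1]
    exact ⟨by exact_mod_cast h3, by exact_mod_cast h4⟩
  refine ⟨trivial, hbound _ _ (abs_coordFst_le v τ.proto.fst τ.proto.snd R) ?_,
    hbound _ _ (abs_coordSnd_le v τ.proto.fst τ.proto.snd R) ?_⟩
  · have := hR.1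
    unfold Tile.coordFst at this
    rwa [det2_sub_left, sub_div] at this
  · have := hR.2
    unfold Tile.coordSnd at this
    rwa [det2_sub_right, sub_div] at this

/-- A point shares a tile with each of its neighbours. -/
lemma eventually_common_tile (hT : IsTiling v (fun τ : T => τ.1.tile)) (P : Fin 2 → ℝ) :
    ∀ᶠ P' in 𝓝 P, ∃ τ ∈ T, P ∈ τ.tile.region v ∧ P' ∈ τ.tile.region v := by
  have hfin := finite_meeting_ball hT P
  set I := {τ ∈ T | (τ.tile.region v ∩ Metric.ball P 1).Nonempty}
  -- Only finitely many tiles come near `P`, so those that miss `P` form a closed set, and a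
  -- neighbourhood of `P` avoids it.
  have hclosed : IsClosed (⋃ τ ∈ {τ ∈ I | P ∉ τ.tile.region v}, τ.tile.region v) := by
    refine (hfin.subset fun τ h => h.1).isClosed_biUnion fun τ hτ => ?_
    have hD := hT.tile_det_ne hτ.1.1
    have : τ.tile.region v = τ.tile.coordFst v ⁻¹' Set.Icc 0 1 ∩ τ.tile.coordSnd v ⁻¹' Set.Icc 0 1 :=
      Set.ext fun Q => Tile.mem_region_iff hD Q
    rw [this]
    exact (isClosed_Icc.preimage (Tile.continuous_coordFst v _)).inter
      (isClosed_Icc.preimage (Tile.continuous_coordSnd v _))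
  have hnot : P ∉ ⋃ τ ∈ {τ ∈ I | P ∉ τ.tile.region v}, τ.tile.region v := by
    simp only [Set.mem_iUnion, not_exists]
    intro τ hτ hP
    exact hτ.2 hP
  filter_upwards [hclosed.isOpen_compl.mem_nhds hnot, Metric.ball_mem_nhds P one_pos] with P' h1 h2
  obtain ⟨τ, hτ, hP'⟩ := hT.exists_mem P'
  refine ⟨τ, hτ, ?_, hP'⟩
  by_contra hP
  apply h1
  simp only [Set.mem_iUnion]
  exact ⟨τ, ⟨⟨hτ, P', hP', h2⟩, hP⟩, hP'⟩

namespace IsSurfaceLift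

variable {L : (Fin 2 → ℝ) → Fin 4 → ℝ}

lemma sub_eq (hL : IsSurfaceLift v T ℓ L) {τ : PlacedTile} (hτ : τ ∈ T) {P P' : Fin 2 → ℝ}
    (hP : P ∈ τ.tile.region v) (hP' : P' ∈ τ.tile.region v) : L P' - L P =
      (det2 (P' - P) (v τ.proto.snd) / det2 (v τ.proto.fst) (v τ.proto.snd)) • e τ.proto.fst +
      (det2 (v τ.proto.fst) (P' - P) / det2 (v τ.proto.fst) (v τ.proto.snd)) • e τ.proto.snd := by
  rw [hL τ hτ P hP, hL τ hτ P' hP', liftAt_sub]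

lemma abs_sub_le_of_common (hT : IsTiling v (fun τ : T => τ.1.tile)) (hL : IsSurfaceLift v T ℓ L)
    {τ : PlacedTile} (hτ : τ ∈ T) {P P' : Fin 2 → ℝ}
    (hP : P ∈ τ.tile.region v) (hP' : P' ∈ τ.tile.region v) (l : Fin 4) :
    |L P' l - L P l| ≤ tileConst v * ‖P' - P‖ := by
  have h := congrFun (hL.sub_eq hτ hP hP') l
  have hne : τ.proto.fst ≠ τ.proto.snd := ne_of_lt (hT.ordered ⟨τ, hτ⟩)
  simp only [Pi.sub_apply, Pi.add_apply, Pi.smul_apply, smul_eq_mul] at h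
  rw [h]
  have h0 : 0 ≤ tileConst v * ‖P' - P‖ := mul_nonneg (tileConst_nonneg v) (norm_nonneg _)
  by_cases h1 : l = τ.proto.fst
  · rw [h1, e_self, e_ne hne, mul_one, mul_zero, add_zero]
    exact abs_coordFst_le v _ _ _
  · by_cases h2 : l = τ.proto.snd
    · rw [h2, e_self, e_ne hne.symm, mul_one, mul_zero, zero_add]
      exact abs_coordSnd_le v _ _ _
    · rw [e_ne h1, e_ne h2]; simpa using h0

lemma continuous (hT : IsTiling v (fun τ : T => τ.1.tile)) (hL : IsSurfaceLift v T ℓ L) :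
    Continuous L := by
  rw [continuous_pi_iff]
  intro l
  rw [continuous_iff_continuousAt]
  intro P
  rw [ContinuousAt, tendsto_iff_dist_tendsto_zero]
  refine squeeze_zero' (Eventually.of_forall fun _ => dist_nonneg)
    (g := fun P' => tileConst v * ‖P' - P‖) ?_ ?_
  · filter_upwards [eventually_common_tile hT P] with P' ⟨τ, hτ, h1, h2⟩
    rw [Real.dist_eq]
    exact hL.abs_sub_le_of_common hT hτ h1 h2 l
  · have : Continuous fun P' : Fin 2 → ℝ => tileConst v * ‖P' - P‖ := by fun_prop
    simpa using this.tendsto P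

/-- A common tile for a point of a line and the points that follow it. -/
lemma eventually_common_line (hT : IsTiling v (fun τ : T => τ.1.tile)) (P w : Fin 2 → ℝ) (t : ℝ) :
    ∀ᶠ t' in 𝓝[>] t, t < t' ∧ ∃ τ ∈ T, P + t • w ∈ τ.tile.region v ∧
      P + t' • w ∈ τ.tile.region v := by
  have hc : Continuous fun t' : ℝ => P + t' • w := by fun_prop
  have := (hc.tendsto t).eventually (eventually_common_tile hT (P + t • w))
  filter_upwards [nhdsWithin_le_nhds this, self_mem_nhdsWithin] with t' h1 h2
  exact ⟨h2, h1⟩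

/-- On a segment, the constant times the distance travelled, plus or minus a coordinate of the lift,
is locally nondecreasing; so the bound inside tiles holds globally with the same constant. -/
lemma abs_sub_le (hT : IsTiling v (fun τ : T => τ.1.tile)) (hL : IsSurfaceLift v T ℓ L)
    (P P' : Fin 2 → ℝ) (l : Fin 4) : |L P' l - L P l| ≤ tileConst v * ‖P' - P‖ := by
  have hLc := hL.continuous hT
  set w := P' - P
  have key : ∀ σ : ℝ, |σ| = 1 → σ * L P l ≤ tileConst v * ‖w‖ + σ * L P' l := by
    intro σ hσ
    have hc : Continuous fun t : ℝ => tileConst v * ‖w‖ * t + σ * L (P + t • w) l := by fun_prop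
    have := le_of_eventually_le hc (fun t => ?_) (zero_le_one' ℝ)
    · simpa [w] using this
    · filter_upwards [eventually_common_line hT P w t] with t' ⟨htt, τ, hτ, h1, h2⟩
      have h3 := hL.abs_sub_le_of_common hT hτ h1 h2 l
      have h4 : P + t' • w - (P + t • w) = (t' - t) • w := by module
      rw [h4, norm_smul, Real.norm_eq_abs, abs_of_pos (by linarith : 0 < t' - t)] at h3
      have h5 := neg_abs_le (σ * (L (P + t' • w) l - L (P + t • w) l))
      rw [abs_mul, hσ, one_mul] at h5
      nlinarith
  have k1 := key 1 (by simp)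
  have k2 := key (-1) (by simp)
  rw [abs_le]
  constructor <;> linarith

end IsSurfaceLift

end

/-- Projecting the lift gives back the plane, up to a translation. -/
lemma IsSurfaceLift.exists_pi_eq {π : (Fin 4 → ℝ) →ₗ[ℝ] (Fin 2 → ℝ)} {T : Set PlacedTile}
    {ℓ : (Fin 2 → ℝ) → (Fin 4 → ℤ)} {L : (Fin 2 → ℝ) → Fin 4 → ℝ}
    (hT : IsTiling (edgeVec π) (fun τ : T => τ.1.tile)) (hL : IsSurfaceLift (edgeVec π) T ℓ L) :
    ∃ κ, ∀ P, π (L P) = P + κ := by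
  have hloc : IsLocallyConstant fun P => π (L P) - P := by
    rw [IsLocallyConstant.iff_eventually_eq]
    intro P
    filter_upwards [eventually_common_tile hT P] with P' ⟨τ, hτ, h1, h2⟩
    have h3 := congrArg π (hL.sub_eq hτ h1 h2)
    rw [map_sub, map_add, map_smul, map_smul] at h3
    have h4 := det2_expand (hT.tile_det_ne hτ) (P' - P)
    have h5 : π (L P') - π (L P) = P' - P := h3.trans h4.symm
    rw [sub_eq_sub_iff_sub_eq_sub, h5]
  refine ⟨π (L 0) - 0, fun P => ?_⟩
  have := hloc.apply_eq_of_preconnectedSpace P 0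
  rw [← this]; abel


/-! ### Approximately affine maps of the plane -/

lemma norm_le_of_det2_le {v : Fin 4 → Fin 2 → ℝ} {j k : Fin 4} (h : det2 (v j) (v k) ≠ 0)
    {w : Fin 2 → ℝ} {B : ℝ} (h1 : |det2 w (v j)| ≤ B) (h2 : |det2 w (v k)| ≤ B) :
    ‖w‖ ≤ B * tileConst v := by
  have hB : 0 ≤ B := (abs_nonneg _).trans h1
  have hD : 0 < |det2 (v j) (v k)| := abs_pos.2 h
  calc ‖w‖ = ‖(det2 w (v k) / det2 (v j) (v k)) • v j +
        (det2 (v j) w / det2 (v j) (v k)) • v k‖ := by rw [← det2_expand h w]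
    _ ≤ |det2 w (v k)| / |det2 (v j) (v k)| * ‖v j‖ +
        |det2 w (v j)| / |det2 (v j) (v k)| * ‖v k‖ := by
      refine (norm_add_le _ _).trans ?_
      rw [norm_smul, norm_smul, Real.norm_eq_abs, Real.norm_eq_abs, abs_div, abs_div,
        det2_swap (v j) w, abs_neg]
    _ ≤ B / |det2 (v j) (v k)| * ‖v j‖ + B / |det2 (v j) (v k)| * ‖v k‖ := by gcongr
    _ = B * ((‖v j‖ + ‖v k‖) / |det2 (v j) (v k)|) := by ring
    _ ≤ B * (2 * (‖v j‖ + ‖v k‖) / |det2 (v j) (v k)|) := by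
      gcongr
      linarith [norm_nonneg (v j), norm_nonneg (v k)]
    _ ≤ _ := by gcongr; exact le_tileConst v j k

/-- A map of the plane sending lines of four directions into strips of four directions is
approximately additive. -/
lemma approx_additive {v f : Fin 4 → Fin 2 → ℝ} (hv : ∀ j k, j ≠ k → det2 (v j) (v k) ≠ 0)
    (hf : ∀ j k, j ≠ k → det2 (f j) (f k) ≠ 0) {Φ : (Fin 2 → ℝ) → Fin 2 → ℝ} {K : ℝ}
    (hK : ∀ k P (t : ℝ), |det2 (Φ (P + t • v k) - Φ P) (f k)| ≤ K) (P P' Q : Fin 2 → ℝ) :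
    ‖(Φ (P' + Q) - Φ P') - (Φ (P + Q) - Φ P)‖ ≤ 8 * K * tileConst f := by
  -- The second difference over a parallelogram is symmetric in its two sides, so it is controlled
  -- against both f_a and f_b, hence in norm.
  have h1 : ∀ a b, a ≠ b → ∀ (s r : ℝ) P, ‖(Φ (P + r • v b + s • v a) - Φ (P + r • v b)) -
      (Φ (P + s • v a) - Φ P)‖ ≤ 2 * K * tileConst f := by
    intro a b hab s r P
    refine norm_le_of_det2_le (hf a b hab) ?_ ?_
    · rw [det2_sub_left]
      refine (abs_sub _ _).trans ?_
      linarith [hK a (P + r • v b) s, hK a P s]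
    · have : (Φ (P + r • v b + s • v a) - Φ (P + r • v b)) - (Φ (P + s • v a) - Φ P) =
        (Φ (P + s • v a + r • v b) - Φ (P + s • v a)) - (Φ (P + r • v b) - Φ P) := by
        rw [add_right_comm]; abel
      rw [this, det2_sub_left]
      refine (abs_sub _ _).trans ?_
      linarith [hK b (P + s • v a) r, hK b P r]
  -- Any change of base point splits into moves along v_b and v_c, so increments along v_a are
  -- almost independent of the base point.
  have h2 : ∀ a b c, a ≠ b → a ≠ c → b ≠ c → ∀ (s : ℝ) P P', ‖(Φ (P' + s • v a) - Φ P') -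
      (Φ (P + s • v a) - Φ P)‖ ≤ 4 * K * tileConst f := by
    intro a b c hab hac hbc s P P'
    have hexp := det2_expand (hv b c hbc) (P' - P)
    set β := det2 (P' - P) (v c) / det2 (v b) (v c)
    set γ := det2 (v b) (P' - P) / det2 (v b) (v c)
    have hP' : P' = P + β • v b + γ • v c := by rw [add_assoc, ← hexp]; abel
    have e1 := h1 a c hac s γ (P + β • v b)
    have e2 := h1 a b hab s β P
    rw [← hP'] at e1
    have e3 := norm_add_le ((Φ (P' + s • v a) - Φ P') -
      (Φ (P + β • v b + s • v a) - Φ (P + β • v b)))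
      ((Φ (P + β • v b + s • v a) - Φ (P + β • v b)) - (Φ (P + s • v a) - Φ P))
    rw [sub_add_sub_cancel] at e3
    linarith
  have hexp := det2_expand (hv 0 1 (by decide)) Q
  set s := det2 Q (v 1) / det2 (v 0) (v 1)
  set r := det2 (v 0) Q / det2 (v 0) (v 1)
  have e1 := h2 0 1 2 (by decide) (by decide) (by decide) s P P'
  have e2 := h2 1 0 2 (by decide) (by decide) (by decide) r (P + s • v 0) (P' + s • v 0)
  have e3 := norm_add_le ((Φ (P' + s • v 0 + r • v 1) - Φ (P' + s • v 0)) -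
    (Φ (P + s • v 0 + r • v 1) - Φ (P + s • v 0)))
    ((Φ (P' + s • v 0) - Φ P') - (Φ (P + s • v 0) - Φ P))
  have e4 : (Φ (P' + Q) - Φ P') - (Φ (P + Q) - Φ P) =
      (Φ (P' + s • v 0 + r • v 1) - Φ (P' + s • v 0)) -
      (Φ (P + s • v 0 + r • v 1) - Φ (P + s • v 0)) +
      ((Φ (P' + s • v 0) - Φ P') - (Φ (P + s • v 0) - Φ P)) := by
    rw [add_assoc P', add_assoc P, ← hexp]; abel
  rw [e4]
  linarith

/-- A Lipschitz approximately additive map is at bounded distance from a linear map. -/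
lemma exists_linear_of_approx_additive {Ψ : (Fin 2 → ℝ) → Fin 2 → ℝ} {M C : ℝ}
    (hM : ∀ P Q, ‖Ψ (P + Q) - Ψ P - Ψ Q‖ ≤ M) (hC : ∀ P, ‖Ψ P‖ ≤ C * ‖P‖) :
    ∃ A : (Fin 2 → ℝ) →ₗ[ℝ] (Fin 2 → ℝ), (∀ P, ‖Ψ P - A P‖ ≤ M) ∧
      ∀ P, Tendsto (fun n : ℕ => ((2 : ℝ) ^ n)⁻¹ • Ψ ((2 : ℝ) ^ n • P)) atTop (𝓝 (A P)) := by
  -- Hyers' dyadic rescaling: its limit is additive, and bounded by the growth hypothesis, hence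
  -- linear.
  let a : ℕ → (Fin 2 → ℝ) → Fin 2 → ℝ := fun n P => ((2 : ℝ) ^ n)⁻¹ • Ψ ((2 : ℝ) ^ n • P)
  have hstep : ∀ P n, dist (a n P) (a (n + 1) P) ≤ M / 2 / 2 ^ n := by
    intro P n
    have h2 : (2 : ℝ) ^ (n + 1) • P = (2 : ℝ) ^ n • P + (2 : ℝ) ^ n • P := by
      rw [pow_succ, mul_two, add_smul]
    have h3 : a (n + 1) P - a n P = ((2 : ℝ) ^ (n + 1))⁻¹ •
        (Ψ ((2 : ℝ) ^ n • P + (2 : ℝ) ^ n • P) - Ψ ((2 : ℝ) ^ n • P) - Ψ ((2 : ℝ) ^ n • P)) := by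
      simp only [a]
      rw [h2, pow_succ, sub_sub, ← two_smul ℝ (Ψ ((2 : ℝ) ^ n • P)), smul_sub, smul_smul, mul_inv,
        mul_assoc, inv_mul_cancel₀ (two_ne_zero), mul_one]
    rw [dist_comm, dist_eq_norm, h3, norm_smul, norm_inv, norm_pow, Real.norm_ofNat]
    calc _ ≤ ((2 : ℝ) ^ (n + 1))⁻¹ * M := by gcongr; exact hM _ _
      _ = _ := by rw [pow_succ]; field_simp
  have hex : ∀ P, ∃ y, Tendsto (fun n => a n P) atTop (𝓝 y) := fun P =>
    cauchySeq_tendsto_of_complete (cauchySeq_of_le_geometric_two (hstep P))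
  choose A₀ hA₀ using hex
  have hM0 : 0 ≤ M := (norm_nonneg _).trans (hM 0 0)
  have hadd : ∀ P Q, A₀ (P + Q) = A₀ P + A₀ Q := by
    intro P Q
    have h1 : Tendsto (fun n => a n (P + Q) - a n P - a n Q) atTop
        (𝓝 (A₀ (P + Q) - A₀ P - A₀ Q)) := ((hA₀ _).sub (hA₀ _)).sub (hA₀ _)
    have h2 : Tendsto (fun n => a n (P + Q) - a n P - a n Q) atTop (𝓝 0) := by
      refine squeeze_zero_norm (a := fun n : ℕ => (1 / 2 : ℝ) ^ n * M) (fun n => ?_) ?_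
      · simp only [a]
        rw [← smul_sub, ← smul_sub, norm_smul, norm_inv, norm_pow, Real.norm_ofNat, smul_add,
          one_div, inv_pow]
        gcongr
        exact hM _ _
      · have := (tendsto_pow_atTop_nhds_zero_of_lt_one (r := (1 / 2 : ℝ)) (by norm_num)
          (by norm_num)).mul_const M
        simpa using this
    have h3 := tendsto_nhds_unique h1 h2
    rw [sub_sub, sub_eq_zero] at h3
    exact h3
  have hbound : ∀ P, ‖A₀ P‖ ≤ C * ‖P‖ := by
    intro P
    refine le_of_tendsto (hA₀ P).norm (Eventually.of_forall fun n => ?_)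
    simp only [a]
    rw [norm_smul, norm_inv, norm_pow, Real.norm_ofNat, inv_mul_le_iff₀ (by positivity)]
    refine (hC _).trans (le_of_eq ?_)
    rw [norm_smul, norm_pow, Real.norm_ofNat]; ring
  let A₁ : (Fin 2 → ℝ) →+ (Fin 2 → ℝ) := AddMonoidHom.mk' A₀ hadd
  have hcont : Continuous A₁ := AddMonoidHomClass.continuous_of_bound A₁ C hbound
  refine ⟨(A₁.toRealLinearMap hcont).toLinearMap, fun P => ?_, fun P => hA₀ P⟩
  have := dist_le_of_le_geometric_two_of_tendsto₀ (hstep P) (hA₀ P)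
  rw [dist_eq_norm] at this
  change ‖Ψ P - A₀ P‖ ≤ M
  simpa [a] using this

/-! ### Corners of tiles and faces -/

/-- The integer offsets of the corners of a face of type `(j, k)`. -/
def offsets (j k : Fin 4) : Set (Fin 4 → ℤ) :=
  {0, Pi.single j 1, Pi.single k 1, Pi.single j 1 + Pi.single k 1}

lemma mem_vertices_iff {π : (Fin 4 → ℝ) →ₗ[ℝ] (Fin 2 → ℝ)} {τ : Tile} {x : Fin 2 → ℝ} :
    x ∈ τ.vertices (edgeVec π) ↔ ∃ δ ∈ offsets τ.fst τ.snd, x = τ.base + π (intVec δ) := by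
  have h0 : intVec 0 = 0 := by ext; simp [intVec]
  simp [Tile.vertices, offsets, edgeVec, intVec_add, intVec_single_one, h0, add_assoc]

lemma offset_eq {j k : Fin 4} {δ : Fin 4 → ℤ} (h : δ ∈ offsets j k) :
    ∃ s ∈ Set.Icc (0 : ℝ) 1, ∃ t ∈ Set.Icc (0 : ℝ) 1, intVec δ = s • e j + t • e k := by
  have h0 : intVec 0 = 0 := by ext; simp [intVec]
  rcases h with rfl | rfl | rfl | rfl
  · exact ⟨0, by simp, 0, by simp, by simp [h0]⟩
  · exact ⟨1, by simp, 0, by simp, by simp [intVec_single_one]⟩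
  · exact ⟨0, by simp, 1, by simp, by simp [intVec_single_one]⟩
  · exact ⟨1, by simp, 1, by simp, by simp [intVec_add, intVec_single_one]⟩

lemma corner_mem_tube {E : AffineSubspace ℝ (Fin 4 → ℝ)} {f : Face} (hf : f ∈ canonicalFaces E)
    {δ : Fin 4 → ℤ} (hδ : δ ∈ offsets f.fst f.snd) : intVec (f.base + δ) ∈ tube E := by
  apply hf.2
  obtain ⟨s, hs, t, ht, h⟩ := offset_eq hδ
  exact ⟨s, hs, t, ht, by rw [intVec_add, h, add_assoc]⟩

lemma mem_region_of_mem_vertices {π : (Fin 4 → ℝ) →ₗ[ℝ] (Fin 2 → ℝ)} {τ : Tile} {x : Fin 2 → ℝ}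
    (hx : x ∈ τ.vertices (edgeVec π)) : x ∈ τ.region (edgeVec π) := by
  obtain ⟨δ, hδ, rfl⟩ := mem_vertices_iff.1 hx
  obtain ⟨s, hs, t, ht, h⟩ := offset_eq hδ
  exact ⟨π (intVec δ), ⟨s, hs, t, ht, by rw [h]; simp [edgeVec]⟩, rfl⟩

lemma IsLift.apply_vertex {π : (Fin 4 → ℝ) →ₗ[ℝ] (Fin 2 → ℝ)} {T : Set PlacedTile}
    {ℓ : (Fin 2 → ℝ) → (Fin 4 → ℤ)} (hℓ : IsLift (edgeVec π) T ℓ) {τ : PlacedTile} (hτ : τ ∈ T)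
    {δ : Fin 4 → ℤ} (hδ : δ ∈ offsets τ.proto.fst τ.proto.snd) :
    ℓ (τ.base + π (intVec δ)) = ℓ τ.base + δ := by
  have h0 : intVec 0 = 0 := by ext; simp [intVec]
  obtain ⟨h1, h2, h3⟩ := hℓ τ hτ
  rcases hδ with rfl | rfl | rfl | rfl
  · simp [h0]
  · rw [intVec_single_one]; exact h1
  · rw [intVec_single_one]; exact h2
  · rw [intVec_add, intVec_single_one, intVec_single_one, map_add, ← add_assoc, ← add_assoc]
    exact h3

/-! ### Ammann bars and planarity of the lift. -/

section

variable {V : Submodule ℝ (Fin 4 → ℝ)} {p : Fin 4 → Fin 4 → ℝ}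
  {π F : (Fin 4 → ℝ) →ₗ[ℝ] (Fin 2 → ℝ)} {t : Fin 4 → ℝ}
  {E : AffineSubspace ℝ (Fin 4 → ℝ)} {T : Set PlacedTile} {ℓ : (Fin 2 → ℝ) → (Fin 4 → ℤ)}
  {L : (Fin 2 → ℝ) → Fin 4 → ℝ}

/-- The vertices of a tiling by the FP-tileset are decorated in each direction. -/
lemma vertex_mem_decoration
    (hT : IsAmmannTiling (edgeVec π) (fun i => π (p i)) (fpTileset π E p) T) (i : Fin 4)
    {τ : PlacedTile} (hτ : τ ∈ T) {x : Fin 2 → ℝ} (hx : x ∈ τ.tile.vertices (edgeVec π)) :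
    x ∈ decoration T i := by
  obtain ⟨f, hf, hfτ⟩ := hT.proto_mem τ hτ
  obtain ⟨δ, hδ, rfl⟩ := mem_vertices_iff.1 hx
  have hfst : τ.proto.fst = f.fst := by rw [← hfτ]; rfl
  have hsnd : τ.proto.snd = f.snd := by rw [← hfτ]; rfl
  have hδ' : δ ∈ offsets f.fst f.snd := by rw [← hfst, ← hsnd]; exact hδ
  refine Set.mem_biUnion hτ ⟨π (intVec δ), ?_, rfl⟩
  rw [← hfτ]
  refine ⟨?_, ?_⟩
  · obtain ⟨s, hs, r, hr, h⟩ := offset_eq hδ'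
    exact ⟨s, hs, r, hr, by rw [h]; simp [edgeVec]⟩
  · refine Set.mem_biUnion hf (Set.mem_biUnion (mem_vertices_iff.2 ⟨δ, hδ', rfl⟩) ⟨0, ?_⟩)
    simp [Face.project]

/-- Along a bar through a vertex, the tiles are placed with respect to this vertex like tiles of the
canonical tiling with respect to one of its vertices. -/
lemma bar_compare (S : LinearSetting V p π F t)
    (hrig : ∀ μ : Fin 4 → ℝ, (∀ j, ∑ k, LinearSetting.conj p t j k •
      (μ k • LinearSetting.conj p t k) = 0) → μ = 0)
    (hT : IsAmmannTiling (edgeVec π) (fun i => π (p i)) (fpTileset π E p) T)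
    (hℓ : IsLift (edgeVec π) T ℓ) (hL : IsSurfaceLift (edgeVec π) T ℓ L) (i : Fin 4)
    {τ₀ : PlacedTile} (hτ₀ : τ₀ ∈ T) {x : Fin 2 → ℝ} (hx : x ∈ τ₀.tile.vertices (edgeVec π))
    (r : ℝ) : ∃ τ ∈ T, x + r • π (e i) ∈ τ.tile.region (edgeVec π) ∧
      ∀ δ ∈ offsets τ.proto.fst τ.proto.snd, ∃ b c : Fin 4 → ℤ, intVec b ∈ tube E ∧
        intVec c ∈ tube E ∧ det2 (F (intVec (ℓ τ.base + δ) - intVec (ℓ x))) (F (e i)) =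
          det2 (F (intVec b - intVec c)) (F (e i)) := by
  obtain ⟨κ, hκ⟩ := hL.exists_pi_eq hT.isTiling
  have hLv : ∀ τ ∈ T, ∀ x ∈ τ.tile.vertices (edgeVec π), π (intVec (ℓ x)) = x + κ := by
    intro τ hτ x hx
    rw [← liftAt_vertex hT.isTiling hℓ hτ hx, ← hL τ hτ x (mem_region_of_mem_vertices hx), hκ]
  have hR : x + r • π (e i) ∈ decoration T i := by
    apply hT.lines i x (vertex_mem_decoration hT i hτ₀ hx)
    refine ⟨r / t i, ?_⟩
    rw [S.pi_p, smul_smul, div_mul_cancel₀ _ (S.t_ne i)]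
  simp only [decoration, Set.mem_iUnion] at hR
  obtain ⟨τ, hτ, z, hz, hzR⟩ := hR
  obtain ⟨f, hf, hfτ⟩ := hT.proto_mem τ hτ
  have hfst : τ.proto.fst = f.fst := by rw [← hfτ]; rfl
  have hsnd : τ.proto.snd = f.snd := by rw [← hfτ]; rfl
  rw [← hfτ] at hz
  obtain ⟨hz1, hz2⟩ := hz
  simp only [ammannLines, Set.mem_iUnion] at hz2
  obtain ⟨f', hf', x', hx', u, hu⟩ := hz2
  obtain ⟨δ', hδ', rfl⟩ := mem_vertices_iff.1 hx'
  set c := f'.base + δ'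
  have hc : intVec c ∈ tube E := corner_mem_tube hf' hδ'
  have hbase : τ.base ∈ τ.tile.vertices (edgeVec π) := by simp [Tile.vertices, PlacedTile.tile]
  refine ⟨τ, hτ, ?_, fun δ hδ => ⟨f.base + δ, c, ?_, hc, ?_⟩⟩
  · refine ⟨z, ?_, hzR⟩
    change z ∈ parallelogram (edgeVec π τ.proto.fst) (edgeVec π τ.proto.snd)
    rw [hfst, hsnd]
    exact hz1
  · apply corner_mem_tube hf
    rwa [← hfst, ← hsnd]
  -- The bar through `x` and the copied canonical bar through `c` meet the tile in a common point.
  -- The integer vector comparing the two positions therefore projects onto the direction of the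
  -- bar, and `F_det_eq_zero` shows that its level is zero.
  · have hlevel : det2 (π (intVec (ℓ x - ℓ τ.base - c + f.base))) (π (e i)) = 0 := by
      have h1 : π (intVec c) = (f'.project π).base + π (intVec δ') := by
        simp only [c, intVec_add, map_add]; rfl
      have h2 : π (intVec (ℓ x - ℓ τ.base - c + f.base)) = (u * t i - r) • π (e i) := by
        rw [intVec_add, intVec_sub, intVec_sub, map_add, map_sub, map_sub, hLv τ₀ hτ₀ x hx,
          hLv τ hτ _ hbase, h1]
        rw [S.pi_p] at hu
        have h3 : π (intVec f.base) = (f'.project π).base + π (intVec δ') + u • t i • π (e i) - z := by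
          rw [← hu]; abel
        have h4 : x = τ.base + z - r • π (e i) := by
          have : τ.base + z = x + r • π (e i) := hzR
          rw [this]; abel
        rw [h3, h4, sub_smul, mul_smul]; abel
      rw [h2, det2_smul_left, det2_self, mul_zero]
    have h5 := S.F_det_eq_zero hrig hlevel
    have h6 : intVec (ℓ τ.base + δ) - intVec (ℓ x) = (intVec (f.base + δ) - intVec c) -
        intVec (ℓ x - ℓ τ.base - c + f.base) := by
      simp only [intVec_add, intVec_sub]; abel
    rw [h6, map_sub, det2_sub_left, h5, sub_zero]

lemma exists_bound_F (F : (Fin 4 → ℝ) →ₗ[ℝ] (Fin 2 → ℝ)) : ∃ C, 0 ≤ C ∧ ∀ x, ‖F x‖ ≤ C * ‖x‖ := by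
  let G := LinearMap.toContinuousLinearMap F
  exact ⟨‖G‖, norm_nonneg _, fun x => G.le_opNorm x⟩

lemma IsSurfaceLift.norm_sub_le (hT : IsTiling (edgeVec π) (fun τ : T => τ.1.tile))
    (hL : IsSurfaceLift (edgeVec π) T ℓ L) (P P' : Fin 2 → ℝ) :
    ‖L P' - L P‖ ≤ tileConst (edgeVec π) * ‖P' - P‖ := by
  rw [pi_norm_le_iff_of_nonneg (mul_nonneg (tileConst_nonneg _) (norm_nonneg _))]
  intro l
  exact hL.abs_sub_le hT P P' l

/-- The lift of a tiling by the FP-tileset stays at bounded distance from the slope. -/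
lemma exists_bound_F_lift (S : LinearSetting V p π F t) (hE : IsCutPlane V E)
    (hπ : IsValidProjection π E)
    (hrig : ∀ μ : Fin 4 → ℝ, (∀ j, ∑ k, LinearSetting.conj p t j k •
      (μ k • LinearSetting.conj p t k) = 0) → μ = 0)
    (hT : IsAmmannTiling (edgeVec π) (fun i => π (p i)) (fpTileset π E p) T)
    (hℓ : IsLift (edgeVec π) T ℓ) (hL : IsSurfaceLift (edgeVec π) T ℓ L) :
    ∃ K, ∀ P, ‖F (L P) - F (L 0)‖ ≤ K := by
  obtain ⟨C, hC0, hC⟩ := exists_bound_F F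
  set K₁ := tileConst (edgeVec π)
  have hK₁ : 0 ≤ K₁ := tileConst_nonneg _
  set N : ℝ := ∑ j, ‖π (e j)‖
  have hN : ∀ j, ‖π (e j)‖ ≤ N := fun j =>
    Finset.single_le_sum (f := fun j => ‖π (e j)‖) (fun j _ => norm_nonneg _) (Finset.mem_univ j)
  set Mf : ℝ := ∑ j, ‖F (e j)‖
  have hMf : ∀ j, ‖F (e j)‖ ≤ Mf := fun j =>
    Finset.single_le_sum (f := fun j => ‖F (e j)‖) (fun j _ => norm_nonneg _) (Finset.mem_univ j)
  have hMf0 : 0 ≤ Mf := (norm_nonneg _).trans (hMf 0)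
  have hN0 : 0 ≤ N := (norm_nonneg _).trans (hN 0)
  have hlip : ∀ P P', ‖F (L P') - F (L P)‖ ≤ C * K₁ * ‖P' - P‖ := by
    intro P P'
    rw [← map_sub, mul_assoc]
    exact (hC _).trans (mul_le_mul_of_nonneg_left (hL.norm_sub_le hT.isTiling P P') hC0)
  have hdetlip : ∀ k P P', ‖P' - P‖ ≤ 2 * N →
      |det2 (F (L P') - F (L P)) (F (e k))| ≤ 2 * (C * K₁ * (2 * N)) * Mf := by
    intro k P P' h
    refine (abs_det2_le _ _).trans ?_
    have h1 := hlip P P'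
    have : ‖F (L P') - F (L P)‖ ≤ C * K₁ * (2 * N) := h1.trans (by gcongr)
    gcongr
    exact hMf k
  have hnear : ∀ τ ∈ T, ∀ P ∈ τ.tile.region (edgeVec π), ‖P - τ.base‖ ≤ 2 * N := by
    rintro τ hτ P ⟨_, ⟨s, hs, r, hr, rfl⟩, rfl⟩
    change ‖τ.base + (s • π (e τ.proto.fst) + r • π (e τ.proto.snd)) - τ.base‖ ≤ 2 * N
    rw [add_sub_cancel_left]
    refine (norm_add_le _ _).trans ?_
    rw [norm_smul, norm_smul, Real.norm_eq_abs, Real.norm_eq_abs, abs_of_nonneg hs.1,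
      abs_of_nonneg hr.1]
    have h1 := mul_le_of_le_one_left (norm_nonneg (π (e τ.proto.fst))) hs.2
    have h2 := mul_le_of_le_one_left (norm_nonneg (π (e τ.proto.snd))) hr.2
    linarith [hN τ.proto.fst, hN τ.proto.snd]
  have hbase : ∀ τ : PlacedTile, τ.base ∈ τ.tile.vertices (edgeVec π) := fun τ => by
    simp [Tile.vertices, PlacedTile.tile]
  -- Bounds the change of level between points at distance at most 2N, in particular between a point
  -- and the base of its tile.
  set K₂ := 2 * (C * K₁ * (2 * N)) * Mf
  obtain ⟨B, hB⟩ : ∃ B, ∀ k, ∑ l, |det2 (F (e l)) (F (e k))| ≤ B :=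
    ⟨∑ k, ∑ l, |det2 (F (e l)) (F (e k))|, fun k =>
      Finset.single_le_sum (f := fun k => ∑ l, |det2 (F (e l)) (F (e k))|)
        (fun k _ => Finset.sum_nonneg fun _ _ => abs_nonneg _) (Finset.mem_univ k)⟩
  -- `P` need not be on a bar: compare it with the base of its tile, follow the bar through that
  -- base, and return, at a cost of three times `K₂`. On the bar, `bar_compare` and `strict_width`
  -- bound the level.
  have hbar : ∀ k P (s : ℝ), |det2 (F (L (P + s • π (e k))) - F (L P)) (F (e k))| ≤
      B + 3 * K₂ := by
    intro k P s
    obtain ⟨τ₀, hτ₀, hP⟩ := hT.isTiling.exists_mem P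
    obtain ⟨τ, hτ, hR, hcorner⟩ := bar_compare S hrig hT hℓ hL k hτ₀ (hbase τ₀) s
    obtain ⟨b, c, hb, hc, hbc⟩ := hcorner 0 (by simp [offsets])
    rw [add_zero] at hbc
    have hLb : ∀ τ ∈ T, L τ.base = intVec (ℓ τ.base) := fun τ hτ => by
      rw [hL τ hτ _ (mem_region_of_mem_vertices (hbase τ)),
        liftAt_vertex hT.isTiling hℓ hτ (hbase τ)]
    change det2 (F (intVec (ℓ τ.base) - intVec (ℓ τ₀.base))) (F (e k)) = _ at hbc
    rw [← hLb τ hτ, ← hLb τ₀ hτ₀, map_sub] at hbc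
    have h1 : |det2 (F (L τ.base) - F (L τ₀.base)) (F (e k))| ≤ B := by
      rw [hbc, abs_le]
      have h2 := S.strict_width hE hπ k hb hc
      have h3 := S.strict_width hE hπ k hc hb
      have h4 : det2 (F (intVec c - intVec b)) (F (e k)) =
          -det2 (F (intVec b - intVec c)) (F (e k)) := by
        rw [← det2_neg_left, ← map_neg, neg_sub]
      have h5 := hB k
      constructor <;> linarith
    set R := τ₀.base + s • π (e k) with hRdef
    have d1 := hdetlip k τ.base R (hnear τ hτ R hR)
    have d2 := hdetlip k τ₀.base P (hnear τ₀ hτ₀ P hP)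
    have d3 := hdetlip k R (P + s • π (e k)) (by
      have : P + s • π (e k) - R = P - τ₀.base := by rw [hRdef]; abel
      rw [this]; exact hnear τ₀ hτ₀ P hP)
    have h6 : F (L (P + s • π (e k))) - F (L P) = (F (L (P + s • π (e k))) - F (L R)) +
        (F (L R) - F (L τ.base)) + (F (L τ.base) - F (L τ₀.base)) - (F (L P) - F (L τ₀.base)) := by
      abel
    rw [h6, det2_sub_left, det2_add_left, det2_add_left]
    rw [abs_le] at h1 d1 d2 d3 ⊢
    constructor <;> linarith
  have hadd := approx_additive (v := fun k => π (e k)) (f := fun k => F (e k))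
    (Φ := fun P => F (L P)) S.pi_det S.F_det' hbar
  obtain ⟨A, hA1, hA2⟩ := exists_linear_of_approx_additive (Ψ := fun P => F (L P) - F (L 0))
    (M := 8 * (B + 3 * K₂) * tileConst (fun k => F (e k))) (C := C * K₁)
    (fun P Q => by
      have := hadd 0 P Q
      rw [zero_add] at this
      convert this using 2
      abel)
    (fun P => by simpa using hlip 0 P)
  -- Strips are invisible at large scale, so the linear part respects the four directions.
  have hdetA : ∀ k, det2 (A (π (e k))) (F (e k)) = 0 := by
    intro k
    have h1 := ((continuous_det2_left (F (e k))).tendsto _).comp (hA2 (π (e k)))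
    refine tendsto_nhds_unique h1 ?_
    refine squeeze_zero_norm (a := fun n : ℕ => (1 / 2 : ℝ) ^ n * (B + 3 * K₂)) (fun n => ?_) ?_
    · simp only [Function.comp]
      rw [det2_smul_left, norm_mul, norm_inv, norm_pow, Real.norm_ofNat, one_div, inv_pow]
      gcongr
      have := hbar k 0 ((2 : ℝ) ^ n)
      rwa [zero_add] at this
    · have := (tendsto_pow_atTop_nhds_zero_of_lt_one (r := (1 / 2 : ℝ)) (by norm_num)
        (by norm_num)).mul_const (B + 3 * K₂)
      simpa using this
  choose a ha using fun k => exists_smul_of_det2_eq_zero (S.F_e_ne k) (hdetA k)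
  -- A vanishes at `π (conj p t j) = 0`. As `F (conj p t k)` is a multiple of `F (e k)`, expanding
  -- this is exactly the image under `F` of the rigidity system; its image under `π` is trivially
  -- zero.
  have hμ : (fun k => -(a k / t k)) = 0 := by
    apply hrig
    intro j
    apply S.eq_zero_of_F_of_pi
    · have h1 : A (π (LinearSetting.conj p t j)) = 0 := by rw [S.pi_conj, map_zero]
      rw [map_eq_sum π, map_sum] at h1
      rw [map_sum, ← h1]
      refine Finset.sum_congr rfl fun k _ => ?_
      rw [map_smul, map_smul, S.F_conj, map_smul, ha, smul_neg, neg_smul, neg_neg]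
      simp only [smul_smul, div_mul_cancel₀ _ (S.t_ne k)]
    · rw [map_sum]
      exact Finset.sum_eq_zero fun k _ => by rw [map_smul, map_smul, S.pi_conj]; simp
  have ha0 : ∀ k, a k = 0 := fun k => by
    have := congrFun hμ k
    simpa [S.t_ne k] using this
  have hA0 : ∀ P, A P = 0 := by
    intro P
    rw [det2_expand (S.pi_det 0 1 (by decide)) P, map_add, map_smul, map_smul, ha, ha, ha0, ha0]
    simp
  refine ⟨8 * (B + 3 * K₂) * tileConst (fun k => F (e k)), fun P => ?_⟩
  have := hA1 P
  rw [hA0, sub_zero] at this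
  exact this

end


/-! ### The shadow of the lifted surface -/

/-- The piecewise affine lift `L` of a tiling, at bounded distance from the kernel of `F`. -/
structure BoundedLift (π F : (Fin 4 → ℝ) →ₗ[ℝ] (Fin 2 → ℝ)) (T : Set PlacedTile)
    (ℓ : (Fin 2 → ℝ) → (Fin 4 → ℤ)) (L : (Fin 2 → ℝ) → Fin 4 → ℝ) (κ : Fin 2 → ℝ) (K : ℝ) :
    Prop where
  tiling : IsTiling (edgeVec π) (fun τ : T => τ.1.tile)
  lift : IsSurfaceLift (edgeVec π) T ℓ L
  pi_eq : ∀ P, π (L P) = P + κ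
  bound : ∀ P, ‖F (L P) - F (L 0)‖ ≤ K

/-- A vector of the space of the `i`-shadows collapsed by `π`, with its orientation. -/
structure IsNormal (π F : (Fin 4 → ℝ) →ₗ[ℝ] (Fin 2 → ℝ)) (i : Fin 4) (n : Fin 4 → ℝ) : Prop where
  pi_eq : π n = 0
  coord : n i = 0
  pos : ∀ l, l ≠ i → 0 < n l * det2 (F (e l)) (F (e i))

lemma exists_bound_of_injective {M : Type*} [NormedAddCommGroup M] [NormedSpace ℝ M]
    (G : (Fin 4 → ℝ) →ₗ[ℝ] M) (hG : ∀ x, G x = 0 → x = 0) : ∃ C, 0 ≤ C ∧ ∀ x, ‖x‖ ≤ C * ‖G x‖ := by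
  obtain ⟨C, -, hC⟩ := LinearMap.exists_antilipschitzWith G (LinearMap.ker_eq_bot'.2 hG)
  refine ⟨C, C.2, fun x => ?_⟩
  have := hC.le_mul_dist x 0
  simpa using this

lemma exists_zero_of_affine_bound {g : ℝ → ℝ} (hg : Continuous g) {a c C : ℝ} (hc : c ≠ 0)
    (h : ∀ s, |g s - a - s * c| ≤ C) : ∃ s, g s = 0 := by
  have h1 := h ((-a - C) / c)
  have h2 := h ((-a + C) / c)
  rw [div_mul_cancel₀ _ hc, abs_le] at h1 h2
  exact mem_range_of_exists_le_of_exists_ge hg ⟨(-a - C) / c, by linarith [h1.2]⟩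
    ⟨(-a + C) / c, by linarith [h2.1]⟩

/-- One corner is at least as far as the given point for every coordinate at once, for the order
given by the signs of `n`. -/
lemma exists_corner_ge {j k : Fin 4} (n : Fin 4 → ℝ) {s r : ℝ} (hs : s ∈ Set.Icc (0 : ℝ) 1)
    (hr : r ∈ Set.Icc (0 : ℝ) 1) :
    ∃ δ ∈ offsets j k, ∀ l, n l * (s • e j + r • e k) l ≤ n l * intVec δ l := by
  refine ⟨(if 0 < n j then Pi.single j 1 else 0) + (if 0 < n k then Pi.single k 1 else 0), ?_, ?_⟩
  · simp only [offsets]; split_ifs <;> simp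
  · intro l
    have key : ∀ (m : Fin 4) (s : ℝ), s ∈ Set.Icc (0 : ℝ) 1 →
        n l * (s * e m l) ≤ n l * intVec (if 0 < n m then Pi.single m 1 else 0) l := by
      intro m s hs
      by_cases hlm : l = m
      · subst hlm
        split_ifs with h
        · simp only [intVec_single_one, e_self, mul_one]
          nlinarith [hs.2]
        · simp only [intVec, Pi.zero_apply, Int.cast_zero, e_self, mul_one, mul_zero]
          nlinarith [hs.1]
      · split_ifs
        · simp [intVec_single_one, e_ne hlm]
        · simp [intVec, e_ne hlm]
    rw [intVec_add]
    simp only [Pi.add_apply, Pi.smul_apply, smul_eq_mul, mul_add]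
    exact add_le_add (key j s hs) (key k r hr)

namespace LinearSetting

variable {V : Submodule ℝ (Fin 4 → ℝ)} {p : Fin 4 → Fin 4 → ℝ}
  {π F : (Fin 4 → ℝ) →ₗ[ℝ] (Fin 2 → ℝ)} {t : Fin 4 → ℝ} {i : Fin 4} {n : Fin 4 → ℝ}

lemma det_normal_pos (hn : IsNormal π F i n) : 0 < det2 (F n) (F (e i)) := by
  obtain ⟨j, k, l, hij, hik, hil, hjk, hjl, hkl⟩ := exists_other_three i
  rw [map_eq_sum, sum_four _ hij hik hil hjk hjl hkl, hn.coord]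
  simp only [det2_add_left, det2_smul_left, zero_mul, zero_add]
  linarith [hn.pos j hij.symm, hn.pos k hik.symm, hn.pos l hil.symm]

lemma normal_ne (hn : IsNormal π F i n) {l : Fin 4} (hl : l ≠ i) : n l ≠ 0 := by
  intro h
  have := hn.pos l hl
  rw [h, zero_mul] at this
  exact lt_irrefl _ this

lemma exists_smul_normal (S : LinearSetting V p π F t) (hn : IsNormal π F i n) {x : Fin 4 → ℝ}
    (hx : π x = 0) (hxi : x i = 0) : ∃ h : ℝ, x = h • n := by
  obtain ⟨l, -, -, hil, -⟩ := exists_other_three i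
  have hl := normal_ne hn hil.symm
  refine ⟨x l / n l, ?_⟩
  refine sub_eq_zero.1 (eq_zero_of_coords S.pi_det (x := x - (x l / n l) • n) ?_ hil ?_ ?_)
  · rw [map_sub, map_smul, hx, hn.pi_eq]; simp
  · simp [hxi, hn.coord]
  · simp [hl]

/-- Otherwise `conj p t i` would be a multiple of `n`; but its image under `F` is parallel to `F (e
i)`, and that of `n` is not. This is the nonzero slope that `exists_above` needs. -/
lemma conj_self_ne (S : LinearSetting V p π F t) (hn : IsNormal π F i n) : p i i - t i ≠ 0 := by
  intro h
  obtain ⟨c, hc⟩ := S.exists_smul_normal hn (S.pi_conj i) (by rw [conj_apply_self, h])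
  have h1 := congrArg (fun x => det2 (F x) (F (e i))) hc
  simp only [S.F_conj, map_smul, det2_neg_left, det2_smul_left, det2_self, mul_zero, neg_zero]
    at h1
  rcases mul_eq_zero.1 h1.symm with h2 | h2
  · exact S.conj_ne i (by rw [hc, h2, zero_smul])
  · exact (det_normal_pos hn).ne' h2

end LinearSetting

/-! ### The shadow as a graph in the normal direction. -/

namespace BoundedLift

variable {V : Submodule ℝ (Fin 4 → ℝ)} {p : Fin 4 → Fin 4 → ℝ}
  {π F : (Fin 4 → ℝ) →ₗ[ℝ] (Fin 2 → ℝ)} {t : Fin 4 → ℝ} {i : Fin 4} {n : Fin 4 → ℝ}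
  {T : Set PlacedTile} {ℓ : (Fin 2 → ℝ) → (Fin 4 → ℤ)} {L : (Fin 2 → ℝ) → Fin 4 → ℝ}
  {κ : Fin 2 → ℝ} {K : ℝ}

lemma continuous (hB : BoundedLift π F T ℓ L κ K) : Continuous L := hB.lift.continuous hB.tiling

lemma pi_omega (hB : BoundedLift π F T ℓ L κ K) (i : Fin 4) (P : Fin 2 → ℝ) :
    π (omega i (L P)) = P + κ - L P i • π (e i) := by
  rw [omega_eq, map_sub, hB.pi_eq, map_smul]

/-- The surface stays near the slope, where moving by `π (e i)` in the plane means moving by `p i /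
t i`; the error has bounded image under `F` and zero image under `π`, and `(F, π)` is injective. -/
lemma exists_line_bound (S : LinearSetting V p π F t) (hB : BoundedLift π F T ℓ L κ K)
    (i : Fin 4) : ∃ C, ∀ P (s : ℝ), |L (P + s • π (e i)) i - L P i - s * (p i i / t i)| ≤ C := by
  obtain ⟨C, hC0, hC⟩ := exists_bound_of_injective (F.prod π) (fun x hx => by
    have hx : (F x, π x) = 0 := hx
    rw [Prod.mk_eq_zero] at hx
    exact S.eq_zero_of_F_of_pi hx.1 hx.2)
  refine ⟨C * (K + K), fun P s => ?_⟩
  set x := L (P + s • π (e i)) - L P - (s / t i) • p i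
  have h1 : π x = 0 := by
    simp only [x, map_sub, map_smul, hB.pi_eq, S.pi_p, smul_smul, div_mul_cancel₀ _ (S.t_ne i)]
    abel
  have h2 : ‖F x‖ ≤ K + K := by
    have : F x = (F (L (P + s • π (e i))) - F (L 0)) - (F (L P) - F (L 0)) := by
      simp only [x, map_sub, map_smul, S.F_p, smul_zero, sub_zero]; abel
    rw [this]
    exact (norm_sub_le _ _).trans (add_le_add (hB.bound _) (hB.bound _))
  have h3 := hC x
  change ‖x‖ ≤ C * ‖(F x, π x)‖ at h3
  rw [h1, Prod.norm_mk, norm_zero, max_eq_left (norm_nonneg _)] at h3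
  have h4 := norm_le_pi_norm x i
  rw [Real.norm_eq_abs] at h4
  have h5 : x i = L (P + s • π (e i)) i - L P i - s * (p i i / t i) := by
    simp only [x, Pi.sub_apply, Pi.smul_apply, smul_eq_mul]; ring
  rw [← h5]
  exact h4.trans (h3.trans (by gcongr))

/-- The shadow of the lifted surface meets each line directed by the normal vector. -/
lemma exists_above (S : LinearSetting V p π F t) (hn : IsNormal π F i n)
    (hB : BoundedLift π F T ℓ L κ K) {z : Fin 4 → ℝ} (hz : z i = 0) :
    ∃ s h : ℝ, omega i (L (π z - κ + s • π (e i))) = z + h • n := by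
  obtain ⟨C, hC⟩ := exists_line_bound S hB i
  set P := π z - κ
  have hLc := hB.continuous
  -- Seek s equal to the i-th coordinate of the lift: then the shadow of the point has the same
  -- image under `π` as `z`, hence differs from it by a multiple of `n`.
  obtain ⟨s, hs⟩ := exists_zero_of_affine_bound (g := fun s => s - L (P + s • π (e i)) i)
    (by fun_prop) (a := -L P i) (c := 1 - p i i / t i) (C := C) (by
      intro h
      apply S.conj_self_ne hn
      have : p i i / t i = 1 := by linarith
      rw [div_eq_one_iff_eq (S.t_ne i)] at this
      linarith) (fun s => by
      rw [← abs_neg]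
      convert hC P s using 2
      ring)
  obtain ⟨h, hh⟩ := S.exists_smul_normal hn
    (x := omega i (L (P + s • π (e i))) - z) (by
      rw [map_sub, hB.pi_omega]
      have : L (P + s • π (e i)) i = s := by linarith
      rw [this]
      simp only [P]; abel) (by simp [omega_apply_self, hz])
  exact ⟨s, h, by rw [← hh]; abel⟩

/-- Along a line of direction `π(e_i)`, the shadow only moves forward. -/
lemma common_tile_bound (hB : BoundedLift π F T ℓ L κ K) {τ : PlacedTile} (hτ : τ ∈ T)
    {P P' : Fin 2 → ℝ} (hP : P ∈ τ.tile.region (edgeVec π)) (hP' : P' ∈ τ.tile.region (edgeVec π))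
    {r : ℝ} (hr : 0 < r) (hPP' : P' - P = r • π (e i)) {l : Fin 4} (hl : l ≠ i) :
    |L P' l - L P l| ≤ tileConst (edgeVec π) * ‖π (e i)‖ * (r - (L P' i - L P i)) := by
  have h := hB.lift.sub_eq hτ hP hP'
  have hne : τ.proto.fst ≠ τ.proto.snd := ne_of_lt (hB.tiling.ordered ⟨τ, hτ⟩)
  have hD : det2 (π (e τ.proto.fst)) (π (e τ.proto.snd)) ≠ 0 := hB.tiling.tile_det_ne hτ
  -- When the tile has an edge of type i, a move by `r • π (e i)` lifts to `r • e i` and both sides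
  -- vanish. Otherwise the i-th coordinate is constant on the tile and the Lipschitz bound applies.
  have flat : L P' - L P = r • e i →
      |L P' l - L P l| ≤ tileConst (edgeVec π) * ‖π (e i)‖ * (r - (L P' i - L P i)) := by
    intro h
    have h1 := congrFun h l
    have h2 := congrFun h i
    simp only [Pi.sub_apply, Pi.smul_apply, smul_eq_mul, e_self, e_ne hl, mul_zero, mul_one]
      at h1 h2
    rw [h1, h2]; simp
  change L P' - L P = (det2 (P' - P) (π (e τ.proto.snd)) /
    det2 (π (e τ.proto.fst)) (π (e τ.proto.snd))) • e τ.proto.fst +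
    (det2 (π (e τ.proto.fst)) (P' - P) /
    det2 (π (e τ.proto.fst)) (π (e τ.proto.snd))) • e τ.proto.snd at h
  by_cases h1 : τ.proto.fst = i
  · apply flat
    rw [h, hPP', h1, det2_smul_left, det2_smul_right, det2_self]
    rw [h1] at hD
    simp [hD]
  by_cases h2 : τ.proto.snd = i
  · apply flat
    rw [h, hPP', h2, det2_smul_left, det2_smul_right, det2_self]
    rw [h2] at hD
    simp [hD]
  have h3 := congrFun h i
  simp only [Pi.sub_apply, Pi.add_apply, Pi.smul_apply, e_ne (Ne.symm h1), e_ne (Ne.symm h2),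
    smul_eq_mul, mul_zero, add_zero] at h3
  have h4 := hB.lift.abs_sub_le_of_common hB.tiling hτ hP hP' l
  rw [hPP', norm_smul, Real.norm_eq_abs, abs_of_pos hr] at h4
  rw [h3]
  linarith

/-- By `common_tile_bound` the excess s - L_i controls the variation of the other coordinates; if it
returns to its initial value, they do not change. -/
lemma eq_of_line (hB : BoundedLift π F T ℓ L κ K) (P : Fin 2 → ℝ) {r : ℝ} (hr : 0 ≤ r)
    (h : L (P + r • π (e i)) i - L P i = r) {l : Fin 4} (hl : l ≠ i) :
    L (P + r • π (e i)) l = L P l := by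
  have hLc := hB.continuous
  set c := tileConst (edgeVec π) * ‖π (e i)‖
  have key : ∀ σ : ℝ, |σ| = 1 → σ * L P l ≤ σ * L (P + r • π (e i)) l := by
    intro σ hσ
    have hc : Continuous fun s : ℝ => c * (s - L (P + s • π (e i)) i) + σ * L (P + s • π (e i)) l := by
      fun_prop
    have := le_of_eventually_le hc (fun s => ?_) hr
    · simp only [zero_smul, add_zero, zero_sub] at this
      have h1 : L (P + r • π (e i)) i = r + L P i := by linarith
      rw [h1] at this
      linarith
    · filter_upwards [IsSurfaceLift.eventually_common_line hB.tiling P (π (e i)) s] with s'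
        ⟨hss, τ, hτ, h1, h2⟩
      have h3 := hB.common_tile_bound hτ h1 h2 (sub_pos.2 hss)
        (by module : P + s' • π (e i) - (P + s • π (e i)) = (s' - s) • π (e i)) hl
      have h5 := neg_abs_le (σ * (L (P + s' • π (e i)) l - L (P + s • π (e i)) l))
      rw [abs_mul, hσ, one_mul] at h5
      nlinarith
  have k1 := key 1 (by simp)
  have k2 := key (-1) (by simp)
  linarith

/-- The shadow of the lifted surface meets each line directed by the normal vector only once. -/
lemma eq_zero_of_above (hn : IsNormal π F i n)
    (hB : BoundedLift π F T ℓ L κ K) {P P' : Fin 2 → ℝ} {h : ℝ}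
    (hPP' : omega i (L P') = omega i (L P) + h • n) : h = 0 := by
  wlog hle : L P i ≤ L P' i generalizing P P' h
  · have := this (P := P') (P' := P) (h := -h) (by rw [hPP']; module) (le_of_not_ge hle)
    linarith
  have h1 := congrArg π hPP'
  rw [map_add, map_smul, hn.pi_eq, hB.pi_omega, hB.pi_omega, smul_zero, add_zero] at h1
  have h2 : P' = P + (L P' i - L P i) • π (e i) := by
    calc P' = P' + κ - L P' i • π (e i) - κ + L P' i • π (e i) := by abel
      _ = P + κ - L P i • π (e i) - κ + L P' i • π (e i) := by rw [h1]
      _ = _ := by rw [sub_smul]; abel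
  obtain ⟨l, -, -, hil, -⟩ := exists_other_three i
  have h3 := hB.eq_of_line P (i := i) (sub_nonneg.2 hle) (by rw [← h2]) hil.symm
  rw [← h2] at h3
  have h4 := congrFun hPP' l
  rw [omega_apply_ne hil.symm, Pi.add_apply, omega_apply_ne hil.symm, h3] at h4
  have h5 : h * n l = 0 := by
    have : (h • n) l = h * n l := rfl
    linarith
  exact (mul_eq_zero.1 h5).resolve_right (LinearSetting.normal_ne hn hil.symm)

/-- The contraction of the direction `π(e_i)` is proper. -/
lemma exists_norm_bound (S : LinearSetting V p π F t) (hn : IsNormal π F i n)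
    (hB : BoundedLift π F T ℓ L κ K) (B : ℝ) :
    ∃ R, ∀ P, ‖π (omega i (L P))‖ ≤ B → ‖P‖ ≤ R := by
  let φ : (Fin 4 → ℝ) →ₗ[ℝ] ℝ :=
    { toFun := fun x => det2 (F x) (F (e i))
      map_add' := fun x y => by rw [map_add, det2_add_left]
      map_smul' := fun r x => by rw [map_smul, det2_smul_left]; rfl }
  have hφ : ∀ x, φ x = det2 (F x) (F (e i)) := fun x => rfl
  -- `π` and the i-th coordinate determine a vector up to a multiple of `n`, and the level `φ`,
  -- nonzero on `n`, removes this ambiguity.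
  obtain ⟨C, hC0, hC⟩ := exists_bound_of_injective
    (π.prod (φ.prod (LinearMap.proj i : (Fin 4 → ℝ) →ₗ[ℝ] ℝ))) (fun x hx => by
    have hx : (π x, (φ x, x i)) = 0 := hx
    simp only [Prod.mk_eq_zero] at hx
    obtain ⟨h1, h2, h3⟩ := hx
    obtain ⟨c, rfl⟩ := S.exists_smul_normal hn h1 h3
    rw [hφ, map_smul, det2_smul_left] at h2
    rw [(mul_eq_zero.1 h2).resolve_right (LinearSetting.det_normal_pos hn).ne', zero_smul])
  obtain ⟨D, hD0, hD⟩ := exists_bound_F F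
  set M := K + ‖F (L 0)‖
  have hM : ∀ P, ‖F (L P)‖ ≤ M := fun P => by
    have h1 := norm_le_insert' (F (L P)) (F (L 0))
    linarith [hB.bound P]
  have hFe : 0 < ‖F (e i)‖ := norm_pos_iff.2 (S.F_e_ne i)
  set X := C * max B (2 * M * ‖F (e i)‖)
  refine ⟨B + ‖κ‖ + (M + D * X) / ‖F (e i)‖ * ‖π (e i)‖, fun P hP => ?_⟩
  have hM0 : 0 ≤ M := (norm_nonneg _).trans (hM P)
  have h1 : ‖omega i (L P)‖ ≤ X := by
    refine (hC _).trans ?_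
    simp only [X]
    gcongr
    change ‖(π (omega i (L P)), (φ (omega i (L P)), omega i (L P) i))‖ ≤ _
    rw [Prod.norm_mk, Prod.norm_mk, omega_apply_self, norm_zero]
    refine max_le (hP.trans (le_max_left _ _)) (max_le ?_ ?_)
    · refine le_trans ?_ (le_max_right _ _)
      rw [hφ, omega_eq, map_sub, map_smul, det2_sub_left, det2_smul_left, det2_self, mul_zero,
        sub_zero, Real.norm_eq_abs]
      refine (abs_det2_le _ _).trans ?_
      gcongr
      exact hM P
    · exact ((norm_nonneg _).trans hP).trans (le_max_left _ _)
  have h2 : |L P i| ≤ (M + D * X) / ‖F (e i)‖ := by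
    rw [le_div_iff₀ hFe, ← Real.norm_eq_abs, ← norm_smul]
    have : L P i • F (e i) = F (L P) - F (omega i (L P)) := by
      rw [omega_eq, map_sub, map_smul]; abel
    rw [this]
    refine (norm_sub_le _ _).trans (add_le_add (hM P) ((hD _).trans ?_))
    gcongr
  have h3 : P = π (omega i (L P)) - κ + L P i • π (e i) := by rw [hB.pi_omega]; abel
  calc ‖P‖ = ‖π (omega i (L P)) - κ + L P i • π (e i)‖ := by rw [← h3]
    _ ≤ ‖π (omega i (L P))‖ + ‖κ‖ + |L P i| * ‖π (e i)‖ := by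
      refine (norm_add_le _ _).trans ?_
      rw [norm_smul, Real.norm_eq_abs]
      gcongr
      exact norm_sub_le _ _
    _ ≤ _ := by gcongr

lemma continuous_omega (i : Fin 4) : Continuous (omega i) := by
  rw [continuous_pi_iff]
  intro j
  by_cases h : j = i
  · simp only [omega, h, if_true]; exact continuous_const
  · simp only [omega, h, if_false]; exact continuous_apply j

/-- Two points of the shadow of the lifted surface are never in strictly increasing position. -/
lemma antichain (S : LinearSetting V p π F t) (hn : IsNormal π F i n)
    (hB : BoundedLift π F T ℓ L κ K) (P₀ P₁ : Fin 2 → ℝ) :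
    ¬ ∀ l, l ≠ i → 0 < n l * (L P₁ l - L P₀ l) := by
  intro hpos
  set A : (Fin 2 → ℝ) → Fin 4 → ℝ := fun P => omega i (L P)
  have hAc : Continuous A := (continuous_omega i).comp hB.continuous
  have hAi : ∀ P, A P i = 0 := fun P => omega_apply_self i _
  have hAl : ∀ P l, l ≠ i → A P l = L P l := fun P l hl => omega_apply_ne hl _
  set d := A P₁ - A P₀
  have hdi : d i = 0 := by simp [d, hAi]
  have hdl : ∀ l, l ≠ i → 0 < n l * d l := fun l hl => by
    simp only [d, Pi.sub_apply, hAl _ l hl]; exact hpos l hl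
  have hπc : Continuous π := π.continuous_of_finiteDimensional
  -- Rate of descent: when the base point moves along `d`, the height of the shadow in the direction
  -- `n` decreases at speed at least δ.
  obtain ⟨δ, hδ, hδ0⟩ : ∃ δ : ℝ, (∀ l, l ≠ i → δ * (n l * n l) ≤ n l * d l) ∧ 0 < δ := by
    have h1 : ∀ᶠ δ : ℝ in 𝓝[>] 0, ∀ l, l ≠ i → δ * (n l * n l) ≤ n l * d l := by
      rw [eventually_all]
      intro l
      by_cases hl : l = i
      · exact Eventually.of_forall fun δ h => absurd hl h
      · have hc : Continuous fun δ : ℝ => δ * (n l * n l) := by fun_prop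
        have := (hc.tendsto 0).eventually (gt_mem_nhds (by simpa using hdl l hl))
        filter_upwards [nhdsWithin_le_nhds this] with δ h _ using h.le
    obtain ⟨δ, h2, h3⟩ := (h1.and self_mem_nhdsWithin).exists
    exact ⟨δ, h2, h3⟩
  obtain ⟨l₀, -, -, hil₀, -⟩ := exists_other_three i
  set H : ℝ × (Fin 2 → ℝ) → ℝ := fun x => (A x.2 l₀ - A P₀ l₀ - x.1 * d l₀) / n l₀
  have hHc : Continuous H := by fun_prop
  have hH : ∀ s P (h : ℝ), A P = A P₀ + s • d + h • n → H (s, P) = h := by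
    intro s P h hP
    have := LinearSetting.normal_ne hn hil₀.symm
    simp only [H, hP, Pi.add_apply, Pi.smul_apply, smul_eq_mul]
    field_simp; ring
  -- Points of the shadow over the segment from `A P₀` to `A P₁` that have descended at the required
  -- rate. Reaching s = 1 gives a negative height over `A P₁`, contradicting uniqueness.
  set Z : Set (ℝ × (Fin 2 → ℝ)) := {x | x.1 ∈ Set.Icc (0 : ℝ) 1 ∧
    A x.2 = A P₀ + x.1 • d + H x • n ∧ H x ≤ -(δ * x.1)}
  obtain ⟨R, hR⟩ := hB.exists_norm_bound S hn (‖π (A P₀)‖ + ‖π d‖)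
  have hbd : ∀ s ∈ Set.Icc (0 : ℝ) 1, ∀ P (h : ℝ), A P = A P₀ + s • d + h • n → ‖P‖ ≤ R := by
    intro s hs P h hP
    apply hR
    change ‖π (A P)‖ ≤ _
    rw [hP, map_add, map_add, map_smul, map_smul, hn.pi_eq, smul_zero, add_zero]
    refine (norm_add_le _ _).trans ?_
    gcongr
    rw [norm_smul, Real.norm_eq_abs, abs_of_nonneg hs.1]
    exact mul_le_of_le_one_left (norm_nonneg _) hs.2
  have hZc : IsCompact Z := by
    refine ((isCompact_Icc (a := (0 : ℝ)) (b := 1)).prod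
      (isCompact_closedBall (0 : Fin 2 → ℝ) R)).of_isClosed_subset ?_ ?_
    · refine (isClosed_Icc.preimage continuous_fst).inter (IsClosed.inter ?_ ?_)
      · exact isClosed_eq (f := fun x : ℝ × (Fin 2 → ℝ) => A x.2)
          (g := fun x => A P₀ + x.1 • d + H x • n) (by fun_prop) (by fun_prop)
      · exact isClosed_le (f := H) (g := fun x => -(δ * x.1)) hHc (by fun_prop)
    · rintro ⟨s, P⟩ ⟨h1, h2, -⟩
      exact ⟨h1, mem_closedBall_zero_iff.2 (hbd s h1 P _ h2)⟩
  have hsub : Set.Icc (0 : ℝ) 1 ⊆ Prod.fst '' Z := by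
    have hcl : IsClosed (Prod.fst '' Z ∩ Set.Icc (0 : ℝ) 1) :=
      ((hZc.image continuous_fst).isClosed).inter isClosed_Icc
    refine hcl.Icc_subset_of_forall_exists_gt ?_ ?_
    · have hA0 : A P₀ = A P₀ + (0 : ℝ) • d + (0 : ℝ) • n := by simp
      have hH0 := hH 0 P₀ 0 hA0
      exact ⟨(0, P₀), ⟨by simp, by rw [hH0]; exact hA0, by rw [hH0]; simp⟩, rfl⟩
    · rintro s ⟨⟨⟨s', Ps⟩, ⟨hs1, hs2, hs3⟩, hss⟩, hs⟩ y hy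
      simp only at hss
      subst hss
      -- approach `s` from the right
      set y' := min y 1
      have hy' : s' < y' := lt_min hy hs.2
      have hseq : ∀ m : ℕ, ∃ P, ∃ h : ℝ,
          A P = A P₀ + (s' + (y' - s') / (m + 1)) • d + h • n := by
        intro m
        obtain ⟨r, h, hh⟩ := hB.exists_above S hn
          (z := A P₀ + (s' + (y' - s') / (m + 1)) • d) (by simp [hAi, hdi])
        exact ⟨_, h, hh⟩
      choose Q h hQ using hseq
      set sm : ℕ → ℝ := fun m => s' + (y' - s') / (m + 1)
      have hsm : ∀ m, sm m ∈ Set.Ioc s' y' := by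
        intro m
        have h1 : 0 < (y' - s') / ((m : ℝ) + 1) := div_pos (by linarith) (by positivity)
        have h2 : (y' - s') / ((m : ℝ) + 1) ≤ y' - s' :=
          div_le_self (by linarith) (by linarith [(Nat.cast_nonneg m : (0 : ℝ) ≤ m)])
        exact ⟨by simp only [sm]; linarith, by simp only [sm]; linarith⟩
      have hsm01 : ∀ m, sm m ∈ Set.Icc (0 : ℝ) 1 := fun m =>
        ⟨hs.1.trans (hsm m).1.le, (hsm m).2.trans (min_le_right _ _)⟩
      have hsmlim : Tendsto sm atTop (𝓝 s') := by
        have h1 : Tendsto (fun m : ℕ => (y' - s') * (1 / ((m : ℝ) + 1))) atTop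
            (𝓝 ((y' - s') * 0)) := tendsto_one_div_add_atTop_nhds_zero_nat.const_mul _
        have h2 := h1.const_add s'
        simpa [sm, div_eq_mul_inv] using h2
      obtain ⟨Pl, -, φ, hφ, hlim⟩ := (isCompact_closedBall (0 : Fin 2 → ℝ) R).tendsto_subseq
        (fun m => mem_closedBall_zero_iff.2 (hbd _ (hsm01 m) (Q m) (h m) (hQ m)))
      have hsl : Tendsto (fun m => sm (φ m)) atTop (𝓝 s') := hsmlim.comp hφ.tendsto_atTop
      -- The limit point lies over parameter `s'`, so uniqueness on normal lines gives it the height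
      -- of `Ps`.
      obtain ⟨h', hh'⟩ := S.exists_smul_normal hn (x := A Pl - A P₀ - s' • d) (by
          have hc : Continuous fun x : ℝ × (Fin 2 → ℝ) => π (A x.2 - A P₀ - x.1 • d) := by fun_prop
          have h1 := (hc.tendsto (s', Pl)).comp (hsl.prodMk_nhds hlim)
          refine tendsto_nhds_unique h1 ?_
          refine tendsto_const_nhds.congr fun m => ?_
          simp only [Function.comp]
          rw [hQ (φ m)]
          have : A P₀ + sm (φ m) • d + h (φ m) • n - A P₀ - sm (φ m) • d = h (φ m) • n := by abel
          change 0 = π (A P₀ + sm (φ m) • d + h (φ m) • n - A P₀ - sm (φ m) • d)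
          rw [this, map_smul, hn.pi_eq, smul_zero]) (by simp [hAi, hdi])
      have hPl : A Pl = A P₀ + s' • d + h' • n := by rw [← hh']; abel
      have heq : h' = H (s', Ps) := by
        have := hB.eq_zero_of_above hn (P := Ps) (P' := Pl) (h := h' - H (s', Ps)) (by
          change A Pl = A Ps + _
          rw [hPl, hs2]; module)
        linarith
      obtain ⟨m, τ, hτ, hm1, hm2⟩ := (hlim.eventually
        (eventually_common_tile hB.tiling Pl)).exists
      -- On a common tile some coordinate other than i is constant; it ties the change of height to
      -- the change of parameter.
      obtain ⟨l, hil, hfl, hsl⟩ := exists_fourth i τ.proto.fst τ.proto.snd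
      have h0 : L (Q (φ m)) l - L Pl l = 0 := by
        have := congrFun (hB.lift.sub_eq hτ hm1 hm2) l
        simpa [e, hfl.symm, hsl.symm] using this
      have h1 := congrFun (hQ (φ m)) l
      have h2 := congrFun hPl l
      change A (Q (φ m)) l = A P₀ l + sm (φ m) * d l + h (φ m) * n l at h1
      change A Pl l = A P₀ l + s' * d l + h' * n l at h2
      rw [hAl _ l hil.symm] at h1 h2
      have h3 : (sm (φ m) - s') * d l + (h (φ m) - h') * n l = 0 := by linarith
      have hnl : 0 < n l * n l := mul_self_pos.2 (LinearSetting.normal_ne hn hil.symm)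
      have h4 := hδ l hil.symm
      have h5 := (hsm (φ m)).1
      have h6 : (h (φ m) - h' + δ * (sm (φ m) - s')) * (n l * n l) ≤ 0 := by
        have e1 : (h (φ m) - h') * (n l * n l) = -((sm (φ m) - s') * (n l * d l)) := by
          have : (h (φ m) - h') * n l = -((sm (φ m) - s') * d l) := by linarith
          calc _ = (h (φ m) - h') * n l * n l := by ring
            _ = _ := by rw [this]; ring
        have e2 : (sm (φ m) - s') * (δ * (n l * n l)) ≤ (sm (φ m) - s') * (n l * d l) :=
          mul_le_mul_of_nonneg_left h4 (by linarith)
        nlinarith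
      have h7 : h (φ m) - h' + δ * (sm (φ m) - s') ≤ 0 := by
        by_contra hc
        push Not at hc
        nlinarith
      have hHm := hH (sm (φ m)) (Q (φ m)) (h (φ m)) (hQ _)
      refine ⟨sm (φ m), ⟨(sm (φ m), Q (φ m)), ⟨hsm01 _, by rw [hHm]; exact hQ _, ?_⟩, rfl⟩,
        (hsm _).1, (hsm _).2.trans (min_le_left _ _)⟩
      rw [hHm]
      simp only
      rw [heq] at h7
      simp only at hs3
      linarith
  obtain ⟨⟨s, P⟩, ⟨-, h2, h3⟩, hs⟩ := hsub (Set.right_mem_Icc.2 zero_le_one)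
  simp only at hs
  subst hs
  have h4 := hB.eq_zero_of_above hn (P := P₁) (P' := P) (h := H (1, P)) (by
    change A P = A P₁ + _
    rw [h2]
    simp only [d, one_smul]
    abel_nf)
  rw [h4] at h3
  linarith

end BoundedLift


/-! ### Periods of the shadow -/

/-- A nonzero integer has absolute value at least 1: this is where integrality turns strict order
into a level difference of at least Σ|f_l|. -/
lemma abs_le_of_int_mul_pos {σ n f : ℝ} {N : ℤ} (hσ : |σ| = 1) (hnf : 0 < n * f)
    (h : 0 < σ * (n * N)) : |f| ≤ σ * (N * f) := by
  have h1 : 0 < σ * (N * f) := by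
    have h2 : 0 < (n * n) * (σ * (N * f)) := by nlinarith [mul_pos hnf h]
    exact pos_of_mul_pos_right h2 (mul_self_nonneg n)
  have hN : N ≠ 0 := by
    rintro rfl
    simp at h
  have hN1 : (1 : ℝ) ≤ |(N : ℝ)| := by exact_mod_cast Int.one_le_abs hN
  rw [← abs_of_pos h1, abs_mul, abs_mul, hσ, one_mul]
  exact le_mul_of_one_le_left (abs_nonneg f) hN1

section

variable {V : Submodule ℝ (Fin 4 → ℝ)} {p : Fin 4 → Fin 4 → ℝ}
  {π F : (Fin 4 → ℝ) →ₗ[ℝ] (Fin 2 → ℝ)} {t : Fin 4 → ℝ} {i : Fin 4} {n : Fin 4 → ℝ}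
  {E : AffineSubspace ℝ (Fin 4 → ℝ)}
  {T : Set PlacedTile} {ℓ : (Fin 2 → ℝ) → (Fin 4 → ℤ)} {L : (Fin 2 → ℝ) → Fin 4 → ℝ}
  {κ : Fin 2 → ℝ} {K : ℝ}

lemma IsSurfaceLift.exists_mem_carrier (hT : IsTiling (edgeVec π) (fun τ : T => τ.1.tile))
    (hL : IsSurfaceLift (edgeVec π) T ℓ L) {τ : PlacedTile} (hτ : τ ∈ T) {P : Fin 2 → ℝ}
    (hP : P ∈ τ.tile.region (edgeVec π)) : ∃ s ∈ Set.Icc (0 : ℝ) 1, ∃ r ∈ Set.Icc (0 : ℝ) 1,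
      L P = intVec (ℓ τ.base) + (s • e τ.proto.fst + r • e τ.proto.snd) := by
  have hL' := hL τ hτ P hP
  obtain ⟨w, ⟨s, hs, r, hr, rfl⟩, rfl⟩ := hP
  refine ⟨s, hs, r, hr, ?_⟩
  rw [hL', ← add_assoc]
  exact liftAt_apply (hT.tile_det_ne hτ) s r

lemma IsSurfaceLift.apply_corner (hT : IsTiling (edgeVec π) (fun τ : T => τ.1.tile))
    (hℓ : IsLift (edgeVec π) T ℓ) (hL : IsSurfaceLift (edgeVec π) T ℓ L) {τ : PlacedTile}
    (hτ : τ ∈ T) {x : Fin 2 → ℝ} (hx : x ∈ τ.tile.vertices (edgeVec π)) :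
    L x = intVec (ℓ x) := by
  rw [hL τ hτ x (mem_region_of_mem_vertices hx), liftAt_vertex hT hℓ hτ hx]

/-- The width of the canonical tilings in the direction of the bars is too small for a corner to
lie strictly above an integer point of the bar. -/
lemma not_corner_above (S : LinearSetting V p π F t) (hE : IsCutPlane V E)
    (hπ : IsValidProjection π E) (hn : IsNormal π F i n) {a x b c : Fin 4 → ℤ} {m : ℤ} {σ : ℝ}
    (hσ : |σ| = 1) (hb : intVec b ∈ tube E) (hc : intVec c ∈ tube E)
    (hbc : det2 (F (intVec a - intVec x)) (F (e i)) = det2 (F (intVec b - intVec c)) (F (e i))) :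
    ¬ ∀ l, l ≠ i → 0 < σ * (n l * (intVec a l - (intVec x l + m * p i l))) := by
  intro h
  have h1 : det2 (F (intVec a - intVec x)) (F (e i)) =
      ∑ l, (intVec a l - (intVec x l + m * p i l)) * det2 (F (e l)) (F (e i)) := by
    -- Subtracting a multiple of `p i` does not change the image under `F`.
    have : F (intVec a - intVec x) = F (intVec a - intVec x - (m : ℝ) • p i) := by
      rw [map_sub F _ ((m : ℝ) • p i), map_smul, S.F_p, smul_zero, sub_zero]
    rw [this, map_eq_sum, det2_sum_left]
    refine Finset.sum_congr rfl fun l _ => ?_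
    rw [det2_smul_left]
    simp only [Pi.sub_apply, Pi.smul_apply, smul_eq_mul]
    ring
  have h2 : ∑ l, |det2 (F (e l)) (F (e i))| ≤ σ * det2 (F (intVec b - intVec c)) (F (e i)) := by
    rw [← hbc, h1, Finset.mul_sum]
    refine Finset.sum_le_sum fun l _ => ?_
    by_cases hl : l = i
    · subst hl; simp [det2_self]
    · obtain ⟨q, hq⟩ := S.coord_int hl
      have hN : intVec a l - (intVec x l + m * p i l) = ((a l - (x l + m * q) : ℤ) : ℝ) := by
        rw [hq]; simp [intVec]
      have := h l hl
      rw [hN] at this ⊢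
      exact abs_le_of_int_mul_pos hσ (hn.pos l hl) this
  rcases eq_or_eq_neg_of_abs_eq hσ with rfl | rfl
  · have := S.strict_width hE hπ i hb hc
    linarith
  · have := S.strict_width hE hπ i hc hb
    rw [← neg_sub, map_neg, det2_neg_left] at this
    linarith

/-- The subperiod translates the shadow of each vertex to a point of the shadow. -/
lemma BoundedLift.exists_vertex_add (S : LinearSetting V p π F t) (hE : IsCutPlane V E)
    (hπ : IsValidProjection π E)
    (hrig : ∀ μ : Fin 4 → ℝ, (∀ j, ∑ k, LinearSetting.conj p t j k •
      (μ k • LinearSetting.conj p t k) = 0) → μ = 0)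
    (hT : IsAmmannTiling (edgeVec π) (fun i => π (p i)) (fpTileset π E p) T)
    (hℓ : IsLift (edgeVec π) T ℓ) (hn : IsNormal π F i n) (hB : BoundedLift π F T ℓ L κ K)
    {τ₀ : PlacedTile} (hτ₀ : τ₀ ∈ T) {x : Fin 2 → ℝ} (hx : x ∈ τ₀.tile.vertices (edgeVec π))
    (m : ℤ) : ∃ P, omega i (L P) = omega i (L x) + (m : ℝ) • omega i (p i) := by
  set z := omega i (L x) + (m : ℝ) • omega i (p i)
  have hzi : z i = 0 := by simp [z, omega_apply_self]
  have hLx := hB.lift.apply_corner hB.tiling hℓ hτ₀ hx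
  have hzl : ∀ l, l ≠ i → z l = intVec (ℓ x) l + m * p i l := fun l hl => by
    simp only [z, Pi.add_apply, Pi.smul_apply, smul_eq_mul, omega_apply_ne hl, hLx]
  obtain ⟨s, h, hsh⟩ := hB.exists_above S hn hzi
  -- The candidate point lies on the line of direction `π (e i)` through `x`, that is, on its bar.
  have hR : π z - κ + s • π (e i) = x + (s - L x i + m * (t i - p i i)) • π (e i) := by
    simp only [z, map_add, map_smul, hB.pi_omega, omega_eq i (p i), map_sub, S.pi_p]
    module
  rw [hR] at hsh
  obtain ⟨τ, hτ, hreg, hcmp⟩ := bar_compare S hrig hT hℓ hB.lift i hτ₀ hx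
    (s - L x i + m * (t i - p i i))
  obtain ⟨a, ha, b, hb, hab⟩ := hB.lift.exists_mem_carrier hB.tiling hτ hreg
  have hcoord : ∀ l, l ≠ i → (a • e τ.proto.fst + b • e τ.proto.snd) l =
      z l + h * n l - intVec (ℓ τ.base) l := fun l hl => by
    have h1 := congrFun hsh l
    rw [omega_apply_ne hl, hab] at h1
    have h2 : (z + h • n) l = z l + h * n l := rfl
    rw [← h2, ← h1, Pi.add_apply (intVec _)]
    ring
  have hnot : ∀ σ : ℝ, |σ| = 1 → σ * h ≤ 0 := by
    intro σ hσ
    by_contra hpos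
    push Not at hpos
    -- If `h` had the sign of σ, the corner of the tile farthest in the direction `σ • n` would be
    -- strictly beyond `z` in all three coordinates.
    obtain ⟨δ, hδ, hδl⟩ := exists_corner_ge (j := τ.proto.fst) (k := τ.proto.snd) (σ • n) ha hb
    obtain ⟨b', c', hb', hc', hbc⟩ := hcmp δ hδ
    refine not_corner_above (m := m) S hE hπ hn hσ hb' hc' hbc fun l hl => ?_
    have h1 := hδl l
    rw [hcoord l hl, hzl l hl] at h1
    have h2 : 0 < n l * n l := mul_self_pos.2 (LinearSetting.normal_ne hn hl)
    have h3 := mul_pos hpos h2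
    rw [intVec_add, Pi.add_apply]
    simp only [Pi.smul_apply, smul_eq_mul] at h1
    nlinarith
  have h0 : h = 0 := by
    have h1 := hnot 1 (by simp)
    have h2 := hnot (-1) (by simp)
    linarith
  exact ⟨_, by rw [hsh, h0, zero_smul, add_zero]⟩

/-- The subperiods translate the shadow of the lifted surface into itself. -/
lemma BoundedLift.shadow_add_mem (S : LinearSetting V p π F t) (hE : IsCutPlane V E)
    (hπ : IsValidProjection π E)
    (hrig : ∀ μ : Fin 4 → ℝ, (∀ j, ∑ k, LinearSetting.conj p t j k •
      (μ k • LinearSetting.conj p t k) = 0) → μ = 0)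
    (hT : IsAmmannTiling (edgeVec π) (fun i => π (p i)) (fpTileset π E p) T)
    (hℓ : IsLift (edgeVec π) T ℓ) (hn : IsNormal π F i n) (hB : BoundedLift π F T ℓ L κ K)
    (m : ℤ) {y : Fin 4 → ℝ} (hy : y ∈ shadow i (liftedSurface T ℓ)) :
    y + (m : ℝ) • omega i (p i) ∈ shadow i (liftedSurface T ℓ) := by
  obtain ⟨Y, hY, rfl⟩ := hy
  simp only [liftedSurface, Set.mem_iUnion] at hY
  obtain ⟨τ, hτ, a, ha, b, hb, hab⟩ := hY
  obtain ⟨s, h, hsh⟩ := hB.exists_above S hn (z := omega i Y + (m : ℝ) • omega i (p i))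
    (by simp [omega_apply_self])
  set R := π (omega i Y + (m : ℝ) • omega i (p i)) - κ + s • π (e i)
  have hnot : ∀ σ : ℝ, |σ| = 1 → 0 < σ * h →
      ∃ P, ∀ l, l ≠ i → 0 < σ * (n l * (L R l - L P l)) := by
    intro σ hσ hpos
    -- Now the corner of the initial face lying farthest back, opposite to `σ • n`: its translate is
    -- in the shadow, strictly behind the point at `R`, which `antichain` forbids.
    obtain ⟨δ, hδ, hδl⟩ := exists_corner_ge (j := τ.proto.fst) (k := τ.proto.snd) (-σ • n) ha hb
    have hx : τ.base + π (intVec δ) ∈ τ.tile.vertices (edgeVec π) :=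
      mem_vertices_iff.2 ⟨δ, hδ, rfl⟩
    have hLx := hB.lift.apply_corner hB.tiling hℓ hτ hx
    rw [hℓ.apply_vertex hτ hδ] at hLx
    obtain ⟨P, hP⟩ := hB.exists_vertex_add S hE hπ hrig hT hℓ hn hτ hx m
    refine ⟨P, fun l hl => ?_⟩
    have h1 := congrFun hsh l
    have h2 := congrFun hP l
    have h3 := hδl l
    simp only [Pi.add_apply, Pi.smul_apply, smul_eq_mul, omega_apply_ne hl, hLx, intVec_add]
      at h1 h2 h3
    have h4 := congrFun hab l
    simp only [Pi.add_apply, Pi.smul_apply, smul_eq_mul] at h4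
    have h5 : 0 < n l * n l := mul_self_pos.2 (LinearSetting.normal_ne hn hl)
    have h6 := mul_pos hpos h5
    rw [h1, h2, h4]
    nlinarith
  have h0 : h = 0 := by
    rcases lt_trichotomy h 0 with hneg | h0 | hpos
    · obtain ⟨P, hP⟩ := hnot (-1) (by simp) (by linarith)
      exact absurd (fun l hl => by linarith [hP l hl]) (hB.antichain S hn R P)
    · exact h0
    · obtain ⟨P, hP⟩ := hnot 1 (by simp) (by linarith)
      exact absurd (fun l hl => by linarith [hP l hl]) (hB.antichain S hn P R)
  rw [h0, zero_smul, add_zero] at hsh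
  obtain ⟨τ', hτ', hR⟩ := hB.tiling.exists_mem R
  obtain ⟨a', ha', b', hb', hab'⟩ := hB.lift.exists_mem_carrier hB.tiling hτ' hR
  refine ⟨L R, ?_, hsh⟩
  simp only [liftedSurface, Set.mem_iUnion]
  exact ⟨τ', hτ', a', ha', b', hb', by rw [hab', add_assoc]⟩

end

lemma exists_eq_smul_of_collinear {M : Type*} [AddCommGroup M] [Module ℝ M] {x y : M} (hy : y ≠ 0)
    (h : Collinear ℝ {0, x, y}) : ∃ r : ℝ, x = r • y := by
  obtain ⟨v, hv⟩ := (collinear_iff_of_mem (Set.mem_insert 0 _)).1 h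
  obtain ⟨a, ha⟩ := hv x (by simp)
  obtain ⟨b, hb⟩ := hv y (by simp)
  simp only [vadd_eq_add, add_zero] at ha hb
  have hb0 : b ≠ 0 := by
    rintro rfl
    exact hy (by rw [hb, zero_smul])
  exact ⟨a / b, by rw [ha, hb, smul_smul, div_mul_cancel₀ _ hb0]⟩

/-- A subperiod is not a proper multiple of an integer vector. -/
lemma IsSubperiod.eq_one {V : Submodule ℝ (Fin 4 → ℝ)} (hdim : Module.finrank ℝ V = 2)
    {E : AffineSubspace ℝ (Fin 4 → ℝ)} (hE : IsCutPlane V E) {i : Fin 4} {p : Fin 4 → ℝ}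
    (hp : IsSubperiod V i p) {r : Fin 4 → ℤ} {n : ℕ} (h : omega i p = n • intVec r) : n = 1 := by
  obtain ⟨-, hne, -, hprim⟩ := hp.2 E hE
  have hn : (n : ℝ) ≠ 0 := by
    intro hn
    apply hne
    rw [h, ← Nat.cast_smul_eq_nsmul ℝ, hn, zero_smul]
  have hr : omega i ((n : ℝ)⁻¹ • p) = intVec r := by
    rw [omega_smul, h, ← Nat.cast_smul_eq_nsmul ℝ, inv_smul_smul₀ hn]
  refine hprim _ ⟨r, rfl⟩ ?_ n h
  -- `r` is the shadow of `p / n`, which lies in `V`, so it is itself a period and primality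
  -- applies.
  rw [← hr]
  exact isPeriod_shadow hdim hE (V.smul_mem _ hp.1) ⟨r, hr.symm⟩

end FPTiling

theorem mainTheorem3
    (V : Submodule ℝ (Fin 4 → ℝ)) (hdim : Module.finrank ℝ V = 2)
    (hirr : TotallyIrrational V)
    (p : Fin 4 → Fin 4 → ℝ) (hchar : IsCharacterizedBySubperiods V p)
    (E : AffineSubspace ℝ (Fin 4 → ℝ)) (hE : IsCutPlane V E)
    (π : (Fin 4 → ℝ) →ₗ[ℝ] (Fin 2 → ℝ)) (hπ : IsFineProjection π E p)
    (T : Set PlacedTile)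
    (hT : IsAmmannTiling (edgeVec π) (fun i => π (p i)) (fpTileset π E p) T)
    (ℓ : (Fin 2 → ℝ) → (Fin 4 → ℤ)) (hℓ : IsLift (edgeVec π) T ℓ)
    (i : Fin 4) :
    IsPeriod (shadow i (liftedSurface T ℓ)) (omega i (p i)) := by
  obtain ⟨F, hF⟩ := exists_linearMap_ker hdim
  have hdet : ∀ j k, j ≠ k → det2 (π (e j)) (π (e k)) ≠ 0 := fun j k hjk =>
    det2_ne_zero_of_linearIndependent (hπ.1.noncollinear j k hjk)
  have hπe : ∀ k, π (e k) ≠ 0 := fun k h => by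
    obtain ⟨j, -, -, hkj, -⟩ := exists_other_three k
    exact hdet k j hkj (by rw [h, det2_zero_left])
  choose t ht using fun k => exists_eq_smul_of_collinear (hπe k) (hπ.2 k)
  have S : LinearSetting V p π F t :=
    { dim := hdim
      irr := hirr
      mem_iff := hF
      p_mem := fun k => (hchar.1 k).1
      omega_mem := fun k => ((hchar.1 k).2 E hE).1
      omega_ne := fun k => ((hchar.1 k).2 E hE).2.1
      pi_det := hdet
      pi_inj := fun x => hπ.1.eq_zero hdim hE
      pi_p := ht }
  have hrig := fun μ => S.rigid (fun k r n => (hchar.1 k).eq_one hdim hE) hchar.2 (μ := μ)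
  obtain ⟨L, hL⟩ := exists_isSurfaceLift hT.isTiling hℓ
  obtain ⟨κ, hκ⟩ := hL.exists_pi_eq hT.isTiling
  obtain ⟨K, hK⟩ := exists_bound_F_lift S hE hπ.1 hrig hT hℓ hL
  obtain ⟨n, hn⟩ := S.exists_normal hE hπ.1 i
  have hB : BoundedLift π F T ℓ L κ K := ⟨hT.isTiling, hL, hκ, hK⟩
  have key := fun (m : ℤ) (y : Fin 4 → ℝ) =>
    hB.shadow_add_mem S hE hπ.1 hrig hT hℓ ⟨hn.1, hn.2.1, hn.2.2⟩ m (y := y)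
  intro y
  refine ⟨fun h => ?_, fun h => ?_⟩
  · simpa using key (-1) _ h
  · simpa using key 1 _ h
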